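/- Let $p$ be a prime. For $h\ge 0$ let $\Sigma_h$ be the set of all unions of balls $a+p^h\mathbb Z_p\subset\mathbb Q_p$, and let $\Sigma_{\rm unif}=\bigcup_h\Sigma_h$. For $k=\mathbb Z_p$ ($p$-adic topology) or $k=\mathbb F_p$ (discrete topology) let $\mathscr D_{\rm unif}(\mathbb Q_p,k)$ be the set of maps $\mu:\Sigma_{\rm unif}\to k$ such that, for every $h$ and every disjoint family $(U_\alpha)$ in $\Sigma_h$, the series $\sum_\alpha\mu(U_\alpha)$ converges unconditionally to $\mu(\bigcup_\alpha U_\alpha)$. It is a commutative ring under convolution, with unit the Dirac mass at $0$; its natural topology is that of uniform convergence on each $\Sigma_h$. Let $\Delta_a$ (resp. $\delta_a$) be the $\mathbb Z_p$-valued (resp. $\mathbb F_p$-valued) Dirac mass at $a\in\mathbb Q_p$; put $t_n=\delta_{1/p^n}-\delta_0$, $t=t_0$, $T_n=\Delta_{1/p^n}-\Delta_0$, $T=T_0$. For a ring $R$, let $R[X^{1/p^\infty}]$ be the ring with $R$-basis the monomials $X^q$, $q\in\mathbb Z[1/p]$, $q\ge0$. "Completion" means separated completion as a topological ring. 1. The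 natural topology of $\mathscr D_{\rm unif}(\mathbb Q_p,\mathbb F_p)$ is the $t$-adic one. The group algebra $\mathbb F_p[\mathbb Q_p]$ embeds in $\mathscr D_{\rm unif}(\mathbb Q_p,\mathbb F_p)$ via Dirac masses, and $\mathscr D_{\rm unif}(\mathbb Q_p,\mathbb F_p)$ is its completion for the topology induced by the $t$-adic topology of $\mathscr D_{\rm unif}(\mathbb Q_p,\mathbb F_p)$. Moreover $\mathscr D_{\rm unif}(\mathbb Q_p,\mathbb F_p)$ is the completion of the group algebra $\mathbb F_p[\mathbb Z[1/p]]$ in its own $(\delta_1-\delta_0)$-adic topology, and the completion of $\mathbb F_p[t^{1/p^\infty}]$ (embedded by $t^{1/p^n}\mapsto t_n$) in its own $t$-adic topology. In particular it is a perfect ring of characteristic $p$. 2. $\mathscr D_{\rm unif}(\mathbb Q_p,\mathbb Z_p)$ is $p$-adically separated and complete, and reduction modulo $p$ of measures induces an isomorphism $\mathscr D_{\rm unif}(\mathbb Q_p,\mathbb Z_p)/p\cong\mathscr D_{\rm unif}(\mathbb Q_p,\mathbb F_p)$. So $\mathscr D_{\rm unif}(\mathbb Q_p,\mathbb Z_p)$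 is a strict $p$-ring, and there is a unique ring isomorphism $e:\mathscr D_{\rm unif}(\mathbb Q_p,\mathbb Z_p)\to W(\mathscr D_{\rm unif}(\mathbb Q_p,\mathbb F_p))$ whose $0$-th Witt component is reduction modulo $p$. By 1, this ring is identified with $\mathbf A_{\inf}$, the ring of Witt vectors of the $t$-adic completion of $\mathbb F_p[t^{1/p^\infty}]$. 3. The natural topology of $\mathscr D_{\rm unif}(\mathbb Q_p,\mathbb Z_p)$ is the $(p,T)$-adic one. The group algebra $\mathbb Z[\mathbb Q_p]$ embeds in $\mathscr D_{\rm unif}(\mathbb Q_p,\mathbb Z_p)$ via Dirac masses, and $\mathscr D_{\rm unif}(\mathbb Q_p,\mathbb Z_p)$ is its completion for the topology induced by the $(p,T)$-adic topology of $\mathscr D_{\rm unif}(\mathbb Q_p,\mathbb Z_p)$. Moreover $\mathscr D_{\rm unif}(\mathbb Q_p,\mathbb Z_p)$ is the completion of the group algebra $\mathbb Z[\mathbb Z[1/p]]$ in its own $(p,\Delta_1-\Delta_0)$-adic topology. 4. For every $n\ge0$ the sequence $T_{n+m}^{p^m}$ converges $p$-adically, as $m\to\infty$, to $\widetilde T_n=e^{-1}([t_n])$,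 where $[\,\cdot\,]$ is the Teichmüller lift, and $t_n^{p^n}=t$, i.e. $t_n=t^{1/p^n}$. Put $\widetilde T=\widetilde T_0$. For $n\ge1$, $\widetilde T_n$ is the only $p^n$-th root of $\widetilde T$ in $\mathscr D_{\rm unif}(\mathbb Q_p,\mathbb Z_p)$ if $p$ is odd, and the $2^n$-th roots of $\widetilde T$ are exactly $\pm\widetilde T_n$ if $p=2$. The map $X^{1/p^n}\mapsto\widetilde T_n$ embeds $\mathbb Z[X^{1/p^\infty}]$ in $\mathscr D_{\rm unif}(\mathbb Q_p,\mathbb Z_p)$ as a subring $\mathbb Z[\widetilde T^{1/p^\infty}]$, and $\mathscr D_{\rm unif}(\mathbb Q_p,\mathbb Z_p)$ with its natural topology, which is the $(p,\widetilde T)$-adic one, is the completion of this subring in its own $(p,\widetilde T)$-adic topology. 5. The isomorphism $e$ is a homeomorphism (a) for the $p$-adic topologies on both sides (on the Witt vectors this is also the product topology of the discrete topologies), and (b) for the natural topology of $\mathscr D_{\rm unif}(\mathbb Q_p,\mathbb Z_p)$ and the product topology on the Witt vectors coming from the natural topology of $\mathscr D_{\rm unif}(\mathbb Q_p,\mathbb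 F_p)$. -/

import Mathlib

open Filter Topology

namespace DiscreteMeasure

variable {G H k : Type} [CommRing k] [UniformSpace k]

/-- A `k`-valued measure on the discrete set `G`: for every disjoint family of subsets the series
of the values converges unconditionally to the value on the union. -/
def IsMeas (m : Set G → k) : Prop :=
  ∀ (A : Type) (V : A → Set G), Pairwise (fun a b => Disjoint (V a) (V b)) →
    HasSum (fun a => m (V a)) (m (⋃ a, V a))

/-- The integral of an arbitrary function on a discrete set. -/
noncomputable def integral (m : Set G → k) (F : G → k) : k := ∑' d, m {d} * F d

/-- The convolution of two measures on a discrete abelian group: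
`V ↦ ∫ n (V - x) dm(x)`, i.e. the push-forward of the product measure under addition. -/
noncomputable def conv [AddCommGroup G] (m n : Set G → k) (V : Set G) : k :=
  integral m fun d => n {e | d + e ∈ V}

variable [IsUniformAddGroup k] [IsTopologicalRing k] [IsLinearTopology k k]
  [CompleteSpace k] [T2Space k]

theorem nonarch : NonarchimedeanAddGroup k where
  is_nonarchimedean U hU := by
    obtain ⟨I, hI, hIU⟩ := (IsLinearTopology.hasBasis_open_ideal (R := k)).mem_iff.1 hU
    exact ⟨⟨I.toAddSubgroup, hI⟩, hIU⟩

theorem summable_of_ideals {A : Type} (f : A → k)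
    (h : ∀ I : Ideal k, IsOpen (I : Set k) → {a | f a ∉ I}.Finite) : Summable f := by
  have := nonarch (k := k)
  apply NonarchimedeanAddGroup.summable_of_tendsto_cofinite_zero
  rw [(IsLinearTopology.hasBasis_open_ideal (R := k)).tendsto_right_iff]
  intro I hI
  simpa [Filter.eventually_cofinite] using h I hI

theorem finite_of_hasSum {A : Type} {f : A → k} {s : k} (h : HasSum f s)
    (I : Ideal k) (hI : IsOpen (I : Set k)) : {a | f a ∉ I}.Finite := by
  have := h.summable.tendsto_cofinite_zero (hI.mem_nhds (by simp))
  exact this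

theorem IsMeas.finite {m : Set G → k} (hm : IsMeas m) (I : Ideal k) (hI : IsOpen (I : Set k)) :
    {d | m {d} ∉ I}.Finite :=
  finite_of_hasSum (hm G (fun d => {d}) (fun a b hab => by simpa using hab)) I hI

theorem IsMeas.summable {m : Set G → k} (hm : IsMeas m) (F : G → k) :
    Summable fun d => m {d} * F d :=
  summable_of_ideals _ fun I hI => (hm.finite I hI).subset fun _ hd h =>
    hd (I.mul_mem_right _ h)

theorem IsMeas.summable_prod {A : Type} {m : Set G → k} (hm : IsMeas m) (F : G → A → k)
    (hF : ∀ d, Summable (F d)) : Summable fun x : G × A => m {x.1} * F x.1 x.2 := by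
  apply summable_of_ideals
  intro I hI
  have hf := hm.finite I hI
  refine Set.Finite.subset (hf.biUnion (t := fun d => (fun a => (d, a)) '' {a | F d a ∉ I})
    fun d _ => (finite_of_hasSum (hF d).hasSum I hI).image _) ?_
  rintro ⟨d, a⟩ h
  simp only [Set.mem_ofPred_eq] at h
  simp only [Set.mem_iUnion, Set.mem_ofPred_eq, Set.mem_image, Prod.mk.injEq]
  exact ⟨d, fun h' => h (I.mul_mem_right _ h'), a, fun h' => h (I.mul_mem_left _ h'), rfl, rfl⟩

theorem integral_integral {m : Set G → k} {n : Set H → k} (hm : IsMeas m) (hn : IsMeas n)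
    (F : G → H → k) :
    integral m (fun d => integral n (F d)) = ∑' x : G × H, m {x.1} * (n {x.2} * F x.1 x.2) := by
  have hs := hm.summable_prod (fun d e => n {e} * F d e) (fun d => hn.summable (F d))
  rw [hs.tsum_prod]
  refine tsum_congr fun d => ?_
  exact ((hn.summable (F d)).tsum_mul_left _).symm

theorem integral_comm {m : Set G → k} {n : Set H → k} (hm : IsMeas m) (hn : IsMeas n)
    (F : G → H → k) :
    integral m (fun d => integral n (F d)) = integral n (fun e => integral m (fun d => F d e)) := by
  rw [integral_integral hm hn, integral_integral hn hm, ← (Equiv.prodComm H G).tsum_eq]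
  refine tsum_congr fun x => ?_
  simp only [Equiv.prodComm_apply, Prod.fst_swap, Prod.snd_swap]
  ring

open Classical in
theorem IsMeas.eq_integral {m : Set G → k} (hm : IsMeas m) (V : Set G) :
    m V = integral m (fun d => if d ∈ V then 1 else 0) := by
  have h := hm V (fun d => {d.1}) (fun a b hab => by simpa [Subtype.ext_iff] using hab)
  have hV : (⋃ a : V, ({a.1} : Set G)) = V := by ext; simp
  rw [hV] at h
  rw [← h.tsum_eq, integral, tsum_subtype V (fun d => m {d})]
  refine tsum_congr fun d => ?_
  by_cases hd : d ∈ V <;> simp [hd]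

theorem integral_add_left {m n : Set G → k} (hm : IsMeas m) (hn : IsMeas n) (F : G → k) :
    integral (m + n) F = integral m F + integral n F := by
  simp only [integral, Pi.add_apply, add_mul]
  exact (hm.summable F).tsum_add (hn.summable F)

/-- Integration against a push-forward. -/
theorem integral_map {m : Set G → k} (hm : IsMeas m) (f : G → H) (F : H → k) :
    integral (fun V => m (f ⁻¹' V)) F = integral m (F ∘ f) := by
  have hs := (hm.summable (F ∘ f))
  rw [integral, integral, ← (Equiv.sigmaFiberEquiv f).tsum_eq (fun d => m {d} * (F ∘ f) d)]
  have hs' := (Equiv.sigmaFiberEquiv f).summable_iff.2 hs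
  refine Eq.trans ?_ hs'.tsum_sigma.symm
  refine tsum_congr fun x => ?_
  have h := hm {y // f y = x} (fun d => {d.1})
    (fun a b hab => by simpa [Subtype.ext_iff] using hab)
  have hV : (⋃ a : {y // f y = x}, ({a.1} : Set G)) = f ⁻¹' {x} := by ext; simp
  rw [hV] at h
  rw [← h.tsum_eq, ← h.summable.tsum_mul_right]
  refine tsum_congr fun y => ?_
  simp [Equiv.sigmaFiberEquiv, y.2]

section group
variable [AddCommGroup G] [AddCommGroup H]

theorem IsMeas.conv {m n : Set G → k} (hm : IsMeas m) (hn : IsMeas n) : IsMeas (conv m n) := by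
  intro A V hV
  have h1 : ∀ d, HasSum (fun a => n {e | d + e ∈ V a}) (n {e | d + e ∈ ⋃ a, V a}) := by
    intro d
    have := hn A (fun a => {e | d + e ∈ V a}) (fun a b hab => (hV hab).preimage (fun e => d + e))
    convert this using 2
    ext e; simp
  have hs := hm.summable_prod (fun d a => n {e | d + e ∈ V a}) (fun d => (h1 d).summable)
  have hs' := (Equiv.prodComm A G).summable_iff.2 hs
  have key := hs'.hasSum.prod_fiberwise (fun a => by
    have := (hm.summable fun d => n {e | d + e ∈ V a}).hasSum
    exact this)
  refine (congrArg (HasSum _) ?_).mpr key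
  show _ = ∑' b : A × G, (fun x : G × A => m {x.1} * n {e | x.1 + e ∈ V x.2}) (Equiv.prodComm A G b)
  rw [(Equiv.prodComm A G).tsum_eq (fun x : G × A => m {x.1} * n {e | x.1 + e ∈ V x.2}),
    hs.tsum_prod]
  refine tsum_congr fun d => ?_
  beta_reduce
  rw [← (h1 d).tsum_eq, ← (h1 d).summable.tsum_mul_left]

theorem conv_comm {m n : Set G → k} (hm : IsMeas m) (hn : IsMeas n) (V : Set G) :
    conv m n V = conv n m V := by
  classical
  simp only [DiscreteMeasure.conv, hn.eq_integral, hm.eq_integral]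
  refine (integral_comm hm hn (fun d e => if d + e ∈ V then (1 : k) else 0)).trans ?_
  refine congrArg _ (funext fun e => congrArg _ (funext fun d => ?_))
  simp [add_comm]

theorem integral_conv {m n : Set G → k} (hm : IsMeas m) (hn : IsMeas n) (F : G → k) :
    integral (conv m n) F = integral m (fun d => integral n (fun e => F (d + e))) := by
  have h1 : ∀ f, conv m n {f} * F f = integral m (fun d => n {f - d} * F f) := by
    intro f
    have : ∀ d, {e | d + e ∈ ({f} : Set G)} = {f - d} := by
      intro d; ext e; simp [eq_sub_iff_add_eq, add_comm]
    simp only [DiscreteMeasure.conv, this]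
    rw [integral, ← (hm.summable _).tsum_mul_right]
    exact tsum_congr fun d => by ring
  have hs : ∀ d, Summable fun f => n {f - d} * F f := by
    intro d
    have := (Equiv.subRight d).summable_iff.2 (hn.summable fun e => F (e + d))
    simpa [Function.comp_def] using this
  have hs2 := hm.summable_prod (fun d f => n {f - d} * F f) hs
  have hs3 := (Equiv.prodComm G G).summable_iff.2 hs2
  have e1 : integral (conv m n) F =
      ∑' x : G × G, m {x.1} * (n {x.2 - x.1} * F x.2) := by
    rw [← (Equiv.prodComm G G).tsum_eq
      (fun x : G × G => m {x.1} * (n {x.2 - x.1} * F x.2))]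
    refine Eq.trans ?_ hs3.tsum_prod.symm
    exact tsum_congr fun f => h1 f
  rw [e1, hs2.tsum_prod]
  refine tsum_congr fun d => ?_
  refine ((hs d).tsum_mul_left (m {d})).trans (congrArg (m {d} * ·) ?_)
  refine Eq.trans ?_ ((Equiv.subRight d).tsum_eq fun e => n {e} * F (d + e))
  simp

theorem conv_assoc {m n q : Set G → k} (hm : IsMeas m) (hn : IsMeas n) (V : Set G) :
    conv (conv m n) q V = conv m (conv n q) V := by
  rw [DiscreteMeasure.conv, integral_conv hm hn]
  simp only [DiscreteMeasure.conv, Set.mem_ofPred_eq, add_assoc]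

/-- Push-forward along a homomorphism is multiplicative. -/
theorem conv_map {m n : Set G → k} (hm : IsMeas m) (f : G →+ H) (V : Set H) :
    conv (fun W => m (f ⁻¹' W)) (fun W => n (f ⁻¹' W)) V = conv m n (f ⁻¹' V) := by
  rw [DiscreteMeasure.conv, integral_map hm]
  simp only [DiscreteMeasure.conv, Function.comp_def, Set.preimage, Set.mem_ofPred_eq, map_add]

theorem conv_add_left {m m' n : Set G → k} (hm : IsMeas m) (hm' : IsMeas m') :
    conv (m + m') n = conv m n + conv m' n :=
  funext fun _ => integral_add_left hm hm' _

end group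
end DiscreteMeasure

/-- The compact open subgroup `p ^ h ℤ_p` of `ℚ_p`. -/
def ballSubgroup (p : ℕ) [Fact p.Prime] (h : ℕ) : AddSubgroup ℚ_[p] where
  carrier := {x | ‖x‖ ≤ (p : ℝ) ^ (-(h : ℤ))}
  zero_mem' := by
    simp
  add_mem' {a b} ha hb := (Padic.nonarchimedean a b).trans (max_le ha hb)
  neg_mem' {a} ha := by simpa using ha

/-- `Σ_h`: the uniformly measurable subsets of `ℚ_p` of radius `h`, i.e. the unions of balls
`a + p ^ h ℤ_p`. -/
def unifMeasurableOfRadius (p : ℕ) [Fact p.Prime] (h : ℕ) : Set (Set ℚ_[p]) :=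
  Set.range fun V : Set (ℚ_[p] ⧸ ballSubgroup p h) =>
    (QuotientAddGroup.mk : ℚ_[p] → ℚ_[p] ⧸ ballSubgroup p h) ⁻¹' V

/-- `Σ_unif`: the uniformly measurable subsets of `ℚ_p`. -/
def unifMeasurable (p : ℕ) [Fact p.Prime] : Set (Set ℚ_[p]) :=
  {U | ∃ h, U ∈ unifMeasurableOfRadius p h}

theorem iUnion_mem_unifMeasurable {p : ℕ} [Fact p.Prime] {h : ℕ} {A : Type}
    {U : A → Set ℚ_[p]} (hU : ∀ a, U a ∈ unifMeasurableOfRadius p h) :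
    (⋃ a, U a) ∈ unifMeasurable p := by
  choose V hV using hU
  exact ⟨h, ⋃ a, V a, by simp only [Set.preimage_iUnion, hV]⟩

/-- A uniform `k`-valued measure on `ℚ_p`: a map `Σ_unif → k` such that, for every disjoint family
of uniformly measurable sets of one same radius, the series of the values converges
unconditionally to the value on the union. -/
@[ext]
structure UnifMeasure (p : ℕ) [Fact p.Prime] (k : Type) [CommRing k] [UniformSpace k] where
  toFun : unifMeasurable p → k
  hasSum_iUnion : ∀ (h : ℕ) (A : Type) (U : A → Set ℚ_[p])
    (hU : ∀ a, U a ∈ unifMeasurableOfRadius p h), Pairwise (fun a b => Disjoint (U a) (U b)) →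
      HasSum (fun a => toFun ⟨U a, h, hU a⟩) (toFun ⟨⋃ a, U a, iUnion_mem_unifMeasurable hU⟩)

namespace UnifMeasure

open DiscreteMeasure

section basic
variable {p : ℕ} [Fact p.Prime] {k : Type} [CommRing k] [UniformSpace k]

theorem toFun_injective : Function.Injective (toFun : UnifMeasure p k → unifMeasurable p → k) :=
  fun _ _ h => UnifMeasure.ext h

/-- The push-forward of a set function on `Σ_unif` to the discrete quotient `ℚ_p / p ^ h ℤ_p`. -/
def push (f : unifMeasurable p → k) (h : ℕ) (V : Set (ℚ_[p] ⧸ ballSubgroup p h)) : k :=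
  f ⟨QuotientAddGroup.mk ⁻¹' V, h, V, rfl⟩

theorem isMeas_push (μ : UnifMeasure p k) (h : ℕ) : IsMeas (push μ.toFun h) := by
  intro A V hV
  have := μ.hasSum_iUnion h A (fun a => QuotientAddGroup.mk ⁻¹' V a) (fun a => ⟨V a, rfl⟩)
    (fun a b hab => (hV hab).preimage _)
  simp only [push, Set.preimage_iUnion]
  exact this

theorem ext_push {f g : unifMeasurable p → k} (H : ∀ h V, push f h V = push g h V) : f = g := by
  funext ⟨U, h, V, hV⟩
  subst hV
  exact H h V

theorem ballSubgroup_anti {h h' : ℕ} (hh : h ≤ h') : ballSubgroup p h' ≤ ballSubgroup p h := by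
  intro x hx
  have hp : (1 : ℝ) ≤ p := by exact_mod_cast (Fact.out : p.Prime).one_lt.le
  exact le_trans (show ‖x‖ ≤ _ from hx) (zpow_le_zpow_right₀ hp (by omega))

/-- The transition map `ℚ_p / p ^ h' ℤ_p → ℚ_p / p ^ h ℤ_p` for `h ≤ h'`. -/
noncomputable def transition {h h' : ℕ} (hh : h ≤ h') :
    (ℚ_[p] ⧸ ballSubgroup p h') →+ (ℚ_[p] ⧸ ballSubgroup p h) :=
  QuotientAddGroup.map _ _ (AddMonoidHom.id _) (ballSubgroup_anti hh)

theorem mk_preimage_transition {h h' : ℕ} (hh : h ≤ h') (V : Set (ℚ_[p] ⧸ ballSubgroup p h)) :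
    (QuotientAddGroup.mk : ℚ_[p] → ℚ_[p] ⧸ ballSubgroup p h') ⁻¹' (transition hh ⁻¹' V) =
      (QuotientAddGroup.mk : ℚ_[p] → ℚ_[p] ⧸ ballSubgroup p h) ⁻¹' V := by
  ext x; rfl

theorem push_transition (f : unifMeasurable p → k) {h h' : ℕ} (hh : h ≤ h')
    (V : Set (ℚ_[p] ⧸ ballSubgroup p h)) : push f h V = push f h' (transition hh ⁻¹' V) := rfl

theorem exists_ofLevels (m : ∀ h, Set (ℚ_[p] ⧸ ballSubgroup p h) → k) (U : unifMeasurable p) :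
    ∃ c : k, ∃ h V, U.1 = QuotientAddGroup.mk ⁻¹' V ∧ c = m h V := by
  obtain ⟨U, h, V, hV⟩ := U
  exact ⟨m h V, h, V, hV.symm, rfl⟩

/-- The set function with given push-forwards `m h` to `ℚ_p / p ^ h ℤ_p`, for a compatible
system. -/
noncomputable def ofLevelsFun (m : ∀ h, Set (ℚ_[p] ⧸ ballSubgroup p h) → k)
    (U : unifMeasurable p) : k :=
  (exists_ofLevels m U).choose

theorem push_ofLevelsFun (m : ∀ h, Set (ℚ_[p] ⧸ ballSubgroup p h) → k)
    (hc : ∀ h h' (hh : h ≤ h') V, m h V = m h' (transition hh ⁻¹' V)) (h : ℕ) :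
    push (ofLevelsFun m) h = m h := by
  funext V
  obtain ⟨h', V', h1, h2⟩ :=
    (exists_ofLevels m ⟨QuotientAddGroup.mk ⁻¹' V, h, V, rfl⟩).choose_spec
  refine Eq.trans h2 ?_
  rw [hc h (max h h') (le_max_left _ _), hc h' (max h h') (le_max_right _ _)]
  congr 1
  apply Set.preimage_injective.2 (QuotientAddGroup.mk_surjective (s := ballSubgroup p (max h h')))
  simpa only [mk_preimage_transition] using h1.symm

/-- A set function all of whose push-forwards are measures is a uniform measure. -/
def ofPush (f : unifMeasurable p → k) (hf : ∀ h, IsMeas (push f h)) : UnifMeasure p k where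
  toFun := f
  hasSum_iUnion := by
    intro h A U hU hd
    choose V hV using id hU
    obtain rfl : (fun a => QuotientAddGroup.mk ⁻¹' V a) = U := funext hV
    have hd' : Pairwise (fun a b => Disjoint (V a) (V b)) := fun a b hab =>
      Set.disjoint_left.2 fun x hx hx' => by
        obtain ⟨y, rfl⟩ := QuotientAddGroup.mk_surjective x
        exact Set.disjoint_left.1 (hd hab) hx hx'
    have := hf h A V hd'
    simp only [push, Set.preimage_iUnion] at this
    exact this

open Classical in
/-- The Dirac mass concentrated in `a`. -/
noncomputable def dirac (k : Type) [CommRing k] [UniformSpace k] (a : ℚ_[p]) :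
    UnifMeasure p k where
  toFun U := if a ∈ U.1 then 1 else 0
  hasSum_iUnion := by
    intro h A U _ hd
    by_cases ha : ∃ i, a ∈ U i
    · obtain ⟨i, hi⟩ := ha
      have h1 : ∀ j, j ≠ i → (if a ∈ U j then (1 : k) else 0) = 0 := fun j hj =>
        if_neg fun hj' => Set.disjoint_left.1 (hd hj) hj' hi
      have := hasSum_single i h1
      simpa only [hi, Set.mem_iUnion, show (∃ i, a ∈ U i) from ⟨i, hi⟩, if_true] using this
    · have h1 : ∀ i, a ∉ U i := fun i hi => ha ⟨i, hi⟩
      simp only [h1, Set.mem_iUnion, exists_false, if_false]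
      exact hasSum_zero

end basic

section ring
variable {p : ℕ} [Fact p.Prime] {k : Type} [CommRing k] [UniformSpace k]
  [IsUniformAddGroup k] [IsTopologicalRing k]

instance : Zero (UnifMeasure p k) := ⟨⟨0, fun _ _ _ _ _ => hasSum_zero⟩⟩

instance : Add (UnifMeasure p k) := ⟨fun μ ν => ⟨μ.toFun + ν.toFun, fun h A U hU hd =>
  (μ.hasSum_iUnion h A U hU hd).add (ν.hasSum_iUnion h A U hU hd)⟩⟩

instance : Neg (UnifMeasure p k) := ⟨fun μ => ⟨-μ.toFun, fun h A U hU hd =>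
  (μ.hasSum_iUnion h A U hU hd).neg⟩⟩

instance : Sub (UnifMeasure p k) := ⟨fun μ ν => ⟨μ.toFun - ν.toFun, fun h A U hU hd =>
  (μ.hasSum_iUnion h A U hU hd).sub (ν.hasSum_iUnion h A U hU hd)⟩⟩

instance : SMul k (UnifMeasure p k) := ⟨fun c μ => ⟨c • μ.toFun, fun h A U hU hd =>
  (μ.hasSum_iUnion h A U hU hd).mul_left c⟩⟩

instance : SMul ℕ (UnifMeasure p k) := ⟨fun c μ => ⟨c • μ.toFun, fun h A U hU hd =>
  (μ.hasSum_iUnion h A U hU hd).const_smul c⟩⟩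

instance : SMul ℤ (UnifMeasure p k) := ⟨fun c μ => ⟨c • μ.toFun, fun h A U hU hd =>
  (μ.hasSum_iUnion h A U hU hd).const_smul c⟩⟩

instance : AddCommGroup (UnifMeasure p k) :=
  toFun_injective.addCommGroup _ rfl (fun _ _ => rfl) (fun _ => rfl) (fun _ _ => rfl)
    (fun _ _ => rfl) (fun _ _ => rfl)

instance : Module k (UnifMeasure p k) :=
  toFun_injective.module k ⟨⟨toFun, rfl⟩, fun _ _ => rfl⟩ fun _ _ => rfl

/-- The family of the sets `Σ_h`, for all radii `h`, as subsets of `Σ_unif`. -/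
def radii (p : ℕ) [Fact p.Prime] : Set (Set (unifMeasurable p)) :=
  Set.range fun h : ℕ => {U : unifMeasurable p | U.1 ∈ unifMeasurableOfRadius p h}

/-- A uniform measure as an element of the space of set functions with the uniformity of uniform
convergence on every `Σ_h`. -/
def toUniformOnFun : UnifMeasure p k →+ UniformOnFun (unifMeasurable p) k (radii p) where
  toFun μ := UniformOnFun.ofFun (radii p) μ.toFun
  map_zero' := rfl
  map_add' _ _ := rfl

/-- The natural topology (and uniformity) of the space of uniform measures: uniform convergence on
the uniformly measurable sets of the same radius, for every radius. -/
instance : UniformSpace (UnifMeasure p k) := UniformSpace.comap toUniformOnFun inferInstance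

instance : IsUniformAddGroup (UnifMeasure p k) := IsUniformAddGroup.comap toUniformOnFun

variable [IsLinearTopology k k] [CompleteSpace k] [T2Space k]

/-- Convolution, `(μ * ν)(U) = (μ × ν) {(x, y) | x + y ∈ U}`: at every level `h`, the push-forward to the discrete group `ℚ_p / p ^ h ℤ_p` of
the product is the convolution of the push-forwards. -/
noncomputable instance : Mul (UnifMeasure p k) := ⟨fun μ ν =>
  ofPush (ofLevelsFun fun h => conv (push μ.toFun h) (push ν.toFun h)) fun h => by
    rw [push_ofLevelsFun _ fun _ h' hh V =>
      conv_map (n := push ν.toFun h') (isMeas_push μ h') (transition hh) V]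
    exact (isMeas_push μ h).conv (isMeas_push ν h)⟩

theorem push_mul (μ ν : UnifMeasure p k) (h : ℕ) (V : Set (ℚ_[p] ⧸ ballSubgroup p h)) :
    push (μ * ν).toFun h V = conv (push μ.toFun h) (push ν.toFun h) V :=
  congrFun (push_ofLevelsFun _ (fun _ h' hh V =>
    conv_map (n := push ν.toFun h') (isMeas_push μ h') (transition hh) V) h) V

noncomputable instance : One (UnifMeasure p k) := ⟨dirac k 0⟩

theorem dirac_mul_push (a : ℚ_[p]) (m : UnifMeasure p k) (h : ℕ)
    (V : Set (ℚ_[p] ⧸ ballSubgroup p h)) :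
    push (dirac k a * m).toFun h V = push m.toFun h {e | (a : ℚ_[p] ⧸ ballSubgroup p h) + e ∈ V} := by
  classical
  rw [push_mul, conv, integral, tsum_eq_single (a : ℚ_[p] ⧸ ballSubgroup p h)]
  · simp [push, dirac]
  · intro b hb
    have : push (dirac k a).toFun h {b} = 0 := if_neg fun hab => hb (Eq.symm hab)
    rw [this, zero_mul]

theorem mul_comm' (μ ν : UnifMeasure p k) : μ * ν = ν * μ :=
  toFun_injective <| ext_push fun h V => by
    rw [push_mul, push_mul, conv_comm (isMeas_push μ h) (isMeas_push ν h)]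

theorem one_mul' (μ : UnifMeasure p k) : 1 * μ = μ :=
  toFun_injective <| ext_push fun h V => by
    refine (dirac_mul_push 0 μ h V).trans ?_
    simp

theorem add_mul' (μ ν ρ : UnifMeasure p k) : (μ + ν) * ρ = μ * ρ + ν * ρ :=
  toFun_injective <| ext_push fun h V => by
    refine (push_mul _ _ h V).trans ?_
    refine (congrFun (conv_add_left (isMeas_push μ h) (isMeas_push ν h)) V).trans ?_
    exact (congrArg₂ (· + ·) (push_mul μ ρ h V) (push_mul ν ρ h V)).symm

theorem mul_assoc' (μ ν ρ : UnifMeasure p k) : μ * ν * ρ = μ * (ν * ρ) :=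
  toFun_injective <| ext_push fun h V => by
    rw [push_mul, push_mul, funext (push_mul μ ν h), funext (push_mul ν ρ h)]
    exact conv_assoc (isMeas_push μ h) (isMeas_push ν h) V

theorem zero_mul' (μ : UnifMeasure p k) : 0 * μ = 0 := by
  have := add_mul' 0 0 μ
  rw [add_zero] at this
  simpa using this

noncomputable instance : CommRing (UnifMeasure p k) :=
  { (inferInstance : AddCommGroup (UnifMeasure p k)) with
    mul_assoc := mul_assoc'
    mul_comm := mul_comm'
    one_mul := one_mul'
    mul_one := fun μ => by rw [mul_comm', one_mul']
    left_distrib := fun μ ν ρ => by rw [mul_comm', add_mul', mul_comm' ν, mul_comm' ρ]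
    right_distrib := add_mul'
    zero_mul := zero_mul'
    mul_zero := fun μ => by rw [mul_comm', zero_mul'] }

theorem smul_mul' (c : k) (μ ν : UnifMeasure p k) : c • μ * ν = c • (μ * ν) :=
  toFun_injective <| ext_push fun h V => by
    refine (push_mul _ _ h V).trans ?_
    refine Eq.trans ?_ (congrArg (c * ·) (push_mul μ ν h V)).symm
    refine Eq.trans ?_ (((isMeas_push μ h).summable _).tsum_mul_left c)
    exact tsum_congr fun d => mul_assoc _ _ _

noncomputable instance : Algebra k (UnifMeasure p k) :=
  Algebra.ofModule smul_mul' fun c μ ν => by rw [mul_comm, smul_mul', mul_comm]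

/-- The character `a ↦ δ_a` of `ℚ_p`. -/
noncomputable def diracHom (p : ℕ) [Fact p.Prime] (k : Type) [CommRing k] [UniformSpace k]
    [IsUniformAddGroup k] [IsTopologicalRing k] [IsLinearTopology k k] [CompleteSpace k]
    [T2Space k] : Multiplicative ℚ_[p] →* UnifMeasure p k where
  toFun a := dirac k a.toAdd
  map_one' := rfl
  map_mul' a b := toFun_injective <| ext_push fun h V => by
    refine Eq.trans ?_ (dirac_mul_push _ _ h V).symm
    rfl

/-- `δ_{1/p^n} - δ_0`. -/
noncomputable def diracSub (p : ℕ) [Fact p.Prime] (k : Type) [CommRing k] [UniformSpace k]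
    [IsUniformAddGroup k] [IsTopologicalRing k] (n : ℕ) : UnifMeasure p k :=
  dirac k (1 / (p : ℚ_[p]) ^ n) - dirac k 0

/-- The map on measures induced by a continuous ring homomorphism of the coefficients. -/
noncomputable def map {k' : Type} [CommRing k'] [UniformSpace k'] [IsUniformAddGroup k']
    [IsTopologicalRing k'] [IsLinearTopology k' k'] [CompleteSpace k'] [T2Space k']
    (φ : k →+* k') (hφ : Continuous φ) : UnifMeasure p k →+* UnifMeasure p k' where
  toFun μ := ⟨fun U => φ (μ.toFun U), fun h A U hU hd =>
    (μ.hasSum_iUnion h A U hU hd).map φ hφ⟩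
  map_zero' := toFun_injective <| funext fun _ => map_zero φ
  map_add' μ ν := toFun_injective <| funext fun _ => map_add φ _ _
  map_one' := toFun_injective <| funext fun U => by
    classical
    show φ (if (0 : ℚ_[p]) ∈ U.1 then 1 else 0) = if (0 : ℚ_[p]) ∈ U.1 then 1 else 0
    split_ifs <;> simp
  map_mul' μ ν := toFun_injective <| ext_push fun h V => by
    refine Eq.trans ?_ (push_mul _ _ h V).symm
    refine (congrArg φ (push_mul μ ν h V)).trans ?_
    refine (((isMeas_push μ h).summable _).map_tsum φ hφ).trans ?_
    exact tsum_congr fun d => map_mul φ _ _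

end ring

end UnifMeasure

/-- The discrete uniformity of `ℤ / n`. -/
instance (n : ℕ) : UniformSpace (ZMod n) := (⊥ : UniformSpace (ZMod n)).replaceTopology rfl

instance (p : ℕ) [Fact p.Prime] : IsLinearTopology ℤ_[p] ℤ_[p] := by
  refine IsLinearTopology.mk_of_hasBasis' (R := ℤ_[p]) (p := fun _ : ℕ => True)
    (s := fun n => (Ideal.span {(p : ℤ_[p]) ^ n})) ?_ (fun I r x hx => I.smul_mem r hx)
  have hp : (1 : ℝ) < p := by exact_mod_cast (Fact.out : p.Prime).one_lt
  have hp0 : (0 : ℝ) < p := by linarith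
  have := Metric.nhds_basis_closedBall_pow (x := (0 : ℤ_[p])) (inv_pos.2 hp0) (inv_lt_one_of_one_lt₀ hp)
  convert this using 2 with n
  ext x
  simp [← PadicInt.norm_le_pow_iff_mem_span_pow]

theorem continuous_toZMod (p : ℕ) [Fact p.Prime] :
    Continuous (PadicInt.toZMod : ℤ_[p] →+* ZMod p) := by
  apply continuous_of_continuousAt_zero
  rw [ContinuousAt, map_zero, nhds_discrete (ZMod p), tendsto_pure]
  filter_upwards [Metric.ball_mem_nhds (0 : ℤ_[p]) one_pos] with x hx
  rw [← RingHom.mem_ker, PadicInt.ker_toZMod, IsLocalRing.mem_maximalIdeal, PadicInt.mem_nonunits]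
  simpa using hx

namespace UnifMeasure

/-- Reduction modulo `p` of uniform measures. -/
noncomputable def reduction (p : ℕ) [Fact p.Prime] :
    UnifMeasure p ℤ_[p] →+* UnifMeasure p (ZMod p) :=
  map PadicInt.toZMod (continuous_toZMod p)

variable (p : ℕ) [Fact p.Prime] (R k : Type) [CommRing R] [CommRing k] [UniformSpace k]
  [IsUniformAddGroup k] [IsTopologicalRing k] [IsLinearTopology k k] [CompleteSpace k] [T2Space k]
  [Algebra R (UnifMeasure p k)]

/-- The map `R[ℚ_p] → D_unif(ℚ_p, k)` sending the basis element of `a` to `δ_a`. -/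
noncomputable def ofGroupAlgebra : AddMonoidAlgebra R ℚ_[p] →+* UnifMeasure p k :=
  (AddMonoidAlgebra.lift R (UnifMeasure p k) ℚ_[p] (diracHom p k)).toRingHom

/-- The subgroup `ℤ[1/p]` of `ℚ_p`. -/
def zInv : AddSubgroup ℚ_[p] where
  carrier := {x | ∃ (n : ℕ) (m : ℤ), x * (p : ℚ_[p]) ^ n = m}
  zero_mem' := ⟨0, 0, by simp⟩
  add_mem' := by
    rintro a b ⟨n, m, h⟩ ⟨n', m', h'⟩
    refine ⟨n + n', m * p ^ n' + m' * p ^ n, ?_⟩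
    push_cast
    rw [← h, ← h']
    ring
  neg_mem' := by
    rintro a ⟨n, m, h⟩
    exact ⟨n, -m, by push_cast; rw [← h]; ring⟩

/-- The element `1` of `ℤ[1/p]`. -/
noncomputable def zInvOne : zInv p := ⟨1, 0, 1, by simp⟩

/-- The map `R[ℤ[1/p]] → D_unif(ℚ_p, k)` sending the basis element of `a` to `δ_a`. -/
noncomputable def ofGroupAlgebraZInv : AddMonoidAlgebra R (zInv p) →+* UnifMeasure p k :=
  (AddMonoidAlgebra.lift R (UnifMeasure p k) (zInv p)
    ((diracHom p k).comp (AddMonoidHom.toMultiplicative (zInv p).subtype))).toRingHom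

end UnifMeasure

/-- The monoid `S = ℤ[1/p] ∩ ℝ_{≥ 0}`. -/
def zInvNonneg (p : ℕ) : AddSubmonoid ℚ where
  carrier := {x | 0 ≤ x ∧ ∃ (n : ℕ) (m : ℤ), x * (p : ℚ) ^ n = m}
  zero_mem' := ⟨le_rfl, 0, 0, by simp⟩
  add_mem' := by
    rintro a b ⟨ha, n, m, h⟩ ⟨hb, n', m', h'⟩
    refine ⟨add_nonneg ha hb, n + n', m * p ^ n' + m' * p ^ n, ?_⟩
    push_cast
    rw [← h, ← h']
    ring

/-- The ring `R[X^{1/p^∞}]`, with `R`-basis the monomials `X ^ q` for `q ∈ ℤ[1/p]`, `q ≥ 0`. -/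
abbrev PerfPoly (R : Type) [CommRing R] (p : ℕ) : Type := AddMonoidAlgebra R (zInvNonneg p)

/-- The element `X^{1/p^n}` of `R[X^{1/p^∞}]`. -/
noncomputable def PerfPoly.root (R : Type) [CommRing R] (p : ℕ) [Fact p.Prime] (n : ℕ) :
    PerfPoly R p :=
  AddMonoidAlgebra.single ⟨1 / (p : ℚ) ^ n, by positivity, n, 1, by
    have : (p : ℚ) ≠ 0 := by exact_mod_cast (Fact.out : p.Prime).ne_zero
    simp [this]⟩ 1

/-- The `t`-adic completion of `𝔽_p[t^{1/p^∞}]`. -/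
abbrev PerfPoly.Completion (p : ℕ) [Fact p.Prime] : Type :=
  AdicCompletion (Ideal.span {PerfPoly.root (ZMod p) p 0}) (PerfPoly (ZMod p) p)

/-- The ring `A_inf`: the Witt vectors of the `t`-adic completion of `𝔽_p[t^{1/p^∞}]`. -/
abbrev Ainf (p : ℕ) [Fact p.Prime] : Type := WittVector p (PerfPoly.Completion p)

/-- The topological ring `B` is, via `f`, the (separated) completion of the ring `A` endowed with
the topology `τ`. -/
structure IsRingCompletion {A B : Type} [CommRing A] [CommRing B] [UniformSpace B]
    [IsUniformAddGroup B] (τ : TopologicalSpace A) (f : A →+* B) : Prop where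
  isTopologicalRing : IsTopologicalRing B
  complete : CompleteSpace B
  separated : T2Space B
  inducing : τ = TopologicalSpace.induced f inferInstance
  dense : DenseRange f

/-- A strict `p`-ring: `p` is not a zero divisor, the ring is separated and complete for the
`p`-adic topology, and the residue ring is perfect of characteristic `p`. -/
structure IsStrictPRing (p : ℕ) (A : Type) [CommRing A] : Prop where
  mem_nonZeroDivisors : (p : A) ∈ nonZeroDivisors A
  isAdicComplete : IsAdicComplete (Ideal.span {(p : A)}) A
  charP : CharP (A ⧸ Ideal.span {(p : A)}) p
  perfectRing : PerfectRing (A ⧸ Ideal.span {(p : A)}) p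

/-- The product topology on the Witt vectors of a topological ring. -/
@[reducible] def wittProductTopology (p : ℕ) {R : Type} (τ : TopologicalSpace R) :
    TopologicalSpace (WittVector p R) :=
  TopologicalSpace.induced (fun x (i : ℕ) => x.coeff i) (@Pi.topologicalSpace ℕ (fun _ => R) fun _ => τ)

/-- The `p`-adic topology of a ring. -/
@[reducible] def pAdicTopology (p : ℕ) (A : Type) [CommRing A] : TopologicalSpace A :=
  (Ideal.span {(p : A)}).adicTopology

/-!
The measures that at level `h` take values divisible by `p ^ h` form a basis of neighbourhoods of
`0` for the natural topology, and the Dirac masses at `ℤ[1/p]` span a dense group algebra. Since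
`[1] ^ p ^ h - 1` lies in `(p, [1] - 1) ^ (h + 1)` and generates, together with `p ^ h`, the trace
of the `h`-th neighbourhood, this neighbourhood basis traces the `(p, [1] - 1)`-adic topology on the
group algebra. The topology of the complete ring of measures is then adic too, because a dense
homomorphism to a complete ring that induces the adic topology of a finitely generated ideal
generates the topology of its target.

Modulo `p` the elements `t_n` are `p`-power roots of `t`, lie in the Jacobson radical and are not
nilpotent. A nonzero polynomial in `t_n` is a power of `t_n` times a unit, which embeds
`𝔽_p[t^{1/p^∞}]` into the measures. Over `ℤ_p` the measures are `p`-torsion free and `p`-adically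
complete with perfect residue ring, hence the Witt vectors of that ring, on which the product of
the `t`-adic topologies is the `(p, [t])`-adic one. The statements on integral subrings follow from
those modulo `p` by dévissage along the powers of `p`.
-/

section DenseRingHom

variable {A B : Type*} [CommRing A] [CommRing B] {I : Ideal A} {f : A →+* B}

theorem isTopologicalAddGroup_adicTopology (I : Ideal A) :
    @IsTopologicalAddGroup A I.adicTopology _ :=
  I.adic_basis.toRing_subgroups_basis.toRingFilterBasis.toAddGroupFilterBasis.isTopologicalAddGroup

theorem isTopologicalRing_of_isAdic [T : TopologicalSpace A] (hI : IsAdic I) :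
    IsTopologicalRing A := by
  rw [show T = I.adicTopology from hI]
  exact I.adic_basis.toRing_subgroups_basis.toRingFilterBasis.isTopologicalRing

theorem isAdic_of_hasBasis {ι : Type*} [TopologicalSpace A] [IsTopologicalAddGroup A]
    {q : ι → Prop} {K : ι → Set A} (hK : (𝓝 (0 : A)).HasBasis q K)
    (h1 : ∀ n, ∃ i, q i ∧ K i ⊆ (I ^ n : Ideal A))
    (h2 : ∀ i, q i → ∃ n, ((I ^ n : Ideal A) : Set A) ⊆ K i) : IsAdic I := by
  refine IsTopologicalAddGroup.ext inferInstance (isTopologicalAddGroup_adicTopology I)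
    (hK.ext I.hasBasis_nhds_zero_adic (fun i hi => ?_) fun n _ => h1 n)
  obtain ⟨n, hn⟩ := h2 i hi
  exact ⟨n, trivial, hn⟩

theorem denseRange_iff_exists_sub_mem {α ι : Type*} [TopologicalSpace B] [IsTopologicalAddGroup B]
    {q : ι → Prop} {K : ι → Ideal B} (hK : (𝓝 (0 : B)).HasBasis q fun i => (K i : Set B))
    {g : α → B} : DenseRange g ↔ ∀ i, q i → ∀ b, ∃ a, b - g a ∈ K i := by
  have hmem (b : B) : b ∈ closure (Set.range g) ↔ ∀ i, q i → ∃ a, b - g a ∈ K i := by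
    simp only [mem_closure_iff_nhds_basis (hK.nhds_of_zero b), Set.exists_range_iff,
      Set.mem_ofPred_eq, SetLike.mem_coe, sub_mem_comm_iff (b := b)]
  exact ⟨fun h i hi b => (hmem b).1 (h b) i hi, fun h b => (hmem b).2 fun i hi => h i hi b⟩

theorem adicTopology_eq_induced_of_comap_le [TopologicalSpace B] [IsTopologicalAddGroup B]
    {K : ℕ → Ideal B} (hK : (𝓝 (0 : B)).HasBasis (fun _ => True) fun n => (K n : Set B))
    (hcont : ∀ n, ∃ m, I ^ m ≤ (K n).comap f) (hcomap : ∀ n, (K n).comap f ≤ I ^ n) :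
    I.adicTopology = TopologicalSpace.induced f inferInstance := by
  refine IsTopologicalAddGroup.ext (isTopologicalAddGroup_adicTopology I)
    (topologicalAddGroup_induced f) ?_
  rw [nhds_induced, map_zero]
  refine I.hasBasis_nhds_zero_adic.ext (hK.comap f) (fun n _ => ⟨n, trivial, hcomap n⟩)
    fun n _ => ?_
  obtain ⟨m, hm⟩ := hcont n
  exact ⟨m, trivial, hm⟩

theorem exists_sub_mem_map_pow (hf : ∀ b, ∃ a, b - f a ∈ I.map f) (n : ℕ) (b : B) :
    ∃ a, b - f a ∈ I.map f ^ n := by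
  induction n with
  | zero => exact ⟨0, by simp⟩
  | succ n ih =>
    have hstep : ∀ y ∈ (I ^ n).map f, ∃ a ∈ I ^ n, y - f a ∈ I.map f ^ (n + 1) := by
      intro y hy
      induction hy using Submodule.span_induction with
      | mem y hy =>
        obtain ⟨a, ha, rfl⟩ := hy
        exact ⟨a, ha, by simp⟩
      | zero => exact ⟨0, zero_mem _, by simp⟩
      | add y z _ _ hy hz =>
        obtain ⟨a, ha, hya⟩ := hy
        obtain ⟨c, hc, hzc⟩ := hz
        exact ⟨a + c, add_mem ha hc, by simpa [add_sub_add_comm] using add_mem hya hzc⟩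
      | smul c y hy hya =>
        obtain ⟨a, ha, hya⟩ := hya
        obtain ⟨d, hd⟩ := hf c
        have hy : y ∈ I.map f ^ n := (Ideal.map_pow f I n).le hy
        refine ⟨d * a, Ideal.mul_mem_left _ _ ha, ?_⟩
        have := add_mem (pow_succ' (I.map f) n ▸ Ideal.mul_mem_mul hd hy)
          (Ideal.mul_mem_left _ (f d) hya)
        convert this using 1
        rw [map_mul, smul_eq_mul]
        ring
    obtain ⟨a, ha⟩ := ih
    obtain ⟨c, -, hc⟩ := hstep _ (by rwa [Ideal.map_pow])
    exact ⟨a + c, by rwa [map_add, ← sub_sub]⟩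

section Complete

variable [UniformSpace B] [IsUniformAddGroup B] [IsTopologicalRing B] [CompleteSpace B] [T2Space B]
  {K : ℕ → Ideal B}

omit [T2Space B] in
theorem summable_of_mem_pow (hK : (𝓝 (0 : B)).HasBasis (fun _ => True) fun n => (K n : Set B))
    (hcont : ∀ n, ∃ m, I ^ m ≤ (K n).comap f) {c : ℕ → A} (hc : ∀ m, c m ∈ I ^ m) :
    Summable fun m => f (c m) := by
  have : NonarchimedeanAddGroup B := ⟨fun U hU => by
    obtain ⟨n, -, hn⟩ := hK.mem_iff.1 hU
    exact ⟨⟨(K n).toAddSubgroup, (K n).toAddSubgroup.isOpen_of_mem_nhds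
      (hK.mem_of_mem trivial)⟩, hn⟩⟩
  refine NonarchimedeanAddGroup.summable_of_tendsto_cofinite_zero ?_
  rw [Nat.cofinite_eq_atTop, hK.tendsto_right_iff]
  intro n _
  obtain ⟨m, hm⟩ := hcont n
  filter_upwards [eventually_ge_atTop m] with l hl
  exact hm (Ideal.pow_le_pow_right hl (hc l))

theorem mem_map_of_hasSum (hK : (𝓝 (0 : B)).HasBasis (fun _ => True) fun n => (K n : Set B))
    (hcont : ∀ n, ∃ m, I ^ m ≤ (K n).comap f) {J : Ideal A} (hJ : J.FG) {c : ℕ → A}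
    (hc : ∀ m, c m ∈ J * I ^ m) {y : B} (hy : HasSum (fun m => f (c m)) y) : y ∈ J.map f := by
  obtain ⟨r, x, rfl⟩ := Submodule.fg_iff_exists_fin_generating_family.1 hJ
  have hcoord (m : ℕ) : ∃ b : Fin r → A, (∀ i, b i ∈ I ^ m) ∧ c m = ∑ i, x i * b i := by
    have := hc m
    rw [mul_comm, ← smul_eq_mul, Submodule.mem_ideal_smul_span_iff_exists_sum] at this
    obtain ⟨b, hb, hbc⟩ := this
    exact ⟨b, hb, by simpa [Finsupp.sum_fintype, mul_comm] using hbc.symm⟩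
  choose b hb hbc using hcoord
  have hsum (i : Fin r) : Summable fun m => f (b m i) :=
    summable_of_mem_pow hK hcont fun m => hb m i
  have hsum' : HasSum (fun m => f (c m)) (∑ i, f (x i) * ∑' m, f (b m i)) := by
    simpa only [hbc, map_sum, map_mul] using
      hasSum_sum fun i _ => (hsum i).hasSum.mul_left (f (x i))
  rw [hy.unique hsum']
  exact Ideal.sum_mem _ fun i _ =>
    Ideal.mul_mem_right _ _ (Ideal.mem_map_of_mem f (Submodule.subset_span ⟨i, rfl⟩))

theorem exists_hasSum_of_mem
    (hK : (𝓝 (0 : B)).HasBasis (fun _ => True) fun n => (K n : Set B)) (hKanti : Antitone K)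
    (hcont : ∀ n, ∃ m, I ^ m ≤ (K n).comap f) (hcomap : ∀ n, (K n).comap f ≤ I ^ n)
    (hf : DenseRange f) {n : ℕ} {y : B} (hy : y ∈ K n) :
    ∃ c : ℕ → A, (∀ m, c m ∈ I ^ (n + m)) ∧ HasSum (fun m => f (c m)) y := by
  obtain ⟨a, ha0, ha⟩ : ∃ a : ℕ → A, a 0 = 0 ∧ ∀ m, y - f (a m) ∈ K (n + m) := by
    choose a ha using fun m => (denseRange_iff_exists_sub_mem hK).1 hf (n + m) trivial y
    refine ⟨fun m => if m = 0 then 0 else a m, if_pos rfl, fun m => ?_⟩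
    beta_reduce
    split_ifs with hm
    · simpa [hm] using hy
    · exact ha m
  have hc (m : ℕ) : a (m + 1) - a m ∈ I ^ (n + m) := hcomap _ <| by
    simpa using sub_mem (ha m) (hKanti (Nat.le_succ _) (ha (m + 1)))
  refine ⟨fun m => a (m + 1) - a m, hc, ?_⟩
  have hsum := (summable_of_mem_pow hK hcont fun m =>
    Ideal.pow_le_pow_right (Nat.le_add_left m n) (hc m)).hasSum
  have hlim : Tendsto (fun m => f (a m)) atTop (𝓝 y) := by
    refine tendsto_sub_nhds_zero_iff.1 (hK.tendsto_right_iff.2 fun l _ => ?_)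
    filter_upwards [eventually_ge_atTop l] with m hm
    exact sub_mem_comm_iff.1 (hKanti (hm.trans (Nat.le_add_left m n)) (ha m))
  have hpart : Tendsto (fun m => f (a m)) atTop (𝓝 (∑' m, f (a (m + 1) - a m))) := by
    simpa only [map_sub, Finset.sum_range_sub (fun m => f (a m)), ha0, map_zero, sub_zero] using
      hsum.tendsto_sum_nat
  rwa [tendsto_nhds_unique hlim hpart]

/-- An element of `K n` is the sum of a series of images of elements of `I ^ n * I ^ m`; grouping
the terms along finitely many generators of `I ^ n` puts it into the extension of `I ^ n`. -/
theorem isAdic_map_of_comap_le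
    (hK : (𝓝 (0 : B)).HasBasis (fun _ => True) fun n => (K n : Set B)) (hKanti : Antitone K)
    (hcont : ∀ n, ∃ m, I ^ m ≤ (K n).comap f) (hcomap : ∀ n, (K n).comap f ≤ I ^ n)
    (hf : DenseRange f) (hI : I.FG) : IsAdic (I.map f) := by
  refine isAdic_of_hasBasis hK (fun n => ⟨n, trivial, fun y hy => ?_⟩) fun n _ => ?_
  · obtain ⟨c, hc, hcy⟩ := exists_hasSum_of_mem hK hKanti hcont hcomap hf hy
    rw [← Ideal.map_pow]
    exact mem_map_of_hasSum hK hcont (hI.pow) (fun m => pow_add I n m ▸ hc m) hcy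
  · obtain ⟨m, hm⟩ := hcont n
    exact ⟨m, by rw [← Ideal.map_pow]; exact Ideal.map_le_iff_le_comap.2 hm⟩

end Complete

end DenseRingHom

section IsRingCompletion

variable {A B : Type} [CommRing A] [CommRing B] [UniformSpace B] [IsUniformAddGroup B]
  [CompleteSpace B] [T2Space B]

theorem isRingCompletion_adicTopology [IsTopologicalRing B] {I : Ideal A} {f : A →+* B}
    {K : ℕ → Ideal B} (hK : (𝓝 (0 : B)).HasBasis (fun _ => True) fun n => (K n : Set B))
    (hcont : ∀ n, ∃ m, I ^ m ≤ (K n).comap f) (hcomap : ∀ n, (K n).comap f ≤ I ^ n)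
    (hf : DenseRange f) : IsRingCompletion I.adicTopology f where
  isTopologicalRing := inferInstance
  complete := inferInstance
  separated := inferInstance
  inducing := adicTopology_eq_induced_of_comap_le hK hcont hcomap
  dense := hf

theorem isRingCompletion_induced {I : Ideal B} (hI : IsAdic I) {f : A →+* B}
    (hf : DenseRange f) : IsRingCompletion (I.adicTopology.induced f) f where
  isTopologicalRing := isTopologicalRing_of_isAdic hI
  complete := inferInstance
  separated := inferInstance
  inducing := congrArg (TopologicalSpace.induced f) (Eq.symm hI)
  dense := hf

end IsRingCompletion

section AdicCompletion

variable {A B : Type*} [CommRing A] [CommRing B] {f : A →+* B} {I : Ideal A}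

/-- The isomorphisms `A ⧸ I ^ n ≃ B ⧸ (I B) ^ n` induced by a ring homomorphism `A → B` inducing the
`I`-adic topology and with `(I B)`-adically dense range. -/
noncomputable def quotientPowEquiv (hcomap : ∀ n, (I.map f ^ n).comap f ≤ I ^ n)
    (hdense : ∀ n b, ∃ a, b - f a ∈ I.map f ^ n) (n : ℕ) : (A ⧸ I ^ n) ≃+* (B ⧸ I.map f ^ n) :=
  RingEquiv.ofBijective
    (Ideal.quotientMap _ f (by rw [← Ideal.map_le_iff_le_comap, Ideal.map_pow]))
    ⟨Ideal.quotientMap_injective' (hcomap n), fun b => by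
      obtain ⟨b, rfl⟩ := Ideal.Quotient.mk_surjective b
      obtain ⟨a, ha⟩ := hdense n b
      exact ⟨Ideal.Quotient.mk _ a, ((Ideal.Quotient.mk_eq_mk_iff_sub_mem _ _).2 ha).symm⟩⟩

variable (hcomap : ∀ n, (I.map f ^ n).comap f ≤ I ^ n)
  (hdense : ∀ n b, ∃ a, b - f a ∈ I.map f ^ n)

@[simp]
theorem quotientPowEquiv_mk (n : ℕ) (a : A) :
    quotientPowEquiv hcomap hdense n (Ideal.Quotient.mk _ a) = Ideal.Quotient.mk _ (f a) := rfl

theorem factorPow_quotientPowEquiv {m n : ℕ} (hmn : m ≤ n) (x : A ⧸ I ^ n) :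
    Ideal.Quotient.factorPow (I.map f) hmn (quotientPowEquiv hcomap hdense n x) =
      quotientPowEquiv hcomap hdense m (Ideal.Quotient.factorPow I hmn x) := by
  obtain ⟨a, rfl⟩ := Ideal.Quotient.mk_surjective x
  rfl

theorem factorPow_comp_quotientPowEquiv_symm {m n : ℕ} (hmn : m ≤ n) :
    (Ideal.Quotient.factorPow I hmn).comp
        ((quotientPowEquiv hcomap hdense n).symm.toRingHom.comp (Ideal.Quotient.mk _)) =
      (quotientPowEquiv hcomap hdense m).symm.toRingHom.comp (Ideal.Quotient.mk _) := by
  refine RingHom.ext fun b => ?_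
  change Ideal.Quotient.factorPow I hmn ((quotientPowEquiv hcomap hdense n).symm _) =
    (quotientPowEquiv hcomap hdense m).symm
      (Ideal.Quotient.factorPow (I.map f) hmn (Ideal.Quotient.mk _ b))
  rw [RingEquiv.eq_symm_apply, ← factorPow_quotientPowEquiv, RingEquiv.apply_symm_apply]

theorem factorPow_evalₐ {m n : ℕ} (hmn : m ≤ n) (x : AdicCompletion I A) :
    Ideal.Quotient.factorPow I hmn (AdicCompletion.evalₐ I n x) = AdicCompletion.evalₐ I m x := by
  induction x using AdicCompletion.induction_on with
  | _ s =>
    rw [AdicCompletion.evalₐ_mk, AdicCompletion.evalₐ_mk]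
    exact AdicCompletion.Ideal.mk_eq_mk I hmn s

theorem factorPow_comp_quotientPowEquiv_evalₐ {m n : ℕ} (hmn : m ≤ n) :
    (Ideal.Quotient.factorPow (I.map f) hmn).comp
        ((quotientPowEquiv hcomap hdense n).toRingHom.comp (AdicCompletion.evalₐ I n).toRingHom) =
      (quotientPowEquiv hcomap hdense m).toRingHom.comp (AdicCompletion.evalₐ I m).toRingHom :=
  RingHom.ext fun x => (factorPow_quotientPowEquiv hcomap hdense hmn _).trans
    (congrArg _ (factorPow_evalₐ hmn x))

/-- The homomorphism from `B` to the `I`-adic completion of `A` given by the inverses of the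
isomorphisms `A ⧸ I ^ n ≃ B ⧸ (I B) ^ n`. -/
noncomputable def toAdicCompletion : B →+* AdicCompletion I A :=
  AdicCompletion.liftRingHom I
    (fun n => (quotientPowEquiv hcomap hdense n).symm.toRingHom.comp (Ideal.Quotient.mk _))
    (factorPow_comp_quotientPowEquiv_symm hcomap hdense)

theorem evalₐ_toAdicCompletion (n : ℕ) (b : B) :
    AdicCompletion.evalₐ I n (toAdicCompletion hcomap hdense b) =
      (quotientPowEquiv hcomap hdense n).symm (Ideal.Quotient.mk _ b) :=
  AdicCompletion.evalₐ_liftRingHom I _ (factorPow_comp_quotientPowEquiv_symm hcomap hdense) n b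

theorem toAdicCompletion_apply (a : A) :
    toAdicCompletion hcomap hdense (f a) = AdicCompletion.of I A a := by
  refine AdicCompletion.ext_evalₐ fun n => ?_
  rw [evalₐ_toAdicCompletion, AdicCompletion.evalₐ_of, RingEquiv.symm_apply_eq,
    quotientPowEquiv_mk]

variable [IsAdicComplete (I.map f) B]

/-- The homomorphism from the `I`-adic completion of `A` to `B` given by the isomorphisms
`A ⧸ I ^ n ≃ B ⧸ (I B) ^ n`. -/
noncomputable def ofAdicCompletion : AdicCompletion I A →+* B :=
  IsAdicComplete.liftRingHom (I.map f)
    (fun n =>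
      (quotientPowEquiv hcomap hdense n).toRingHom.comp (AdicCompletion.evalₐ I n).toRingHom)
    (factorPow_comp_quotientPowEquiv_evalₐ hcomap hdense)

theorem mk_ofAdicCompletion (n : ℕ) (x : AdicCompletion I A) :
    Ideal.Quotient.mk (I.map f ^ n) (ofAdicCompletion hcomap hdense x) =
      quotientPowEquiv hcomap hdense n (AdicCompletion.evalₐ I n x) :=
  IsAdicComplete.mk_liftRingHom _ _ (factorPow_comp_quotientPowEquiv_evalₐ hcomap hdense) n x

theorem toAdicCompletion_ofAdicCompletion (x : AdicCompletion I A) :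
    toAdicCompletion hcomap hdense (ofAdicCompletion hcomap hdense x) = x :=
  AdicCompletion.ext_evalₐ fun n => by
    rw [evalₐ_toAdicCompletion, mk_ofAdicCompletion, RingEquiv.symm_apply_apply]

theorem ofAdicCompletion_toAdicCompletion (b : B) :
    ofAdicCompletion hcomap hdense (toAdicCompletion hcomap hdense b) = b :=
  congrFun (IsHausdorff.funext' (I.map f)
    (f := fun b => ofAdicCompletion hcomap hdense (toAdicCompletion hcomap hdense b)) (g := id)
    fun n b => by
      rw [mk_ofAdicCompletion, evalₐ_toAdicCompletion, RingEquiv.apply_symm_apply, id]) b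

/-- A ring complete for the extension of `I` and with the same quotients as `A` is the `I`-adic
completion of `A`. -/
noncomputable def adicCompletionEquiv : AdicCompletion I A ≃+* B :=
  RingEquiv.ofRingHom (ofAdicCompletion hcomap hdense) (toAdicCompletion hcomap hdense)
    (RingHom.ext (ofAdicCompletion_toAdicCompletion hcomap hdense))
    (RingHom.ext (toAdicCompletion_ofAdicCompletion hcomap hdense))

theorem adicCompletionEquiv_of (a : A) :
    adicCompletionEquiv hcomap hdense (AdicCompletion.of I A a) = f a := by
  rw [← toAdicCompletion_apply hcomap hdense]
  exact ofAdicCompletion_toAdicCompletion hcomap hdense (f a)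

end AdicCompletion

section SpanPair

variable {A : Type*} [CommRing A] (a b : A)

theorem span_pair_pow_le (n : ℕ) : Ideal.span {a ^ n, b ^ n} ≤ Ideal.span {a, b} ^ n := by
  rw [Ideal.span_le, Set.insert_subset_iff, Set.singleton_subset_iff]
  exact ⟨Ideal.pow_mem_pow (Ideal.subset_span (by simp)) n,
    Ideal.pow_mem_pow (Ideal.subset_span (by simp)) n⟩

theorem pow_span_pair_le (m n : ℕ) :
    Ideal.span {a, b} ^ (m + n) ≤ Ideal.span {a ^ m, b ^ n} := by
  rw [Ideal.span_insert, Ideal.span_insert, ← Ideal.span_singleton_pow, ← Ideal.span_singleton_pow]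
  exact Ideal.sup_pow_add_le_pow_sup_pow

end SpanPair

theorem isTopologicalRing_of_isLinearTopology {B : Type*} [CommRing B] [TopologicalSpace B]
    [IsTopologicalAddGroup B] [IsLinearTopology B B] : IsTopologicalRing B :=
  IsTopologicalRing.of_addGroup_of_nhds_zero
    (IsLinearTopology.tendsto_mul_zero_of_right _ _ tendsto_snd)
    (fun x => IsLinearTopology.tendsto_mul_zero_of_right (fun _ => x) id tendsto_id)
    fun x => IsLinearTopology.tendsto_mul_zero_of_left id (fun _ => x) tendsto_id

theorem ideal_mem_of_hasSum {α k : Type*} [CommRing k] [TopologicalSpace k]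
    [IsTopologicalAddGroup k] {f : α → k} {s : k} (hs : HasSum f s) {J : Ideal k}
    (hJ : IsOpen (J : Set k)) (hf : ∀ a, f a ∈ J) : s ∈ J :=
  (J.toAddSubgroup.isClosed_of_isOpen hJ).mem_of_tendsto hs
    (Eventually.of_forall fun _ => J.sum_mem fun a _ => hf a)

namespace UnifMeasure

open DiscreteMeasure

section Topology

variable {p : ℕ} [Fact p.Prime] {k : Type} [CommRing k] [UniformSpace k]

theorem unifMeasurableOfRadius_mono : Monotone (unifMeasurableOfRadius p) := by
  rintro h h' hh _ ⟨V, rfl⟩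
  exact ⟨transition hh ⁻¹' V, mk_preimage_transition hh V⟩

theorem radii_directedOn : DirectedOn (· ⊆ ·) (radii p) := by
  rintro _ ⟨h, rfl⟩ _ ⟨h', rfl⟩
  exact ⟨_, ⟨max h h', rfl⟩, fun U hU => unifMeasurableOfRadius_mono (le_max_left _ _) hU,
    fun U hU => unifMeasurableOfRadius_mono (le_max_right _ _) hU⟩

theorem sUnion_radii : ⋃₀ radii p = Set.univ := by
  refine Set.eq_univ_of_forall fun U => ?_
  obtain ⟨h, hU⟩ := U.2
  exact ⟨_, ⟨h, rfl⟩, hU⟩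

variable [IsUniformAddGroup k] [IsTopologicalRing k]

omit [IsUniformAddGroup k] in
theorem isUniformInducing_toUniformOnFun :
    IsUniformInducing (toUniformOnFun : UnifMeasure p k →+ _) := ⟨rfl⟩

instance [T2Space k] : T2Space (UnifMeasure p k) := by
  have := UniformOnFun.t2Space_of_covering (β := k) (sUnion_radii (p := p))
  exact T2Space.of_injective_continuous (f := toUniformOnFun) (fun _ _ h => toFun_injective h)
    isUniformInducing_toUniformOnFun.uniformContinuous.continuous

variable [IsLinearTopology k k]

variable (p k) in
theorem hasBasis_nhds_zero_uniformOnFun :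
    (𝓝 (0 : UniformOnFun (unifMeasurable p) k (radii p))).HasBasis
      (fun i : ℕ × Ideal k => IsOpen (i.2 : Set k))
      fun i => {f | ∀ V, push (UniformOnFun.toFun (radii p) f) i.1 V ∈ i.2} := by
  have := UniformOnFun.hasBasis_nhds_zero_of_basis (radii p) (Set.range_nonempty _)
    radii_directedOn (IsLinearTopology.hasBasis_open_ideal (R := k))
  refine this.to_hasBasis ?_ ?_
  · rintro ⟨_, J⟩ ⟨⟨h, rfl⟩, hJ⟩
    refine ⟨(h, J), hJ, fun f hf U hU => ?_⟩
    obtain ⟨U, hU'⟩ := U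
    obtain ⟨V, rfl⟩ := hU
    exact hf V
  · rintro ⟨h, J⟩ hJ
    exact ⟨(_, J), ⟨⟨h, rfl⟩, hJ⟩, fun f hf V => hf _ ⟨V, rfl⟩⟩

variable (p k) in
theorem hasBasis_nhds_zero :
    (𝓝 (0 : UnifMeasure p k)).HasBasis (fun i : ℕ × Ideal k => IsOpen (i.2 : Set k))
      fun i => {μ | ∀ V, push μ.toFun i.1 V ∈ i.2} := by
  rw [isUniformInducing_toUniformOnFun.isInducing.nhds_eq_comap, map_zero]
  exact (hasBasis_nhds_zero_uniformOnFun p k).comap _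

theorem exists_push_sub_mem {f : UniformOnFun (unifMeasurable p) k (radii p)}
    (hf : f ∈ closure (Set.range (toUniformOnFun : UnifMeasure p k →+ _))) (h : ℕ) {J : Ideal k}
    (hJ : IsOpen (J : Set k)) :
    ∃ μ : UnifMeasure p k, ∀ V,
      push μ.toFun h V - push (UniformOnFun.toFun (radii p) f) h V ∈ J := by
  have hsub : Tendsto (fun g => g - f) (𝓝 f) (𝓝 0) := tendsto_sub_nhds_zero_iff.2 tendsto_id
  obtain ⟨_, hμ, μ, rfl⟩ := mem_closure_iff_nhds.1 hf _
    (hsub ((hasBasis_nhds_zero_uniformOnFun p k).mem_of_mem (i := (h, J)) hJ))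
  exact ⟨μ, hμ⟩

theorem isMeas_push_of_mem_closure {f : UniformOnFun (unifMeasurable p) k (radii p)}
    (hf : f ∈ closure (Set.range (toUniformOnFun : UnifMeasure p k →+ _))) (h : ℕ) :
    IsMeas (push (UniformOnFun.toFun (radii p) f) h) := by
  set g := push (UniformOnFun.toFun (radii p) f) h
  intro A V hV
  refine tendsto_sub_nhds_zero_iff.1
    ((IsLinearTopology.hasBasis_open_ideal (R := k)).tendsto_right_iff.2 fun J hJ => ?_)
  obtain ⟨μ, hμ⟩ := exists_push_sub_mem hf h hJ
  have hlim : Tendsto _ _ _ := tendsto_sub_nhds_zero_iff.2 (isMeas_push μ h A V hV)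
  filter_upwards [hlim (hJ.mem_nhds J.zero_mem)] with s hs
  have hsum : ∑ a ∈ s, (push μ.toFun h (V a) - g (V a)) ∈ J := J.sum_mem fun a _ => hμ (V a)
  have := J.sub_mem (J.add_mem hs (hμ (⋃ a, V a))) hsum
  rw [Finset.sum_sub_distrib] at this
  change _ ∈ J
  convert this using 1
  ring

theorem isClosed_range_toUniformOnFun :
    IsClosed (Set.range (toUniformOnFun : UnifMeasure p k →+ _)) :=
  isClosed_of_closure_subset fun f hf =>
    ⟨ofPush (UniformOnFun.toFun (radii p) f) (isMeas_push_of_mem_closure hf), rfl⟩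

instance [CompleteSpace k] : CompleteSpace (UnifMeasure p k) :=
  (completeSpace_iff_isComplete_range isUniformInducing_toUniformOnFun).2
    isClosed_range_toUniformOnFun.isComplete

variable [CompleteSpace k] [T2Space k]

/-- The ideal of the measures whose values on the sets of radius `h` lie in the open ideal `J`;
these ideals form a basis of neighborhoods of zero. -/
def levelIdeal (p : ℕ) [Fact p.Prime] (h : ℕ) (J : Ideal k) (hJ : IsOpen (J : Set k)) :
    Ideal (UnifMeasure p k) where
  carrier := {μ | ∀ V, push μ.toFun h V ∈ J}
  zero_mem' _ := J.zero_mem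
  add_mem' ha hb V := J.add_mem (ha V) (hb V)
  smul_mem' c μ hμ V := by
    rw [smul_eq_mul, push_mul]
    exact ideal_mem_of_hasSum ((isMeas_push c h).summable _).hasSum hJ
      fun d => J.mul_mem_left _ (hμ _)

theorem mem_levelIdeal_iff_singleton {h : ℕ} {J : Ideal k} {hJ : IsOpen (J : Set k)}
    {μ : UnifMeasure p k} : μ ∈ levelIdeal p h J hJ ↔ ∀ x, push μ.toFun h {x} ∈ J := by
  refine ⟨fun H x => H _, fun H V => ?_⟩
  have hsum := isMeas_push μ h V (fun d => {d.1})
    fun a b hab => by simpa [Subtype.ext_iff] using hab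
  rw [show (⋃ a : V, ({a.1} : Set (ℚ_[p] ⧸ ballSubgroup p h))) = V by ext; simp] at hsum
  exact ideal_mem_of_hasSum hsum hJ fun a => H _

theorem levelIdeal_mono {h h' : ℕ} (hh : h' ≤ h) {J J' : Ideal k} (hJJ : J ≤ J')
    (hJ : IsOpen (J : Set k)) (hJ' : IsOpen (J' : Set k)) :
    levelIdeal p h J hJ ≤ levelIdeal p h' J' hJ' := fun μ hμ V => by
  rw [push_transition _ hh]
  exact hJJ (hμ _)

variable (p k) in
theorem hasBasis_levelIdeal :
    (𝓝 (0 : UnifMeasure p k)).HasBasis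
      (fun _ : ℕ × {J : Ideal k // IsOpen (J : Set k)} => True)
      fun i => (levelIdeal p i.1 i.2.1 i.2.2 : Set (UnifMeasure p k)) :=
  (hasBasis_nhds_zero p k).to_hasBasis (fun i hi => ⟨(i.1, ⟨i.2, hi⟩), trivial, fun _ h => h⟩)
    fun i _ => ⟨(i.1, i.2.1), i.2.2, fun _ h => h⟩

instance : IsLinearTopology (UnifMeasure p k) (UnifMeasure p k) :=
  IsLinearTopology.mk_of_hasBasis' (R := UnifMeasure p k) (hasBasis_levelIdeal p k)
    fun I r _ hx => I.smul_mem r hx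

instance : IsTopologicalRing (UnifMeasure p k) := isTopologicalRing_of_isLinearTopology

/-- The ideal of the measures whose values on the sets of radius `n` lie in the `n`-th power of an
ideal defining the topology of `k`. -/
def levelIdealPow (p : ℕ) [Fact p.Prime] {I : Ideal k} (hI : IsAdic I) (n : ℕ) :
    Ideal (UnifMeasure p k) :=
  levelIdeal p n (I ^ n) ((isAdic_iff.1 hI).1 n)

theorem antitone_levelIdealPow {I : Ideal k} (hI : IsAdic I) : Antitone (levelIdealPow p hI) :=
  fun _ _ h => levelIdeal_mono h (Ideal.pow_le_pow_right h) _ _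

theorem hasBasis_levelIdealPow {I : Ideal k} (hI : IsAdic I) :
    (𝓝 (0 : UnifMeasure p k)).HasBasis (fun _ => True)
      fun n => (levelIdealPow p hI n : Set (UnifMeasure p k)) := by
  refine (hasBasis_levelIdeal p k).to_hasBasis (fun ⟨h, J, hJ⟩ _ => ?_)
    fun n _ => ⟨(n, ⟨I ^ n, (isAdic_iff.1 hI).1 n⟩), trivial, subset_rfl⟩
  obtain ⟨n, hn⟩ := (isAdic_iff.1 hI).2 J (hJ.mem_nhds J.zero_mem)
  exact ⟨max h n, trivial, levelIdeal_mono (le_max_left h n)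
    ((Ideal.pow_le_pow_right (le_max_right h n)).trans hn) _ hJ⟩

end Topology

end UnifMeasure

section GroupAlgebra

open AddMonoidAlgebra

variable {R G : Type*} [CommRing R] [AddCommGroup G]

theorem single_zsmul_sub_one_mem_span (g : G) (n : ℤ) :
    (single (n • g) 1 - single 0 1 : AddMonoidAlgebra R G) ∈
      Ideal.span {(single g 1 - single 0 1 : AddMonoidAlgebra R G)} := by
  have hnat (m : ℕ) : (single (m • g) 1 - single 0 1 : AddMonoidAlgebra R G) ∈
      Ideal.span {(single g 1 - single 0 1 : AddMonoidAlgebra R G)} := by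
    rw [Ideal.mem_span_singleton]
    simpa [single_pow, one_def] using sub_one_dvd_pow_sub_one (single g 1 : AddMonoidAlgebra R G) m
  obtain ⟨m, rfl | rfl⟩ := n.eq_nat_or_neg
  · simpa only [natCast_zsmul] using hnat m
  · have := Ideal.mul_mem_left _ (-single (-(m • g)) 1) (hnat m)
    simpa [mul_sub, single_mul_single, neg_add_eq_sub] using this

theorem sub_mapDomain_mem_span {g : G} {r : G → G}
    (hr : ∀ x, x - r x ∈ AddSubgroup.zmultiples g) (a : AddMonoidAlgebra R G) :
    a - a.mapDomain r ∈ Ideal.span {(single g 1 - single 0 1 : AddMonoidAlgebra R G)} := by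
  induction a using AddMonoidAlgebra.induction_linear with
  | zero => simp
  | add x y hx hy =>
    rw [mapDomain_add, add_sub_add_comm]
    exact Ideal.add_mem _ hx hy
  | single x c =>
    obtain ⟨n, hn⟩ := AddSubgroup.mem_zmultiples_iff.1 (hr x)
    have := Ideal.mul_mem_left _ (single (r x) c) (single_zsmul_sub_one_mem_span (R := R) g n)
    rwa [mul_sub, single_mul_single, single_mul_single, hn, mul_one, add_zero, add_sub_cancel,
      ← mapDomain_single (f := r)] at this

theorem mapDomain_mem_map_algebraMap {X : Type*} {I : Ideal R} {b : AddMonoidAlgebra R X}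
    (hb : ∀ y, b.coeff y ∈ I) (s : X → G) :
    b.mapDomain s ∈ I.map (algebraMap R (AddMonoidAlgebra R G)) := by
  classical
  have hb' : b.mapDomain s = b.coeff.sum fun y c => single (s y) c := by
    ext
    simp [Finsupp.mapDomain, Finsupp.sum]
  rw [hb']
  refine Ideal.sum_mem _ fun y _ => ?_
  have := Ideal.mul_mem_left _ (single (s y) 1)
    (Ideal.mem_map_of_mem (algebraMap R (AddMonoidAlgebra R G)) (hb y))
  simpa [mapDomain_single, single_mul_single] using this

theorem mem_map_sup_span_of_coeff_mapDomain_mem {X : Type*} {g : G} {f : G → X}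
    (hf : ∀ x y, f x = f y → x - y ∈ AddSubgroup.zmultiples g) {I : Ideal R}
    {a : AddMonoidAlgebra R G} (ha : ∀ y, (a.mapDomain f).coeff y ∈ I) :
    a ∈ I.map (algebraMap R (AddMonoidAlgebra R G)) ⊔ Ideal.span {single g 1 - single 0 1} := by
  have hs (x : G) : f (Function.invFun f (f x)) = f x := Function.invFun_eq ⟨x, rfl⟩
  have h1 := mapDomain_mem_map_algebraMap ha (Function.invFun f)
  have h2 := sub_mapDomain_mem_span (r := Function.invFun f ∘ f)
    (fun x => hf _ _ (hs x).symm) a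
  rw [← add_sub_cancel (mapDomain (Function.invFun f) (a.mapDomain f)) a]
  refine Submodule.add_mem_sup h1 ?_
  convert h2 using 2
  ext
  simp [Finsupp.mapDomain_comp]

end GroupAlgebra

section Ball

variable {p : ℕ} [Fact p.Prime]

theorem mem_ballSubgroup {h : ℕ} {x : ℚ_[p]} :
    x ∈ ballSubgroup p h ↔ ‖x‖ ≤ (p : ℝ) ^ (-(h : ℤ)) := Iff.rfl

theorem div_pow_mem_ballSubgroup {h n : ℕ} {x : ℚ_[p]} :
    x / (p : ℚ_[p]) ^ n ∈ ballSubgroup p h ↔ ‖x‖ ≤ (p : ℝ) ^ (-((n + h : ℕ) : ℤ)) := by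
  have hp0 : (0 : ℝ) < p := by exact_mod_cast (Fact.out : p.Prime).pos
  rw [mem_ballSubgroup, norm_div, norm_pow, Padic.norm_p, div_le_iff₀ (by positivity), inv_pow,
    ← zpow_natCast, ← zpow_neg, ← zpow_add₀ hp0.ne', ← neg_add_rev, Nat.cast_add]

theorem intCast_div_pow_mem_ballSubgroup {h n : ℕ} {m : ℤ} :
    (m : ℚ_[p]) / (p : ℚ_[p]) ^ n ∈ ballSubgroup p h ↔ ((p ^ (n + h) : ℕ) : ℤ) ∣ m := by
  rw [div_pow_mem_ballSubgroup, Padic.norm_int_le_pow_iff_dvd, Nat.cast_pow]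

theorem exists_natCast_div_pow_eq (h : ℕ) (x : ℚ_[p] ⧸ ballSubgroup p h) :
    ∃ m n : ℕ, (((m : ℚ_[p]) / (p : ℚ_[p]) ^ n : ℚ_[p]) : ℚ_[p] ⧸ ballSubgroup p h) = x := by
  have hp : (p : ℚ_[p]) ≠ 0 := by exact_mod_cast (Fact.out : p.Prime).ne_zero
  obtain ⟨x, rfl⟩ := QuotientAddGroup.mk_surjective x
  obtain ⟨n, hn⟩ := pow_unbounded_of_one_lt ‖x‖
    (show (1 : ℝ) < p by exact_mod_cast (Fact.out : p.Prime).one_lt)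
  have hy : ‖x * (p : ℚ_[p]) ^ n‖ ≤ 1 := by
    rw [norm_mul, norm_pow, Padic.norm_p, inv_pow]
    exact mul_inv_le_one_of_le₀ hn.le (by positivity)
  let y : ℤ_[p] := ⟨_, hy⟩
  refine ⟨y.appr (n + h), n, ?_⟩
  have happr := PadicInt.appr_spec (n + h) y
  rw [← PadicInt.norm_le_pow_iff_mem_span_pow, PadicInt.norm_def] at happr
  have hsub : -((y.appr (n + h) : ℚ_[p]) / (p : ℚ_[p]) ^ n) + x =
      ((y - (y.appr (n + h) : ℤ_[p]) : ℤ_[p]) : ℚ_[p]) / (p : ℚ_[p]) ^ n := by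
    push_cast
    field_simp
    ring
  rwa [QuotientAddGroup.eq, hsub, div_pow_mem_ballSubgroup]

theorem exists_eq_intCast_mul_pow {h : ℕ} {x : ℚ_[p]} (hx : x ∈ UnifMeasure.zInv p)
    (hb : x ∈ ballSubgroup p h) : ∃ m : ℤ, x = m * (p : ℚ_[p]) ^ h := by
  have hp : (p : ℚ_[p]) ≠ 0 := by exact_mod_cast (Fact.out : p.Prime).ne_zero
  obtain ⟨n, m, hm⟩ := hx
  obtain rfl : x = (m : ℚ_[p]) / (p : ℚ_[p]) ^ n := by
    rw [← hm, mul_div_cancel_right₀ _ (pow_ne_zero _ hp)]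
  obtain ⟨c, rfl⟩ := intCast_div_pow_mem_ballSubgroup.1 hb
  refine ⟨c, ?_⟩
  push_cast
  field_simp
  ring

theorem exists_notMem_ballSubgroup {x : ℚ_[p]} (hx : x ≠ 0) : ∃ h, x ∉ ballSubgroup p h := by
  have hp : (1 : ℝ) < p := by exact_mod_cast (Fact.out : p.Prime).one_lt
  obtain ⟨n, hn⟩ := exists_pow_lt_of_lt_one (norm_pos_iff.2 hx) (inv_lt_one_of_one_lt₀ hp)
  refine ⟨n, fun h => hn.not_ge ?_⟩
  rwa [mem_ballSubgroup, zpow_neg, zpow_natCast, ← inv_pow] at h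

theorem exists_injOn_mk_ballSubgroup (s : Finset ℚ_[p]) :
    ∃ h, Set.InjOn (QuotientAddGroup.mk : ℚ_[p] → ℚ_[p] ⧸ ballSubgroup p h) s := by
  classical
  have hsep (z : ℚ_[p] × ℚ_[p]) : ∃ h, z.1 ≠ z.2 → -z.1 + z.2 ∉ ballSubgroup p h := by
    by_cases hz : z.1 = z.2
    · exact ⟨0, fun h => absurd hz h⟩
    · exact (exists_notMem_ballSubgroup fun h => hz (neg_add_eq_zero.1 h)).imp fun _ h _ => h
  choose H hH using hsep
  refine ⟨(s ×ˢ s).sup H, fun x hx y hy hxy => by_contra fun hne => hH (x, y) hne ?_⟩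
  exact UnifMeasure.ballSubgroup_anti (Finset.le_sup (Finset.mk_mem_product hx hy))
    (QuotientAddGroup.eq.1 hxy)

end Ball

namespace UnifMeasure

open DiscreteMeasure

section Dirac

variable {p : ℕ} [Fact p.Prime] {k : Type} [CommRing k] [UniformSpace k]

open Classical in
theorem push_dirac (a : ℚ_[p]) (h : ℕ) (x : ℚ_[p] ⧸ ballSubgroup p h) :
    push (dirac k a).toFun h {x} = if (a : ℚ_[p] ⧸ ballSubgroup p h) = x then 1 else 0 :=
  if_congr Iff.rfl rfl rfl

variable [IsUniformAddGroup k] [IsTopologicalRing k]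

theorem diracSub_eq (n : ℕ) : diracSub p k n = dirac k (1 / (p : ℚ_[p]) ^ n) - 1 := rfl

variable [IsLinearTopology k k] [CompleteSpace k] [T2Space k]

theorem dirac_nsmul (n : ℕ) (a : ℚ_[p]) : dirac k (n • a) = dirac k a ^ n :=
  (diracHom p k).map_pow (Multiplicative.ofAdd a) n

theorem dirac_natCast_div_pow (m n : ℕ) :
    dirac k ((m : ℚ_[p]) / (p : ℚ_[p]) ^ n) = (diracSub p k n + 1) ^ m := by
  rw [diracSub_eq, sub_add_cancel, ← dirac_nsmul, nsmul_eq_mul, mul_one_div]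

theorem dirac_sub_one_mem_levelIdeal {h : ℕ} {a : ℚ_[p]} (ha : a ∈ ballSubgroup p h) {J : Ideal k}
    (hJ : IsOpen (J : Set k)) : dirac k a - 1 ∈ levelIdeal p h J hJ := by
  classical
  refine mem_levelIdeal_iff_singleton.2 fun x => ?_
  change push (dirac k a).toFun h {x} - push (dirac k 0).toFun h {x} ∈ J
  have : (a : ℚ_[p] ⧸ ballSubgroup p h) = (0 : ℚ_[p]) := by
    rw [QuotientAddGroup.eq, add_zero]
    exact neg_mem ha
  rw [push_dirac, push_dirac, this, sub_self]
  exact J.zero_mem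

variable {R : Type} [CommRing R] [Algebra R (UnifMeasure p k)]

theorem ofGroupAlgebra_single (x : ℚ_[p]) (c : R) :
    ofGroupAlgebra p R k (AddMonoidAlgebra.single x c) = c • dirac k x :=
  AddMonoidAlgebra.lift_single _ _ _

theorem ofGroupAlgebraZInv_single (x : zInv p) (c : R) :
    ofGroupAlgebraZInv p R k (AddMonoidAlgebra.single x c) = c • dirac k (x : ℚ_[p]) :=
  AddMonoidAlgebra.lift_single _ _ _

theorem ofGroupAlgebraZInv_eq (a : AddMonoidAlgebra R (zInv p)) :
    ofGroupAlgebraZInv p R k a = ofGroupAlgebra p R k (a.mapDomain (zInv p).subtype) := by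
  induction a using AddMonoidAlgebra.induction_linear with
  | zero => simp
  | add x z hx hz => rw [map_add, AddMonoidAlgebra.mapDomain_add, map_add, hx, hz]
  | single x c =>
    rw [AddMonoidAlgebra.mapDomain_single, ofGroupAlgebra_single, ofGroupAlgebraZInv_single]
    rfl

theorem smul_dirac_mem_range_ofGroupAlgebraZInv (c : R) (m n : ℕ) :
    c • dirac k ((m : ℚ_[p]) / (p : ℚ_[p]) ^ n) ∈ Set.range (ofGroupAlgebraZInv p R k) := by
  have hp : (p : ℚ_[p]) ≠ 0 := by exact_mod_cast (Fact.out : p.Prime).ne_zero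
  exact ⟨_, ofGroupAlgebraZInv_single
    ⟨(m : ℚ_[p]) / (p : ℚ_[p]) ^ n, n, m, by simp [div_mul_cancel₀ _ (pow_ne_zero n hp)]⟩ c⟩

variable [Algebra R k] [IsScalarTower R k (UnifMeasure p k)]

theorem push_ofGroupAlgebra (a : AddMonoidAlgebra R ℚ_[p]) (h : ℕ) (y : ℚ_[p] ⧸ ballSubgroup p h) :
    push (ofGroupAlgebra p R k a).toFun h {y} =
      algebraMap R k ((a.mapDomain (QuotientAddGroup.mk (s := ballSubgroup p h))).coeff y) := by
  classical
  induction a using AddMonoidAlgebra.induction_linear with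
  | zero => simp [show push (0 : UnifMeasure p k).toFun h {y} = 0 from rfl]
  | add x z hx hz =>
    rw [map_add, AddMonoidAlgebra.mapDomain_add, AddMonoidAlgebra.coeff_add, Finsupp.add_apply,
      map_add, ← hx, ← hz]
    rfl
  | single x c =>
    rw [AddMonoidAlgebra.mapDomain_single, AddMonoidAlgebra.coeff_single, Finsupp.single_apply,
      ofGroupAlgebra_single, ← algebraMap_smul k]
    refine (congrArg (algebraMap R k c * ·) (push_dirac x h y)).trans ?_
    split_ifs <;> simp

theorem ofGroupAlgebra_injective (hR : Function.Injective (algebraMap R k)) :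
    Function.Injective (ofGroupAlgebra p R k) := by
  refine (injective_iff_map_eq_zero _).2 fun a ha => ?_
  obtain ⟨h, hinj⟩ := exists_injOn_mk_ballSubgroup a.coeff.support
  refine AddMonoidAlgebra.coeff_injective (Finsupp.mapDomain_injOn _ hinj
    (Set.mem_ofPred.2 subset_rfl) (by simp) (Finsupp.ext fun y => hR ?_))
  have := push_ofGroupAlgebra (k := k) a h y
  rw [ha, AddMonoidAlgebra.coeff_mapDomain] at this
  exact this.symm.trans (by simp; rfl)

theorem ofGroupAlgebraZInv_injective (hR : Function.Injective (algebraMap R k)) :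
    Function.Injective (ofGroupAlgebraZInv p R k) := by
  intro a b hab
  rw [ofGroupAlgebraZInv_eq, ofGroupAlgebraZInv_eq] at hab
  exact AddMonoidAlgebra.mapDomain_injective (zInv p).subtype_injective
    (ofGroupAlgebra_injective (p := p) hR hab)

theorem exists_sub_ofGroupAlgebra_mem_levelIdeal (hR : DenseRange (algebraMap R k))
    (μ : UnifMeasure p k) {h : ℕ} {J : Ideal k} (hJ : IsOpen (J : Set k))
    {r : ℚ_[p] ⧸ ballSubgroup p h → ℚ_[p]} (hr : ∀ x, (r x : ℚ_[p] ⧸ ballSubgroup p h) = x) :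
    ∃ b : AddMonoidAlgebra R (ℚ_[p] ⧸ ballSubgroup p h),
      μ - ofGroupAlgebra p R k (b.mapDomain r) ∈ levelIdeal p h J hJ := by
  have happrox (x : ℚ_[p] ⧸ ballSubgroup p h) : ∃ c : R,
      push μ.toFun h {x} - algebraMap R k c ∈ J ∧ (push μ.toFun h {x} ∈ J → c = 0) := by
    by_cases hx : push μ.toFun h {x} ∈ J
    · exact ⟨0, by simpa using hx, fun _ => rfl⟩
    · obtain ⟨c, hc⟩ := (denseRange_iff_exists_sub_mem
        (IsLinearTopology.hasBasis_open_ideal (R := k))).1 hR J hJ (push μ.toFun h {x})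
      exact ⟨c, hc, fun h => absurd h hx⟩
  choose c hc hc0 using happrox
  have hfin := (isMeas_push μ h).finite J hJ
  let b : AddMonoidAlgebra R (ℚ_[p] ⧸ ballSubgroup p h) := .ofCoeff <|
    Finsupp.onFinset hfin.toFinset c fun x hx => hfin.mem_toFinset.2 fun h => hx (hc0 x h)
  have hb : (b.mapDomain r).mapDomain (QuotientAddGroup.mk (s := ballSubgroup p h)) = b := by
    refine AddMonoidAlgebra.coeff_injective ?_
    rw [AddMonoidAlgebra.coeff_mapDomain, AddMonoidAlgebra.coeff_mapDomain,
      ← Finsupp.mapDomain_comp, show QuotientAddGroup.mk ∘ r = id from funext hr,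
      Finsupp.mapDomain_id]
  refine ⟨b, mem_levelIdeal_iff_singleton.2 fun x => ?_⟩
  change push μ.toFun h {x} - push (ofGroupAlgebra p R k (b.mapDomain r)).toFun h {x} ∈ J
  rw [push_ofGroupAlgebra, hb]
  exact hc x

theorem denseRange_of_smul_dirac_mem (hR : DenseRange (algebraMap R k)) {A : Type*} [Ring A]
    {f : A →+* UnifMeasure p k}
    (hf : ∀ (c : R) (m n : ℕ), c • dirac k ((m : ℚ_[p]) / (p : ℚ_[p]) ^ n) ∈ f.range) :
    DenseRange f := by
  refine (denseRange_iff_exists_sub_mem (hasBasis_levelIdeal p k)).2 fun ⟨h, J, hJ⟩ _ μ => ?_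
  choose m n hmn using exists_natCast_div_pow_eq (p := p) h
  obtain ⟨b, hb⟩ := exists_sub_ofGroupAlgebra_mem_levelIdeal hR μ hJ hmn
  suffices ofGroupAlgebra p R k (b.mapDomain _) ∈ f.range by
    obtain ⟨a, ha⟩ := this
    exact ⟨a, ha ▸ hb⟩
  clear hb
  induction b using AddMonoidAlgebra.induction_linear with
  | zero => simp
  | add x y hx hy =>
    rw [AddMonoidAlgebra.mapDomain_add, map_add]
    exact add_mem hx hy
  | single x c =>
    rw [AddMonoidAlgebra.mapDomain_single, ofGroupAlgebra_single]
    exact hf c (m x) (n x)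

theorem mem_sup_of_ofGroupAlgebraZInv_mem_levelIdeal {h : ℕ} {J : Ideal k}
    {hJ : IsOpen (J : Set k)} {a : AddMonoidAlgebra R (zInv p)}
    (ha : ofGroupAlgebraZInv p R k a ∈ levelIdeal p h J hJ) :
    a ∈ (J.comap (algebraMap R k)).map (algebraMap R (AddMonoidAlgebra R (zInv p))) ⊔
      Ideal.span {AddMonoidAlgebra.single (p ^ h • zInvOne p) 1 - AddMonoidAlgebra.single 0 1} := by
  refine mem_map_sup_span_of_coeff_mapDomain_mem
    (f := fun x : zInv p => ((x : ℚ_[p]) : ℚ_[p] ⧸ ballSubgroup p h)) (fun x y hxy => ?_)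
    fun y => ?_
  · have hmem : ((x - y : zInv p) : ℚ_[p]) ∈ ballSubgroup p h := by
      simpa [neg_add_eq_sub] using QuotientAddGroup.eq.1 hxy.symm
    obtain ⟨m, hm⟩ := exists_eq_intCast_mul_pow (x - y).2 hmem
    exact AddSubgroup.mem_zmultiples_iff.2 ⟨m, Subtype.ext (by simpa [zInvOne] using hm.symm)⟩
  · have := mem_levelIdeal_iff_singleton.1 ha y
    rw [ofGroupAlgebraZInv_eq, push_ofGroupAlgebra] at this
    simpa [← Finsupp.mapDomain_comp, Function.comp_def] using this

end Dirac

end UnifMeasure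

section PowPrimePow

variable {A : Type*} [CommRing A] {p : ℕ} [Fact p.Prime]

theorem pow_prime_pow_sub_one_mem_pow (x : A) (n : ℕ) :
    x ^ p ^ n - 1 ∈ Ideal.span {(p : A), x - 1} ^ (n + 1) := by
  induction n with
  | zero => simpa using Ideal.subset_span (by simp : x - 1 ∈ ({(p : A), x - 1} : Set A))
  | succ n ih =>
    set I := Ideal.span {(p : A), x - 1}
    set y := x ^ p ^ n - 1
    obtain ⟨r, hr⟩ := exists_add_pow_prime_eq (Fact.out : p.Prime) y 1
    have hxy : x ^ p ^ (n + 1) - 1 = y ^ p + (p : A) * y * r := by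
      rw [pow_succ, pow_mul, show x ^ p ^ n = y + 1 by simp [y], hr]
      ring
    have hp : (p : A) ∈ I := Ideal.subset_span (by simp)
    have hle : n + 1 + 1 ≤ (n + 1) * p := by nlinarith [(Fact.out : p.Prime).two_le]
    rw [hxy]
    refine add_mem (Ideal.pow_le_pow_right hle ?_) (Ideal.mul_mem_right _ _ ?_)
    · rw [pow_mul]
      exact Ideal.pow_mem_pow ih p
    · rw [pow_succ']
      exact Ideal.mul_mem_mul hp ih

theorem sub_one_pow_mem {K : Ideal A} {x : A} {h n : ℕ} (hp : (p : A) ^ n ∈ K)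
    (hx : x ^ p ^ h - 1 ∈ K) : (x - 1) ^ (p ^ h * n) ∈ K := by
  obtain ⟨r, hr⟩ := exists_add_pow_prime_pow_eq (Fact.out : p.Prime) (x - 1) 1 h
  set d := (x - 1) ^ p ^ h
  have hd : x ^ p ^ h - 1 ∣ d ^ n - (-(p * ((x - 1) * r))) ^ n := by
    refine dvd_trans (dvd_of_eq ?_) (sub_dvd_pow_sub_pow _ _ n)
    rw [sub_add_cancel, one_pow] at hr
    rw [hr]
    ring
  rw [pow_mul]
  refine (Submodule.sub_mem_iff_left _ ?_).1 (K.mem_of_dvd hd hx)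
  rw [neg_pow, mul_pow]
  exact Ideal.mul_mem_left _ _ (Ideal.mul_mem_right _ _ hp)

end PowPrimePow

namespace UnifMeasure

open DiscreteMeasure

section AdicTopology

variable {p : ℕ} [Fact p.Prime] {k : Type} [CommRing k] [UniformSpace k] [IsUniformAddGroup k]
  [IsTopologicalRing k] [IsLinearTopology k k] [CompleteSpace k] [T2Space k]
  (hk : IsAdic (Ideal.span {(p : k)}))

theorem natCast_pow_mul_toFun (n : ℕ) (μ : UnifMeasure p k) (U : unifMeasurable p) :
    ((p : UnifMeasure p k) ^ n * μ).toFun U = (p : k) ^ n * μ.toFun U := by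
  rw [← Nat.cast_pow, ← Nat.cast_pow, ← nsmul_eq_mul, ← nsmul_eq_mul]
  rfl

theorem span_natCast_pow_le_levelIdealPow (n : ℕ) :
    Ideal.span {(p : UnifMeasure p k)} ^ n ≤ levelIdealPow p hk n := by
  rw [Ideal.span_singleton_pow, Ideal.span_singleton_le_iff_mem]
  intro V
  rw [← mul_one ((p : UnifMeasure p k) ^ n)]
  change ((p : UnifMeasure p k) ^ n * 1).toFun _ ∈ _
  rw [natCast_pow_mul_toFun]
  exact Ideal.mul_mem_right _ _ (Ideal.pow_mem_pow (Ideal.mem_span_singleton_self _) n)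

theorem natCast_pow_mem_levelIdealPow (n : ℕ) :
    (p : UnifMeasure p k) ^ n ∈ levelIdealPow p hk n :=
  span_natCast_pow_le_levelIdealPow hk n (Ideal.pow_mem_pow (Ideal.mem_span_singleton_self _) n)

variable {R : Type} [CommRing R] [Algebra R (UnifMeasure p k)]

theorem exists_pow_le_comap_levelIdealPow (n : ℕ) :
    ∃ m, Ideal.span {(p : AddMonoidAlgebra R (zInv p)),
      AddMonoidAlgebra.single (zInvOne p) 1 - AddMonoidAlgebra.single 0 1} ^ m ≤
        (levelIdealPow p hk n).comap (ofGroupAlgebraZInv p R k) := by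
  have hp : (p : AddMonoidAlgebra R (zInv p)) ^ n ∈
      (levelIdealPow p hk n).comap (ofGroupAlgebraZInv p R k) := by
    simpa using natCast_pow_mem_levelIdealPow hk n
  have hT : (AddMonoidAlgebra.single (zInvOne p) 1 : AddMonoidAlgebra R (zInv p)) ^ p ^ n - 1 ∈
      (levelIdealPow p hk n).comap (ofGroupAlgebraZInv p R k) := by
    rw [Ideal.mem_comap, map_sub, map_pow, ofGroupAlgebraZInv_single, one_smul, map_one,
      ← dirac_nsmul]
    refine dirac_sub_one_mem_levelIdeal ?_ _
    simpa [zInvOne] using intCast_div_pow_mem_ballSubgroup (p := p) (h := n) (n := 0) (m := p ^ n)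
  exact ⟨_, (pow_span_pair_le _ _ _ _).trans <| Ideal.span_le.2 <| Set.pair_subset hp <|
    sub_one_pow_mem hp hT⟩

variable [Algebra R k] [IsScalarTower R k (UnifMeasure p k)]

theorem comap_levelIdealPow_le
    (hR : ∀ n, (Ideal.span {(p : k)} ^ n).comap (algebraMap R k) ≤ Ideal.span {(p : R)} ^ n)
    (n : ℕ) :
    (levelIdealPow p hk n).comap (ofGroupAlgebraZInv p R k) ≤
      Ideal.span {(p : AddMonoidAlgebra R (zInv p)),
        AddMonoidAlgebra.single (zInvOne p) 1 - AddMonoidAlgebra.single 0 1} ^ n := by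
  intro a ha
  refine (sup_le ((Ideal.map_mono (hR n)).trans ?_) ?_ :
    (_ ⊔ _ : Ideal (AddMonoidAlgebra R (zInv p))) ≤ _)
    (mem_sup_of_ofGroupAlgebraZInv_mem_levelIdeal (hJ := (isAdic_iff.1 hk).1 n) ha)
  · rw [Ideal.map_pow, Ideal.map_span, Set.image_singleton, map_natCast]
    exact Ideal.pow_right_mono (Ideal.span_mono (by simp)) n
  · rw [Ideal.span_singleton_le_iff_mem]
    have := pow_prime_pow_sub_one_mem_pow (p := p)
      (AddMonoidAlgebra.single (zInvOne p) 1 : AddMonoidAlgebra R (zInv p)) n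
    rw [AddMonoidAlgebra.single_pow, one_pow] at this
    exact Ideal.pow_le_pow_right n.le_succ this

theorem denseRange_ofGroupAlgebraZInv (hR : DenseRange (algebraMap R k)) :
    DenseRange (ofGroupAlgebraZInv p R k) :=
  denseRange_of_smul_dirac_mem hR smul_dirac_mem_range_ofGroupAlgebraZInv

theorem denseRange_ofGroupAlgebra (hR : DenseRange (algebraMap R k)) :
    DenseRange (ofGroupAlgebra p R k) :=
  denseRange_of_smul_dirac_mem hR fun c _ _ => ⟨_, ofGroupAlgebra_single _ c⟩

include hk in
theorem isRingCompletion_ofGroupAlgebraZInv (hRd : DenseRange (algebraMap R k))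
    (hR : ∀ n, (Ideal.span {(p : k)} ^ n).comap (algebraMap R k) ≤ Ideal.span {(p : R)} ^ n) :
    IsRingCompletion (Ideal.span {(p : AddMonoidAlgebra R (zInv p)),
      AddMonoidAlgebra.single (zInvOne p) 1 - AddMonoidAlgebra.single 0 1}).adicTopology
      (ofGroupAlgebraZInv p R k) :=
  isRingCompletion_adicTopology (hasBasis_levelIdealPow hk) (exists_pow_le_comap_levelIdealPow hk)
    (comap_levelIdealPow_le hk hR) (denseRange_ofGroupAlgebraZInv hRd)

omit [Algebra R k] [IsScalarTower R k (UnifMeasure p k)] in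
theorem map_span_ofGroupAlgebraZInv :
    (Ideal.span {(p : AddMonoidAlgebra R (zInv p)),
      AddMonoidAlgebra.single (zInvOne p) 1 - AddMonoidAlgebra.single 0 1}).map
        (ofGroupAlgebraZInv p R k) = Ideal.span {(p : UnifMeasure p k), diracSub p k 0} := by
  rw [Ideal.map_span, Set.image_pair, map_natCast, map_sub, ofGroupAlgebraZInv_single,
    ofGroupAlgebraZInv_single, one_smul, one_smul]
  simp [diracSub, zInvOne]

include hk in
theorem isAdic_span_diracSub : IsAdic (Ideal.span {(p : UnifMeasure p k), diracSub p k 0}) := by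
  rw [← map_span_ofGroupAlgebraZInv (R := k)]
  exact isAdic_map_of_comap_le (hasBasis_levelIdealPow hk) (antitone_levelIdealPow hk)
    (exists_pow_le_comap_levelIdealPow hk) (comap_levelIdealPow_le hk fun n => le_rfl)
    (denseRange_ofGroupAlgebraZInv Function.surjective_id.denseRange)
    ((Submodule.fg_span (Set.toFinite _)))

include hk in
theorem isRingCompletion_ofGroupAlgebra (hRd : DenseRange (algebraMap R k)) :
    IsRingCompletion ((Ideal.span {(p : UnifMeasure p k), diracSub p k 0}).adicTopology.induced
      (ofGroupAlgebra p R k)) (ofGroupAlgebra p R k) :=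
  isRingCompletion_induced (isAdic_span_diracSub hk) (denseRange_ofGroupAlgebra hRd)

end AdicTopology

theorem isAdic_span_zmod (p : ℕ) [Fact p.Prime] : IsAdic (Ideal.span {(p : ZMod p)}) := by
  rw [CharP.cast_eq_zero, Ideal.span_singleton_zero]
  exact is_bot_adic_iff.2 inferInstance

theorem isAdic_span_padicInt (p : ℕ) [Fact p.Prime] : IsAdic (Ideal.span {(p : ℤ_[p])}) := by
  have hp : (1 : ℝ) < p := by exact_mod_cast (Fact.out : p.Prime).one_lt
  have hpow (n : ℕ) : ((Ideal.span {(p : ℤ_[p])} ^ n : Ideal ℤ_[p]) : Set ℤ_[p]) =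
      Metric.closedBall 0 ((p : ℝ)⁻¹ ^ n) := by
    ext x
    simp [Ideal.span_singleton_pow, ← PadicInt.norm_le_pow_iff_mem_span_pow]
  have hbasis := Metric.nhds_basis_closedBall_pow (x := (0 : ℤ_[p]))
    (inv_pos.2 (zero_lt_one.trans hp)) (inv_lt_one_of_one_lt₀ hp)
  simp only [← hpow] at hbasis
  exact isAdic_of_hasBasis hbasis (fun n => ⟨n, trivial, subset_rfl⟩) fun n _ => ⟨n, subset_rfl⟩

theorem comap_span_padicInt_le (p : ℕ) [Fact p.Prime] (n : ℕ) :
    (Ideal.span {(p : ℤ_[p])} ^ n).comap (algebraMap ℤ ℤ_[p]) ≤ Ideal.span {(p : ℤ)} ^ n := by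
  intro m hm
  rw [Ideal.mem_comap, Ideal.span_singleton_pow, Ideal.mem_span_singleton] at hm
  rw [Ideal.span_singleton_pow, Ideal.mem_span_singleton]
  exact (PadicInt.pow_p_dvd_int_iff n m).1 hm

instance (p : ℕ) [Fact p.Prime] : IsScalarTower ℤ ℤ_[p] (UnifMeasure p ℤ_[p]) :=
  ⟨fun n c μ => toFun_injective (smul_assoc n c μ.toFun)⟩

end UnifMeasure

theorem associated_of_sub_mem_span_mul {B : Type*} [CommRing B] {x : B}
    (hx : x ∈ Ideal.jacobson (⊥ : Ideal B)) {a b : B} (h : b - a ∈ Ideal.span {a * x}) :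
    Associated a b := by
  obtain ⟨c, hc⟩ := Ideal.mem_span_singleton.1 h
  obtain ⟨u, hu⟩ := Ideal.mem_jacobson_bot.1 hx c
  exact ⟨u, by rw [hu]; linear_combination -hc⟩

open Polynomial in
theorem isUnit_aeval_of_mem_jacobson {k B : Type*} [Field k] [CommRing B] [Algebra k B] {x : B}
    (hx : x ∈ Ideal.jacobson (⊥ : Ideal B)) {P : k[X]} (hP : P.coeff 0 ≠ 0) :
    IsUnit (aeval x P) := by
  have hunit : IsUnit (algebraMap k B (P.coeff 0)) := hP.isUnit.map _
  refine (associated_of_sub_mem_span_mul hx (Ideal.mem_span_singleton.2 ?_)).isUnit hunit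
  rw [hunit.mul_left_dvd]
  nth_rw 1 [← divX_mul_X_add P]
  simp

open Polynomial in
theorem associated_pow_aeval {k B : Type*} [Field k] [CommRing B] [Algebra k B] {x : B}
    (hx : x ∈ Ideal.jacobson (⊥ : Ideal B)) {P : k[X]} (hP : P ≠ 0) :
    Associated (x ^ P.natTrailingDegree) (aeval x P) := by
  obtain ⟨Q, hQ⟩ := (X_pow_dvd_iff (f := P)).2 fun i hi => coeff_eq_zero_of_lt_natTrailingDegree hi
  have hQ0 : Q.coeff 0 ≠ 0 := by
    have := coeff_X_pow_mul Q P.natTrailingDegree 0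
    rw [← hQ, zero_add] at this
    rw [← this]
    exact mt trailingCoeff_eq_zero.1 hP
  obtain ⟨u, hu⟩ := isUnit_aeval_of_mem_jacobson hx hQ0
  refine ⟨u, ?_⟩
  rw [hu]
  nth_rw 2 [hQ]
  rw [map_mul, map_pow, aeval_X]

theorem le_of_pow_dvd_pow_of_mem_jacobson {B : Type*} [CommRing B] {x : B}
    (hx : x ∈ Ideal.jacobson (⊥ : Ideal B)) (hnil : ¬ IsNilpotent x) {m n : ℕ}
    (h : x ^ m ∣ x ^ n) : m ≤ n := by
  obtain ⟨c, hc⟩ := h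
  by_contra! hnm
  obtain ⟨d, rfl⟩ := Nat.exists_eq_add_of_lt hnm
  have hunit : IsUnit (x * -(x ^ d * c) + 1) := Ideal.mem_jacobson_bot.1 hx _
  refine hnil ⟨n, hunit.mul_left_eq_zero.1 ?_⟩
  linear_combination hc

namespace PerfPoly

variable {p : ℕ}

theorem exists_natCast_eq (q : zInvNonneg p) : ∃ n m : ℕ, (q : ℚ) * (p : ℚ) ^ n = m := by
  obtain ⟨h0, n, m, hm⟩ := q.2
  have hm0 : 0 ≤ m := by
    have : (0 : ℚ) ≤ m := hm ▸ by positivity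
    exact_mod_cast this
  lift m to ℕ using hm0
  exact ⟨n, m, mod_cast hm⟩

section PowHom

variable {M : Type*} [CommMonoid M] (x : ℕ → M)

theorem pow_prime_pow_eq (hx : ∀ n, x (n + 1) ^ p = x n) (n m : ℕ) :
    x (n + m) ^ p ^ m = x n := by
  induction m with
  | zero => simp
  | succ m ih => rw [pow_succ', pow_mul, ← add_assoc, hx, ih]

theorem pow_mul_prime_pow_eq (hx : ∀ n, x (n + 1) ^ p = x n) (N n : ℕ) :
    x n ^ (p ^ n * N) = x 0 ^ N := by
  rw [pow_mul, ← pow_prime_pow_eq x hx 0 n, zero_add]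

theorem pow_eq_pow (hx : ∀ n, x (n + 1) ^ p = x n) {q : ℚ} {n m n' m' : ℕ}
    (h : q * (p : ℚ) ^ n = m) (h' : q * (p : ℚ) ^ n' = m') : x n ^ m = x n' ^ m' := by
  have hm : p ^ n' * m = p ^ n * m' := by
    have : ((p ^ n' * m : ℕ) : ℚ) = (p ^ n * m' : ℕ) := by
      push_cast
      rw [← h, ← h']
      ring
    exact_mod_cast this
  rw [← pow_prime_pow_eq x hx n n', ← pow_prime_pow_eq x hx n' n, ← pow_mul, ← pow_mul,
    add_comm n' n, hm]

/-- The homomorphism `m / p ^ n ↦ x n ^ m` from the nonnegative elements of `ℤ[1/p]` attached to a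
compatible system of `p`-power roots `x`. -/
noncomputable def powHom (hx : ∀ n, x (n + 1) ^ p = x n) : Multiplicative (zInvNonneg p) →* M where
  toFun q := x (exists_natCast_eq q.toAdd).choose ^ (exists_natCast_eq q.toAdd).choose_spec.choose
  map_one' := by
    rw [pow_eq_pow x hx (exists_natCast_eq _).choose_spec.choose_spec
      (n' := 0) (m' := 0) (by simp), pow_zero]
  map_mul' q r := by
    obtain ⟨n, m, h⟩ := exists_natCast_eq q.toAdd
    obtain ⟨n', m', h'⟩ := exists_natCast_eq r.toAdd
    have hq : (q.toAdd : ℚ) * (p : ℚ) ^ (n + n') = (m * p ^ n' : ℕ) := by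
      push_cast; rw [← h]; ring
    have hr : (r.toAdd : ℚ) * (p : ℚ) ^ (n + n') = (m' * p ^ n : ℕ) := by
      push_cast; rw [← h']; ring
    have hqr : ((q * r).toAdd : ℚ) * (p : ℚ) ^ (n + n') = (m * p ^ n' + m' * p ^ n : ℕ) := by
      rw [Nat.cast_add, ← hq, ← hr, ← add_mul]; rfl
    rw [pow_eq_pow x hx (exists_natCast_eq _).choose_spec.choose_spec hq,
      pow_eq_pow x hx (exists_natCast_eq _).choose_spec.choose_spec hr,
      pow_eq_pow x hx (exists_natCast_eq _).choose_spec.choose_spec hqr, pow_add]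

theorem powHom_apply (hx : ∀ n, x (n + 1) ^ p = x n) (q : zInvNonneg p) {n m : ℕ}
    (h : (q : ℚ) * (p : ℚ) ^ n = m) : powHom x hx (Multiplicative.ofAdd q) = x n ^ m :=
  pow_eq_pow x hx (exists_natCast_eq _).choose_spec.choose_spec h

end PowHom

section Eval

variable [Fact p.Prime] (R : Type) [CommRing R] {B : Type} [CommRing B] [Algebra R B]

/-- Evaluation of the elements of `R[X^{1/p^∞}]` at a compatible system of `p`-power roots. -/
noncomputable def eval (x : ℕ → B) (hx : ∀ n, x (n + 1) ^ p = x n) : PerfPoly R p →ₐ[R] B :=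
  AddMonoidAlgebra.lift R B (zInvNonneg p) (powHom x hx)

theorem eval_root (x : ℕ → B) (hx : ∀ n, x (n + 1) ^ p = x n) (n : ℕ) :
    eval R x hx (root R p n) = x n := by
  have hp : (p : ℚ) ≠ 0 := by exact_mod_cast (Fact.out : p.Prime).ne_zero
  refine (AddMonoidAlgebra.lift_single _ _ _).trans ?_
  rw [one_smul, powHom_apply x hx _ (n := n) (m := 1) (by simp [hp]), pow_one]

theorem root_pow_eq_single {q : zInvNonneg p} {n m : ℕ} (h : (q : ℚ) * (p : ℚ) ^ n = m) (c : R) :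
    c • root R p n ^ m = AddMonoidAlgebra.single q c := by
  have hp : (p : ℚ) ≠ 0 := by exact_mod_cast (Fact.out : p.Prime).ne_zero
  rw [root, AddMonoidAlgebra.single_pow, AddMonoidAlgebra.smul_single, one_pow, smul_eq_mul,
    mul_one]
  congr 1
  ext
  rw [AddSubmonoidClass.coe_nsmul, nsmul_eq_mul, ← h]
  field_simp

theorem root_succ_pow (n : ℕ) : root R p (n + 1) ^ p = root R p n := by
  have hp : (p : ℚ) ≠ 0 := by exact_mod_cast (Fact.out : p.Prime).ne_zero
  rw [← one_smul R (root R p (n + 1) ^ p)]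
  exact root_pow_eq_single R (by field_simp; ring) 1

variable {R}

theorem exists_forall_ge_exists_aeval_root (a : PerfPoly R p) :
    ∃ n₀, ∀ n, n₀ ≤ n → ∃ P : Polynomial R, Polynomial.aeval (root R p n) P = a := by
  induction a using AddMonoidAlgebra.induction_linear with
  | zero => exact ⟨0, fun n _ => ⟨0, map_zero _⟩⟩
  | add x y hx hy =>
    obtain ⟨n, hn⟩ := hx
    obtain ⟨m, hm⟩ := hy
    refine ⟨max n m, fun l hl => ?_⟩
    obtain ⟨P, rfl⟩ := hn l (le_of_max_le_left hl)
    obtain ⟨Q, rfl⟩ := hm l (le_of_max_le_right hl)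
    exact ⟨P + Q, map_add _ _ _⟩
  | single q c =>
    obtain ⟨n, m, h⟩ := exists_natCast_eq q
    refine ⟨n, fun l hl => ?_⟩
    obtain ⟨d, rfl⟩ := Nat.exists_eq_add_of_le hl
    refine ⟨Polynomial.monomial (m * p ^ d) c, ?_⟩
    rw [Polynomial.aeval_monomial, ← Algebra.smul_def, root_pow_eq_single]
    push_cast
    rw [← h]
    ring

theorem exists_aeval_root (a : PerfPoly R p) :
    ∃ (n : ℕ) (P : Polynomial R), Polynomial.aeval (root R p n) P = a :=
  let ⟨n, hn⟩ := exists_forall_ge_exists_aeval_root a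
  ⟨n, hn n le_rfl⟩

theorem eval_aeval_root (x : ℕ → B) (hx : ∀ n, x (n + 1) ^ p = x n) (n : ℕ) (P : Polynomial R) :
    eval R x hx (Polynomial.aeval (root R p n) P) = Polynomial.aeval (x n) P := by
  rw [← Polynomial.aeval_algHom_apply, eval_root]

end Eval

section Jacobson

variable {k : Type} [Field k] {B : Type} [CommRing B] [Algebra k B] {x : ℕ → B}
  (hx : ∀ n, x (n + 1) ^ p = x n) (hjac : x 0 ∈ Ideal.jacobson (⊥ : Ideal B))

include hx hjac in
theorem mem_jacobson (n : ℕ) : x n ∈ Ideal.jacobson (⊥ : Ideal B) := by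
  rw [← pow_prime_pow_eq x hx 0 n, zero_add] at hjac
  exact Ideal.mem_sInf.2 fun {_} hM => hM.2.isPrime.mem_of_pow_mem _ (Ideal.mem_sInf.1 hjac hM)

variable [Fact p.Prime]

include hx in
theorem not_isNilpotent (hnil : ¬ IsNilpotent (x 0)) (n : ℕ) : ¬ IsNilpotent (x n) := fun h =>
  hnil <| by
    rw [← pow_prime_pow_eq x hx 0 n, zero_add]
    exact h.pow_of_pos (pow_ne_zero n (Fact.out : p.Prime).ne_zero)

include hjac in
theorem pow_dvd_of_pow_dvd_eval (hnil : ¬ IsNilpotent (x 0)) {N : ℕ} {a : PerfPoly k p}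
    (ha : x 0 ^ N ∣ eval k x hx a) : root k p 0 ^ N ∣ a := by
  obtain ⟨n, P, rfl⟩ := exists_aeval_root a
  rcases eq_or_ne P 0 with rfl | hP
  · simp
  have hjac' := mem_jacobson hx hjac n
  rw [eval_aeval_root, ← pow_mul_prime_pow_eq x hx N n] at ha
  have hle : p ^ n * N ≤ P.natTrailingDegree :=
    le_of_pow_dvd_pow_of_mem_jacobson hjac' (not_isNilpotent hx hnil n)
      (ha.trans (associated_pow_aeval hjac' hP).symm.dvd)
  have hX : Polynomial.X ^ (p ^ n * N) ∣ P := Polynomial.X_pow_dvd_iff.2 fun i hi =>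
    Polynomial.coeff_eq_zero_of_lt_natTrailingDegree (hi.trans_le hle)
  simpa [pow_mul_prime_pow_eq _ (root_succ_pow k)] using
    map_dvd (Polynomial.aeval (root k p n)) hX

include hjac in
theorem comap_eval_span_pow_le (hnil : ¬ IsNilpotent (x 0)) (N : ℕ) :
    (Ideal.span {x 0} ^ N).comap (eval k x hx) ≤ Ideal.span {root k p 0} ^ N := fun a ha => by
  rw [Ideal.mem_comap, Ideal.span_singleton_pow, Ideal.mem_span_singleton] at ha
  rw [Ideal.span_singleton_pow, Ideal.mem_span_singleton]
  exact pow_dvd_of_pow_dvd_eval hx hjac hnil ha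

include hjac in
theorem eval_injective (hnil : ¬ IsNilpotent (x 0)) : Function.Injective (eval k x hx) := by
  refine (injective_iff_map_eq_zero _).2 fun a ha => ?_
  obtain ⟨n, P, rfl⟩ := exists_aeval_root a
  rw [eval_aeval_root] at ha
  by_contra hP
  have hP : P ≠ 0 := fun h => hP (by rw [h, map_zero])
  have hassoc := associated_pow_aeval (mem_jacobson hx hjac n) hP
  rw [ha, associated_zero_iff_eq_zero] at hassoc
  exact not_isNilpotent hx hnil n ⟨_, hassoc⟩

include hjac in
theorem exists_associated_pow {N : ℕ} {a : PerfPoly k p} {b : B}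
    (ha : b - eval k x hx a ∈ Ideal.span {x 0} ^ N) (hb : b ∉ Ideal.span {x 0} ^ N) :
    ∃ n i, Associated (x n ^ i) b := by
  obtain ⟨n, P, rfl⟩ := exists_aeval_root a
  rw [Ideal.span_singleton_pow, ← pow_mul_prime_pow_eq x hx N n] at ha hb
  rw [eval_aeval_root] at ha
  have hjac' := mem_jacobson hx hjac n
  have hP : P ≠ 0 := by
    rintro rfl
    exact hb (by simpa using ha)
  have hassoc := associated_pow_aeval hjac' hP
  have hlt : P.natTrailingDegree < p ^ n * N := by
    by_contra! hle
    refine hb ?_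
    rw [← sub_add_cancel b (Polynomial.aeval (x n) P)]
    exact add_mem ha (Ideal.mem_span_singleton.2 ((pow_dvd_pow _ hle).trans hassoc.dvd))
  have hdvd : Polynomial.aeval (x n) P * x n ∣ x n ^ (p ^ n * N) :=
    (mul_dvd_mul_right hassoc.symm.dvd _).trans (pow_succ (x n) _ ▸ pow_dvd_pow _ hlt)
  exact ⟨n, P.natTrailingDegree, hassoc.trans <| associated_of_sub_mem_span_mul hjac' <|
    Ideal.span_singleton_le_span_singleton.2 hdvd ha⟩

include hjac in
theorem isDomain_of_exists_sub_eval_mem [IsHausdorff (Ideal.span {x 0}) B]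
    (hnil : ¬ IsNilpotent (x 0))
    (hdense : ∀ n b, ∃ a, b - eval k x hx a ∈ Ideal.span {x 0} ^ n) : IsDomain B := by
  have hassoc (b : B) (hb : b ≠ 0) : ∃ n i, Associated (x n ^ i) b := by
    obtain ⟨N, hN⟩ : ∃ N, b ∉ Ideal.span {x 0} ^ N := by
      by_contra! h
      exact hb (IsHausdorff.haus (I := Ideal.span {x 0}) inferInstance b fun n => by
        simpa [SModEq.zero] using h n)
    obtain ⟨a, ha⟩ := hdense N b
    exact exists_associated_pow hx hjac ha hN
  have : Nontrivial B := nontrivial_of_ne (x 0) 0 fun h => hnil (h ▸ IsNilpotent.zero)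
  have : NoZeroDivisors B := by
    refine ⟨fun {a b} hab => ?_⟩
    by_contra! h
    obtain ⟨n, i, hi⟩ := hassoc a h.1
    obtain ⟨m, j, hj⟩ := hassoc b h.2
    have hzero : x n ^ i * x m ^ j = 0 := by
      rw [← associated_zero_iff_eq_zero, ← hab]
      exact hi.mul_mul hj
    refine hnil ⟨i + j, zero_dvd_iff.1 (hzero ▸ ?_)⟩
    rw [pow_add, ← pow_mul_prime_pow_eq x hx i n, ← pow_mul_prime_pow_eq x hx j m]
    have hp (n : ℕ) : 0 < p ^ n := pow_pos (Fact.out : p.Prime).pos n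
    exact mul_dvd_mul (pow_dvd_pow _ (Nat.le_mul_of_pos_left _ (hp n)))
      (pow_dvd_pow _ (Nat.le_mul_of_pos_left _ (hp m)))
  exact NoZeroDivisors.to_isDomain B

end Jacobson

end PerfPoly

namespace UnifMeasure

variable {p : ℕ} [Fact p.Prime]

theorem dirac_injective {k : Type} [CommRing k] [UniformSpace k] [IsUniformAddGroup k]
    [IsTopologicalRing k] [IsLinearTopology k k] [CompleteSpace k] [T2Space k] [Nontrivial k] :
    Function.Injective (dirac k : ℚ_[p] → UnifMeasure p k) := by
  have hinj := (ofGroupAlgebra_injective (p := p) (R := k) (k := k) Function.injective_id).comp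
    (AddMonoidAlgebra.single_left_injective (one_ne_zero (α := k)))
  simpa [Function.comp_def, ofGroupAlgebra_single] using hinj

instance : Nontrivial (UnifMeasure p (ZMod p)) :=
  dirac_injective.nontrivial

instance : CharP (UnifMeasure p (ZMod p)) p :=
  charP_of_injective_algebraMap (algebraMap (ZMod p) (UnifMeasure p (ZMod p))).injective p

theorem dirac_sub_one_pow_prime_pow (a : ℚ_[p]) (n : ℕ) :
    (dirac (ZMod p) a - 1) ^ p ^ n = dirac (ZMod p) (p ^ n • a) - 1 := by
  rw [sub_pow_char_pow, one_pow, dirac_nsmul]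

theorem diracSub_succ_pow (n : ℕ) :
    diracSub p (ZMod p) (n + 1) ^ p = diracSub p (ZMod p) n := by
  have hp : (p : ℚ_[p]) ≠ 0 := by exact_mod_cast (Fact.out : p.Prime).ne_zero
  have ha : p ^ 1 • (1 / (p : ℚ_[p]) ^ (n + 1)) = 1 / (p : ℚ_[p]) ^ n := by
    rw [pow_one, nsmul_eq_mul, pow_succ]
    field_simp
  have hpow := dirac_sub_one_pow_prime_pow (1 / (p : ℚ_[p]) ^ (n + 1)) 1
  rwa [ha, pow_one p] at hpow

theorem diracSub_pow_self (n : ℕ) : diracSub p (ZMod p) n ^ p ^ n = diracSub p (ZMod p) 0 := by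
  simpa using PerfPoly.pow_prime_pow_eq _ (diracSub_succ_pow (p := p)) 0 n

theorem not_isNilpotent_diracSub : ¬ IsNilpotent (diracSub p (ZMod p) 0) := by
  rintro ⟨n, hn⟩
  have hp : p ^ n • (1 : ℚ_[p]) ≠ 0 := by
    simp [(Fact.out : p.Prime).ne_zero]
  have hpow : diracSub p (ZMod p) 0 ^ p ^ n = 0 :=
    pow_eq_zero_of_le (Nat.lt_pow_self (Fact.out : p.Prime).one_lt).le hn
  refine hp (dirac_injective (k := ZMod p) (sub_eq_zero.1 (Eq.trans ?_ hpow)))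
  rw [diracSub_eq, pow_zero, div_one, dirac_sub_one_pow_prime_pow]
  rfl

theorem isAdic_span_diracSub_zmod : IsAdic (Ideal.span {diracSub p (ZMod p) 0}) := by
  simpa [CharP.cast_eq_zero] using isAdic_span_diracSub (isAdic_span_zmod p)

instance : IsAdicComplete (Ideal.span {diracSub p (ZMod p) 0}) (UnifMeasure p (ZMod p)) :=
  isAdic_span_diracSub_zmod.isAdicComplete_iff.2 ⟨inferInstance, inferInstance⟩

theorem diracSub_mem_jacobson : diracSub p (ZMod p) 0 ∈ Ideal.jacobson (⊥ : Ideal _) :=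
  IsAdicComplete.le_jacobson_bot _ (Ideal.mem_span_singleton_self _)

theorem isRingCompletion_ofGroupAlgebra_zmod : IsRingCompletion
    ((Ideal.span {diracSub p (ZMod p) 0}).adicTopology.induced (ofGroupAlgebra p (ZMod p) (ZMod p)))
    (ofGroupAlgebra p (ZMod p) (ZMod p)) :=
  isRingCompletion_induced isAdic_span_diracSub_zmod
    (denseRange_ofGroupAlgebra Function.surjective_id.denseRange)

theorem isRingCompletion_ofGroupAlgebraZInv_zmod : IsRingCompletion
    (Ideal.span {(AddMonoidAlgebra.single (zInvOne p) 1 - AddMonoidAlgebra.single 0 1 :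
      AddMonoidAlgebra (ZMod p) (zInv p))}).adicTopology
    (ofGroupAlgebraZInv p (ZMod p) (ZMod p)) := by
  have := isRingCompletion_ofGroupAlgebraZInv (R := ZMod p) (isAdic_span_zmod p)
    Function.surjective_id.denseRange fun n => le_rfl
  have hp : (p : AddMonoidAlgebra (ZMod p) (zInv p)) = 0 := by
    rw [← map_natCast (algebraMap (ZMod p) _), CharP.cast_eq_zero, map_zero]
  rwa [hp, Ideal.span, Submodule.span_insert_zero] at this

/-- The embedding of `𝔽_p[X^{1/p^∞}]` into the measures which sends `X ^ (1 / p ^ n)` to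
`t_n = δ_{1/p^n} - δ_0`. -/
noncomputable def ofPerfPoly (p : ℕ) [Fact p.Prime] :
    PerfPoly (ZMod p) p →ₐ[ZMod p] UnifMeasure p (ZMod p) :=
  PerfPoly.eval (ZMod p) (diracSub p (ZMod p)) diracSub_succ_pow

theorem ofPerfPoly_root (n : ℕ) :
    ofPerfPoly p (PerfPoly.root (ZMod p) p n) = diracSub p (ZMod p) n :=
  PerfPoly.eval_root _ _ _ n

theorem ofPerfPoly_injective : Function.Injective (ofPerfPoly p) :=
  PerfPoly.eval_injective _ diracSub_mem_jacobson not_isNilpotent_diracSub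

theorem map_span_root_ofPerfPoly :
    (Ideal.span {PerfPoly.root (ZMod p) p 0}).map (ofPerfPoly p : _ →+* UnifMeasure p (ZMod p)) =
      Ideal.span {diracSub p (ZMod p) 0} := by
  rw [Ideal.map_span, Set.image_singleton]
  exact congrArg (fun x => Ideal.span {x}) (ofPerfPoly_root 0)

theorem comap_ofPerfPoly_le (n : ℕ) :
    (Ideal.span {diracSub p (ZMod p) 0} ^ n).comap (ofPerfPoly p : _ →+* UnifMeasure p (ZMod p)) ≤
      Ideal.span {PerfPoly.root (ZMod p) p 0} ^ n := fun _ ha =>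
  PerfPoly.comap_eval_span_pow_le diracSub_succ_pow diracSub_mem_jacobson not_isNilpotent_diracSub
    n ha

theorem denseRange_ofPerfPoly : DenseRange (ofPerfPoly p) := by
  refine denseRange_of_smul_dirac_mem (f := (ofPerfPoly p).toRingHom) (R := ZMod p)
    Function.surjective_id.denseRange fun c m n => ?_
  refine ⟨c • (PerfPoly.root (ZMod p) p n + 1) ^ m, ?_⟩
  rw [dirac_natCast_div_pow, ← ofPerfPoly_root]
  exact (map_smul (ofPerfPoly p) _ _).trans (by rw [map_pow, map_add, map_one])

theorem exists_sub_ofPerfPoly_mem (n : ℕ) (b : UnifMeasure p (ZMod p)) :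
    ∃ a, b - ofPerfPoly p a ∈ Ideal.span {diracSub p (ZMod p) 0} ^ n :=
  (denseRange_iff_exists_sub_mem (g := ofPerfPoly p)
    isAdic_span_diracSub_zmod.hasBasis_nhds_zero).1 denseRange_ofPerfPoly n trivial b

theorem isRingCompletion_ofPerfPoly :
    IsRingCompletion (Ideal.span {PerfPoly.root (ZMod p) p 0}).adicTopology
      (ofPerfPoly p : PerfPoly (ZMod p) p →+* UnifMeasure p (ZMod p)) :=
  isRingCompletion_adicTopology isAdic_span_diracSub_zmod.hasBasis_nhds_zero
    (fun n => ⟨n, by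
      rw [← map_span_root_ofPerfPoly, ← Ideal.map_le_iff_le_comap, Ideal.map_pow]⟩)
    comap_ofPerfPoly_le denseRange_ofPerfPoly

theorem exists_completion_ringEquiv : ∃ j : PerfPoly.Completion p ≃+* UnifMeasure p (ZMod p),
    ∀ x, j (AdicCompletion.of _ _ x) = ofPerfPoly p x := by
  have : IsAdicComplete ((Ideal.span {PerfPoly.root (ZMod p) p 0}).map
      (ofPerfPoly p : _ →+* UnifMeasure p (ZMod p))) (UnifMeasure p (ZMod p)) :=
    map_span_root_ofPerfPoly (p := p) ▸ inferInstance
  refine ⟨adicCompletionEquiv (f := (ofPerfPoly p : _ →+* UnifMeasure p (ZMod p))) ?_ ?_,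
    adicCompletionEquiv_of _ _⟩
  · rw [map_span_root_ofPerfPoly]
    exact comap_ofPerfPoly_le
  · rw [map_span_root_ofPerfPoly]
    exact exists_sub_ofPerfPoly_mem

instance : IsDomain (UnifMeasure p (ZMod p)) :=
  PerfPoly.isDomain_of_exists_sub_eval_mem diracSub_succ_pow diracSub_mem_jacobson
    not_isNilpotent_diracSub exists_sub_ofPerfPoly_mem

end UnifMeasure

theorem PerfPoly.exists_pow_prime_eq {p : ℕ} [Fact p.Prime] (a : PerfPoly (ZMod p) p) :
    ∃ b, b ^ p = a := by
  obtain ⟨n, P, rfl⟩ := exists_aeval_root a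
  refine ⟨Polynomial.aeval (root (ZMod p) p (n + 1)) P, ?_⟩
  rw [← map_pow, ← ZMod.expand_card, Polynomial.expand_aeval, root_succ_pow]

theorem UnifMeasure.frobenius_surjective {p : ℕ} [Fact p.Prime] :
    Function.Surjective (frobenius (UnifMeasure p (ZMod p)) p) := by
  have hmap : (Ideal.span {diracSub p (ZMod p) 0}).map (frobenius (UnifMeasure p (ZMod p)) p) =
      Ideal.span {diracSub p (ZMod p) 0} ^ p := by
    rw [Ideal.map_span, Set.image_singleton, frobenius_def, Ideal.span_singleton_pow]
  have : IsHausdorff ((Ideal.span {diracSub p (ZMod p) 0}).map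
      (frobenius (UnifMeasure p (ZMod p)) p)) (UnifMeasure p (ZMod p)) :=
    .of_map (J := Ideal.span {diracSub p (ZMod p) 0}) (by
      rw [Algebra.algebraMap_self, Ideal.map_id, hmap]
      exact Ideal.pow_le_self (Fact.out : p.Prime).ne_zero)
  refine surjective_of_mk_map_comp_surjective (I := Ideal.span {diracSub p (ZMod p) 0})
    (frobenius (UnifMeasure p (ZMod p)) p) fun y => ?_
  obtain ⟨b, rfl⟩ := Ideal.Quotient.mk_surjective y
  obtain ⟨a, ha⟩ := exists_sub_ofPerfPoly_mem p b
  obtain ⟨c, rfl⟩ := PerfPoly.exists_pow_prime_eq a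
  refine ⟨ofPerfPoly p c, ((Ideal.Quotient.mk_eq_mk_iff_sub_mem _ _).2 ?_).symm⟩
  rwa [hmap, frobenius_def, ← map_pow]

instance {p : ℕ} [Fact p.Prime] : PerfectRing (UnifMeasure p (ZMod p)) p :=
  ⟨frobenius_inj (UnifMeasure p (ZMod p)) p, UnifMeasure.frobenius_surjective⟩

theorem isAdicComplete_of_isClosed_pow {B : Type*} [CommRing B] [UniformSpace B]
    [IsUniformAddGroup B] [CompleteSpace B] [T2Space B] {I : Ideal B} {K : ℕ → Ideal B}
    (hK : (𝓝 (0 : B)).HasBasis (fun _ => True) fun n => (K n : Set B)) (hle : ∀ n, I ^ n ≤ K n)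
    (hclosed : ∀ n, IsClosed (↑(I ^ n) : Set B)) : IsAdicComplete I B where
  haus' x hx := by
    refine (specializes_iff_mem_closure.2 ?_).eq
    refine (mem_closure_iff_nhds_basis hK).2 fun n _ => ⟨x, rfl, hle n ?_⟩
    simpa [SModEq.zero] using hx n
  prec' f hf := by
    have hmem : ∀ {m n}, m ≤ n → f n - f m ∈ I ^ m := fun {m n} hmn => by
      have := SModEq.sub_mem.1 (hf hmn).symm
      rwa [smul_eq_mul, Ideal.mul_top] at this
    have hcauchy : CauchySeq f :=
      (hK.uniformity_of_nhds_zero.cauchySeq_iff').2 fun n _ => ⟨n, fun m hm =>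
        hle n (by simpa using neg_mem (hmem hm))⟩
    obtain ⟨L, hL⟩ := cauchySeq_tendsto_of_complete hcauchy
    refine ⟨L, fun n => (SModEq.sub_mem.2 ?_).symm⟩
    rw [smul_eq_mul, Ideal.mul_top]
    exact (hclosed n).mem_of_tendsto (hL.sub_const _) (eventually_atTop.2 ⟨n, fun m => hmem⟩)

namespace UnifMeasure

theorem continuous_toFun {p : ℕ} [Fact p.Prime] {k : Type} [CommRing k] [UniformSpace k]
    [IsUniformAddGroup k] [IsTopologicalRing k] (U : unifMeasurable p) :
    Continuous fun μ : UnifMeasure p k => μ.toFun U :=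
  (UniformOnFun.uniformContinuous_eval_of_mem_sUnion k (radii p)
    ((sUnion_radii (p := p)).symm ▸ Set.mem_univ U)).continuous.comp continuous_induced_dom

variable {p : ℕ} [Fact p.Prime]

theorem natCast_mem_nonZeroDivisors :
    (p : UnifMeasure p ℤ_[p]) ∈ nonZeroDivisors (UnifMeasure p ℤ_[p]) := by
  refine mem_nonZeroDivisors_iff_left.2 fun μ hμ => toFun_injective (funext fun U => ?_)
  have hU : (p : ℤ_[p]) * μ.toFun U = 0 := by
    have := natCast_pow_mul_toFun 1 μ U
    rw [pow_one, pow_one, hμ] at this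
    exact this.symm
  exact (mul_eq_zero.1 hU).resolve_left (by exact_mod_cast (Fact.out : p.Prime).ne_zero)

theorem natCast_pow_dvd_iff {n : ℕ} {μ : UnifMeasure p ℤ_[p]} :
    (p : UnifMeasure p ℤ_[p]) ^ n ∣ μ ↔ ∀ U, (p : ℤ_[p]) ^ n ∣ μ.toFun U := by
  constructor
  · rintro ⟨ν, rfl⟩ U
    exact ⟨ν.toFun U, natCast_pow_mul_toFun n ν U⟩
  · intro h
    choose ν hν using h
    have hp : (p : ℤ_[p]) ^ n ≠ 0 := pow_ne_zero _ (by exact_mod_cast (Fact.out : p.Prime).ne_zero)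
    have hind : IsInducing (AddMonoidHom.mulLeft ((p : ℤ_[p]) ^ n)) :=
      ((continuous_const_mul ((p : ℤ_[p]) ^ n)).isClosedEmbedding
        (mul_right_injective₀ hp)).isInducing
    refine ⟨⟨ν, fun h A U hU hd => (hind.hasSum_iff _ _).1 ?_⟩,
      toFun_injective (funext fun U => ?_)⟩
    · convert μ.hasSum_iUnion h A U hU hd using 1
      · exact funext fun a => (hν _).symm
      · exact (hν _).symm
    · rw [natCast_pow_mul_toFun]
      exact hν U

theorem isClosed_span_natCast_pow (n : ℕ) :
    IsClosed (↑(Ideal.span {(p : UnifMeasure p ℤ_[p])} ^ n) : Set (UnifMeasure p ℤ_[p])) := by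
  have hclosed : IsClosed (↑(Ideal.span {(p : ℤ_[p])} ^ n) : Set ℤ_[p]) :=
    AddSubgroup.isClosed_of_isOpen (Ideal.span {(p : ℤ_[p])} ^ n).toAddSubgroup
      ((isAdic_iff.1 (isAdic_span_padicInt p)).1 n)
  have heq : (↑(Ideal.span {(p : UnifMeasure p ℤ_[p])} ^ n) : Set (UnifMeasure p ℤ_[p])) =
      ⋂ U, {μ | μ.toFun U ∈ Ideal.span {(p : ℤ_[p])} ^ n} := by
    ext μ
    simp only [Ideal.span_singleton_pow, SetLike.mem_coe, Ideal.mem_span_singleton,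
      natCast_pow_dvd_iff, Set.mem_iInter, Set.mem_ofPred_eq]
  rw [heq]
  exact isClosed_iInter fun U => hclosed.preimage (continuous_toFun U)

instance isAdicComplete_span_natCast :
    IsAdicComplete (Ideal.span {(p : UnifMeasure p ℤ_[p])}) (UnifMeasure p ℤ_[p]) :=
  isAdicComplete_of_isClosed_pow (hasBasis_levelIdealPow (isAdic_span_padicInt p))
    (span_natCast_pow_le_levelIdealPow _) isClosed_span_natCast_pow

theorem reduction_eq_zero_iff {μ : UnifMeasure p ℤ_[p]} :
    reduction p μ = 0 ↔ (p : UnifMeasure p ℤ_[p]) ∣ μ := by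
  have hdvd := natCast_pow_dvd_iff (n := 1) (μ := μ)
  simp only [pow_one] at hdvd
  rw [hdvd, ← toFun_injective.eq_iff, funext_iff]
  refine forall_congr' fun U => ?_
  rw [← Ideal.mem_span_singleton, ← PadicInt.maximalIdeal_eq_span_p, ← PadicInt.ker_toZMod]
  exact RingHom.mem_ker.symm

theorem ker_reduction :
    RingHom.ker (reduction p) = Ideal.span {(p : UnifMeasure p ℤ_[p])} :=
  Ideal.ext fun _ => reduction_eq_zero_iff.trans Ideal.mem_span_singleton.symm

theorem reduction_dirac (a : ℚ_[p]) : reduction p (dirac ℤ_[p] a) = dirac (ZMod p) a := by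
  classical
  refine toFun_injective (funext fun U => ?_)
  change PadicInt.toZMod (if a ∈ U.1 then (1 : ℤ_[p]) else 0) = if a ∈ U.1 then 1 else 0
  split_ifs <;> simp

theorem reduction_diracSub (n : ℕ) : reduction p (diracSub p ℤ_[p] n) = diracSub p (ZMod p) n := by
  rw [diracSub_eq, map_sub, map_one, reduction_dirac, ← diracSub_eq]

theorem map_reduction_span_diracSub :
    (Ideal.span {(p : UnifMeasure p ℤ_[p]), diracSub p ℤ_[p] 0}).map (reduction p) =
      Ideal.span {diracSub p (ZMod p) 0} := by
  rw [Ideal.map_span, Set.image_pair, map_natCast, CharP.cast_eq_zero, reduction_diracSub,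
    Ideal.span, Submodule.span_insert_zero]

theorem reduction_surjective : Function.Surjective (reduction p) := by
  have : IsAdicComplete (Ideal.span {(p : UnifMeasure p ℤ_[p]), diracSub p ℤ_[p] 0})
      (UnifMeasure p ℤ_[p]) :=
    (isAdic_span_diracSub (isAdic_span_padicInt p)).isAdicComplete_iff.2
      ⟨inferInstance, inferInstance⟩
  have : IsHausdorff ((Ideal.span {(p : UnifMeasure p ℤ_[p]), diracSub p ℤ_[p] 0}).map
      (reduction p)) (UnifMeasure p (ZMod p)) := by
    rw [map_reduction_span_diracSub]
    infer_instance
  refine surjective_of_mk_map_comp_surjective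
    (I := Ideal.span {(p : UnifMeasure p ℤ_[p]), diracSub p ℤ_[p] 0}) _ fun y => ?_
  obtain ⟨b, rfl⟩ := Ideal.Quotient.mk_surjective y
  have hdense : DenseRange (reduction p) := by
    refine denseRange_of_smul_dirac_mem (f := reduction p) (R := ZMod p)
      Function.surjective_id.denseRange fun c m n => ?_
    obtain ⟨c, rfl⟩ := ZMod.intCast_surjective c
    exact ⟨c * dirac ℤ_[p] ((m : ℚ_[p]) / (p : ℚ_[p]) ^ n), by
      rw [map_mul, map_intCast, reduction_dirac, Algebra.smul_def, map_intCast]⟩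
  obtain ⟨μ, hμ⟩ := (denseRange_iff_exists_sub_mem
    isAdic_span_diracSub_zmod.hasBasis_nhds_zero).1 hdense 1 trivial b
  refine ⟨μ, ((Ideal.Quotient.mk_eq_mk_iff_sub_mem _ _).2 ?_).symm⟩
  rwa [map_reduction_span_diracSub, ← pow_one (Ideal.span _)]

end UnifMeasure

section Reduction

variable {A B A' B' : Type*} [CommRing A] [CommRing B] [CommRing A'] [CommRing B']
  {f : A →+* B} {f' : A' →+* B'} {rA : A →+* A'} {rB : B →+* B'} {u x : A}

theorem injective_of_injective_of_ker_eq_span (hcomm : rB.comp f = f'.comp rA)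
    (hA : RingHom.ker rA = Ideal.span {u}) [IsHausdorff (Ideal.span {u}) A]
    (hu : f u ∈ nonZeroDivisors B) (hf' : Function.Injective f') : Function.Injective f := by
  refine (injective_iff_map_eq_zero f).2 fun a ha => ?_
  refine IsHausdorff.haus ‹IsHausdorff (Ideal.span {u}) A› a fun n => ?_
  rw [SModEq.zero, smul_eq_mul, Ideal.mul_top, Ideal.span_singleton_pow, Ideal.mem_span_singleton]
  induction n generalizing a with
  | zero => simp
  | succ n ih =>
    have hker : a ∈ RingHom.ker rA := hf' <| by
      rw [map_zero, ← RingHom.comp_apply, ← hcomm, RingHom.comp_apply, ha, map_zero]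
    rw [hA, Ideal.mem_span_singleton] at hker
    obtain ⟨c, rfl⟩ := hker
    rw [map_mul] at ha
    rw [pow_succ']
    exact mul_dvd_mul_left u (ih c (mem_nonZeroDivisors_iff_left.1 hu _ ha))

/-- If `f a = v * f u ^ (k + 1) + w * f x ^ n`, then modulo `u` the element `a` is a multiple
`b * x ^ n`, and `f u` divides `f (a - b * x ^ n)`. -/
theorem comap_span_pair_pow_le (hcomm : rB.comp f = f'.comp rA) (hrA : Function.Surjective rA)
    (hA : RingHom.ker rA = Ideal.span {u}) (hB : RingHom.ker rB = Ideal.span {f u})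
    (hu : f u ∈ nonZeroDivisors B) {n : ℕ} (hx : rB (f x) ^ n ∈ nonZeroDivisors B')
    (hcomap : (Ideal.span {rB (f x) ^ n}).comap f' ≤ Ideal.span {rA x ^ n}) (k : ℕ) :
    (Ideal.span {f u ^ k, f x ^ n}).comap f ≤ Ideal.span {u ^ k, x ^ n} := by
  have hcomm' : ∀ a, f' (rA a) = rB (f a) := fun a => (RingHom.congr_fun hcomm a).symm
  have hBu : rB (f u) = 0 := by
    rw [← RingHom.mem_ker, hB]
    exact Ideal.mem_span_singleton_self (f u)
  induction k with
  | zero =>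
    rw [pow_zero u, Ideal.span_insert 1, Ideal.span_singleton_one, top_sup_eq]
    exact le_top
  | succ k ih =>
    intro a ha
    obtain ⟨v, w, hvw⟩ := Ideal.mem_span_pair.1 (Ideal.mem_comap.1 ha)
    have hmod : f' (rA a) = rB w * rB (f x) ^ n := by
      rw [hcomm', ← hvw, map_add, map_mul, map_mul, map_pow, map_pow, hBu,
        zero_pow k.succ_ne_zero, mul_zero, zero_add]
    obtain ⟨b', hb'⟩ := Ideal.mem_span_singleton'.1
      (hcomap (Ideal.mem_comap.2 (Ideal.mem_span_singleton'.2 ⟨_, hmod.symm⟩)))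
    obtain ⟨b, rfl⟩ := hrA b'
    have hab : a - b * x ^ n ∈ RingHom.ker rA := by
      rw [RingHom.mem_ker, map_sub, map_mul, map_pow, hb', sub_self]
    obtain ⟨a₁, ha₁⟩ := Ideal.mem_span_singleton'.1 (hA ▸ hab)
    have hwb : w - f b ∈ RingHom.ker rB := by
      refine mem_nonZeroDivisors_iff_right.1 hx _ ?_
      rw [map_sub, sub_mul, ← hmod, ← hb', map_mul, map_pow, hcomm', hcomm', sub_self]
    obtain ⟨w₁, hw₁⟩ := Ideal.mem_span_singleton'.1 (hB ▸ hwb)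
    have hfa₁ : v * f u ^ k + w₁ * f x ^ n = f a₁ := by
      refine sub_eq_zero.1 (mem_nonZeroDivisors_iff_right.1 hu _ ?_)
      have hfa := congrArg f ha₁
      rw [map_mul, map_sub, map_mul, map_pow] at hfa
      linear_combination hvw - hfa + f x ^ n * hw₁
    obtain ⟨c, d, hcd⟩ := Ideal.mem_span_pair.1
      (ih (Ideal.mem_comap.2 (Ideal.mem_span_pair.2 ⟨_, _, hfa₁⟩)))
    exact Ideal.mem_span_pair.2 ⟨c, u * d + b, by linear_combination ha₁ + u * hcd⟩

theorem exists_sub_mem_map_span_pair (hcomm : rB.comp f = f'.comp rA)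
    (hrA : Function.Surjective rA) (hrB : Function.Surjective rB)
    (hB : RingHom.ker rB = Ideal.span {f u})
    (hd : ∀ b, ∃ a, b - f' a ∈ Ideal.span {rB (f x)}) (b : B) :
    ∃ a, b - f a ∈ (Ideal.span {u, x}).map f := by
  obtain ⟨a', ha'⟩ := hd (rB b)
  obtain ⟨a, rfl⟩ := hrA a'
  obtain ⟨c', hc'⟩ := Ideal.mem_span_singleton'.1 ha'
  obtain ⟨c, rfl⟩ := hrB c'
  have hker : b - f a - c * f x ∈ RingHom.ker rB := by
    rw [RingHom.mem_ker, map_sub, map_sub, map_mul, hc', ← RingHom.comp_apply f',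
      ← hcomm, RingHom.comp_apply, sub_self]
  obtain ⟨d, hd⟩ := Ideal.mem_span_singleton'.1 (hB ▸ hker)
  refine ⟨a, ?_⟩
  rw [Ideal.map_span, Set.image_pair]
  exact Ideal.mem_span_pair.2 ⟨d, c, by linear_combination hd⟩

end Reduction

/-- The hypotheses on `f'` say that it is dense and induces the `rA x`-adic topology. -/
theorem isRingCompletion_of_reduction {A B : Type} {A' B' : Type*} [CommRing A] [CommRing B]
    [CommRing A'] [CommRing B'] [IsDomain B'] {f : A →+* B} {f' : A' →+* B'} {rA : A →+* A'}
    {rB : B →+* B'} {u x : A} [UniformSpace B] [IsUniformAddGroup B] [CompleteSpace B] [T2Space B]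
    (hcomm : rB.comp f = f'.comp rA) (hrA : Function.Surjective rA) (hrB : Function.Surjective rB)
    (hA : RingHom.ker rA = Ideal.span {u}) (hB : RingHom.ker rB = Ideal.span {f u})
    (hu : f u ∈ nonZeroDivisors B) (hx : rB (f x) ≠ 0)
    (hcomap : ∀ n, (Ideal.span {rB (f x)} ^ n).comap f' ≤ Ideal.span {rA x} ^ n)
    (hd : ∀ b, ∃ a, b - f' a ∈ Ideal.span {rB (f x)}) (hI : IsAdic (Ideal.span {f u, f x})) :
    IsRingCompletion (Ideal.span {u, x}).adicTopology f := by
  have := isTopologicalRing_of_isAdic hI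
  have hmap : (Ideal.span {u, x}).map f = Ideal.span {f u, f x} := by
    rw [Ideal.map_span, Set.image_pair]
  have hbasis : (𝓝 (0 : B)).HasBasis (fun _ => True)
      fun n => (↑(Ideal.span {f u, f x} ^ (n + n)) : Set B) :=
    hI.hasBasis_nhds_zero.to_hasBasis
      (fun n _ => ⟨n, trivial, Ideal.pow_le_pow_right (Nat.le_add_left n n)⟩)
      fun n _ => ⟨n + n, trivial, subset_rfl⟩
  refine isRingCompletion_adicTopology hbasis (fun n => ⟨n + n, ?_⟩) (fun n => ?_) ?_
  · rw [← hmap, ← Ideal.map_pow]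
    exact Ideal.le_comap_map
  · simp only [Ideal.span_singleton_pow] at hcomap
    calc (Ideal.span {f u, f x} ^ (n + n)).comap f
        ≤ (Ideal.span {f u ^ n, f x ^ n}).comap f := Ideal.comap_mono (pow_span_pair_le _ _ n n)
      _ ≤ Ideal.span {u ^ n, x ^ n} := comap_span_pair_pow_le hcomm hrA hA hB hu
          (pow_mem (mem_nonZeroDivisors_of_ne_zero hx) n) (hcomap n) n
      _ ≤ Ideal.span {u, x} ^ n := span_pair_pow_le u x n
  · refine (denseRange_iff_exists_sub_mem hI.hasBasis_nhds_zero).2 fun n _ b => ?_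
    rw [← hmap]
    exact exists_sub_mem_map_pow (exists_sub_mem_map_span_pair hcomm hrA hrB hB hd) n b

section IntGroupAlgebra

variable {G : Type*} [AddCommMonoid G]

theorem coeff_natCast_mul {R : Type*} [CommRing R] (n : ℕ) (a : AddMonoidAlgebra R G) (x : G) :
    ((n : AddMonoidAlgebra R G) * a).coeff x = n * a.coeff x := by
  rw [← nsmul_eq_mul, AddMonoidAlgebra.coeff_smul, Finsupp.smul_apply, nsmul_eq_mul]

theorem ker_mapRingHom_intCast (n : ℕ) :
    RingHom.ker (AddMonoidAlgebra.mapRingHom G (Int.castRingHom (ZMod n))) =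
      Ideal.span {(n : AddMonoidAlgebra ℤ G)} := by
  refine le_antisymm (fun a ha => Ideal.mem_span_singleton.2
    ⟨.ofCoeff (a.coeff.mapRange (· / (n : ℤ)) (Int.zero_ediv _)), ?_⟩) ?_
  · ext x
    have hx : ((a.coeff x : ℤ) : ZMod n) = 0 := by
      simpa using congrArg (fun b => b.coeff x) (RingHom.mem_ker.1 ha)
    rw [coeff_natCast_mul]
    exact (Int.mul_ediv_cancel' ((ZMod.intCast_zmod_eq_zero_iff_dvd _ _).1 hx)).symm
  · rw [Ideal.span_singleton_le_iff_mem, RingHom.mem_ker, map_natCast,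
      ← map_natCast (algebraMap (ZMod n) _), ZMod.natCast_self, map_zero]

theorem isHausdorff_span_natCast {n : ℕ} (hn : n ≠ 1) :
    IsHausdorff (Ideal.span {(n : AddMonoidAlgebra ℤ G)}) (AddMonoidAlgebra ℤ G) where
  haus' a ha := by
    ext x
    by_contra hx
    obtain ⟨m, hm⟩ := Int.finiteMultiplicity_iff (a := n).2 ⟨by simpa using hn, hx⟩
    have hdvd := SModEq.zero.1 (ha (m + 1))
    rw [smul_eq_mul, Ideal.mul_top, Ideal.span_singleton_pow, Ideal.mem_span_singleton] at hdvd
    obtain ⟨c, rfl⟩ := hdvd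
    refine hm ⟨c.coeff x, ?_⟩
    rw [← Nat.cast_pow, coeff_natCast_mul, Nat.cast_pow]

end IntGroupAlgebra

section StrictPRing

variable {p : ℕ} [Fact p.Prime] {A R : Type*} [CommRing A] [CommRing R] [CharP R p]
  [PerfectRing R p] {r : A →+* R}

/-- The composition of `W(R) → W((A/p)♭)`, which exists because `R ≅ A/p` is perfect, with
Fontaine's map `θ : W((A/p)♭) → A`. -/
theorem exists_ringHom_wittVector [Nontrivial R] [IsAdicComplete (Ideal.span {(p : A)}) A]
    (hr : Function.Surjective r) (hker : RingHom.ker r = Ideal.span {(p : A)}) :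
    ∃ θ : WittVector p R →+* A, ∀ x, r (θ x) = x.coeff 0 := by
  have : Fact ¬IsUnit (p : A) := ⟨fun h => by
    have hunit := h.map r
    rw [map_natCast, CharP.cast_eq_zero] at hunit
    exact not_isUnit_zero hunit⟩
  let ρ : R ≃+* ModP A p :=
    ((Ideal.quotEquivOfEq hker.symm).trans (RingHom.quotientKerEquivOfSurjective hr)).symm
  have hρ : ∀ a, ρ (r a) = Ideal.Quotient.mk _ a := fun a => by
    rw [RingEquiv.symm_apply_eq]
    rfl
  let ℓ : R →+* PreTilt A p := Perfection.lift p R (ModP A p) (ρ : R →+* ModP A p)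
  have hℓ : ∀ x, PreTilt.coeff 0 (ℓ x) = ρ x := fun x => rfl
  refine ⟨(WittVector.fontaineTheta A p).comp (WittVector.map ℓ), fun x => ρ.injective ?_⟩
  rw [hρ]
  refine (WittVector.mk_fontaineTheta _).trans ?_
  rw [WittVector.map_coeff, hℓ]

theorem exists_ringEquiv_wittVector [Nontrivial R] [IsAdicComplete (Ideal.span {(p : A)}) A]
    (hr : Function.Surjective r) (hker : RingHom.ker r = Ideal.span {(p : A)})
    (hp : (p : A) ∈ nonZeroDivisors A) :
    ∃ e : A ≃+* WittVector p R, ∀ a, (e a).coeff 0 = r a := by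
  obtain ⟨θ, hθ⟩ := exists_ringHom_wittVector hr hker
  have hmap : (Ideal.span {(p : WittVector p R)}).map θ = Ideal.span {(p : A)} := by
    rw [Ideal.map_span, Set.image_singleton, map_natCast]
  have hinj : Function.Injective θ :=
    injective_of_injective_of_ker_eq_span (f' := RingHom.id R) (rB := r) (RingHom.ext hθ)
      WittVector.ker_constantCoeff (by rwa [map_natCast]) Function.injective_id
  have hsurj : Function.Surjective θ := by
    have : IsHausdorff ((Ideal.span {(p : WittVector p R)}).map θ) A := by
      rw [hmap]
      infer_instance
    refine surjective_of_mk_map_comp_surjective (I := Ideal.span {(p : WittVector p R)}) θ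
      fun y => ?_
    obtain ⟨a, rfl⟩ := Ideal.Quotient.mk_surjective y
    refine ⟨WittVector.teichmuller p (r a), (Ideal.Quotient.mk_eq_mk_iff_sub_mem _ _).2 ?_⟩
    rw [hmap, ← hker, RingHom.mem_ker, map_sub, hθ, WittVector.teichmuller_coeff_zero, sub_self]
  refine ⟨(RingEquiv.ofBijective θ ⟨hinj, hsurj⟩).symm, fun a => ?_⟩
  rw [← hθ]
  exact congrArg r ((RingEquiv.ofBijective θ ⟨hinj, hsurj⟩).apply_symm_apply a)

/-- The Teichmüller representatives are `p ^ n`-th powers for all `n`, so the two maps agree on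
them modulo every power of `p`. -/
theorem wittVector_ringHom_ext [IsHausdorff (Ideal.span {(p : A)}) A] {g g' : WittVector p R →+* A}
    (h : ∀ x, (p : A) ∣ g x - g' x) : g = g' := by
  have hmod : ∀ n : ℕ, (Ideal.Quotient.mk (Ideal.span {(p : A)} ^ n)).comp g =
      (Ideal.Quotient.mk (Ideal.span {(p : A)} ^ n)).comp g' := by
    intro n
    refine WittVector.eq_of_apply_teichmuller_eq _ _ ⟨n, ?_⟩ fun x => ?_
    · rw [← map_natCast (Ideal.Quotient.mk (Ideal.span {(p : A)} ^ n)), ← map_pow,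
        Ideal.Quotient.eq_zero_iff_mem]
      exact Ideal.pow_mem_pow (Ideal.mem_span_singleton_self _) n
    · obtain ⟨y, rfl⟩ := (iterateFrobeniusEquiv R p n).surjective x
      rw [iterateFrobeniusEquiv_def, map_pow, RingHom.comp_apply, RingHom.comp_apply, map_pow g,
        map_pow g', Ideal.Quotient.mk_eq_mk_iff_sub_mem, Ideal.span_singleton_pow,
        Ideal.mem_span_singleton]
      exact (pow_dvd_pow _ n.le_succ).trans (dvd_sub_pow_of_dvd_sub (h _) n)
  refine RingHom.ext fun x =>
    (IsHausdorff.eq_iff_smodEq (I := Ideal.span {(p : A)})).2 fun n => ?_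
  rw [smul_eq_mul, Ideal.mul_top, SModEq.sub_mem]
  exact (Ideal.Quotient.mk_eq_mk_iff_sub_mem _ _).1 (RingHom.congr_fun (hmod n) x)

theorem eq_of_coeff_zero_eq {e e' : A ≃+* WittVector p R}
    (h : ∀ a, (e' a).coeff 0 = (e a).coeff 0) : e' = e := by
  have hid : (e' : A →+* WittVector p R).comp (e.symm : WittVector p R →+* A) = .id _ :=
    wittVector_ringHom_ext fun x => by
      rw [← Ideal.mem_span_singleton, ← WittVector.ker_constantCoeff, RingHom.mem_ker, map_sub,
        sub_eq_zero]
      exact (h _).trans (congrArg (fun y => y.coeff 0) (e.apply_symm_apply x))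
  ext1 a
  simpa using RingHom.congr_fun hid (e a)

omit [Fact p.Prime] in
theorem isStrictPRing_of_ker_eq {A : Type} [CommRing A] {r : A →+* R}
    [IsAdicComplete (Ideal.span {(p : A)}) A] (hr : Function.Surjective r)
    (hker : RingHom.ker r = Ideal.span {(p : A)}) (hp : (p : A) ∈ nonZeroDivisors A) :
    IsStrictPRing p A := by
  let ρ : A ⧸ Ideal.span {(p : A)} ≃+* R :=
    (Ideal.quotEquivOfEq hker.symm).trans (RingHom.quotientKerEquivOfSurjective hr)
  refine ⟨hp, inferInstance,
    charP_of_injective_ringHom (f := (ρ.symm : R →+* _)) ρ.symm.injective p, ⟨?_⟩⟩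
  have hconj : (fun x : A ⧸ Ideal.span {(p : A)} => x ^ p) =
      ρ.symm ∘ (fun x : R => x ^ p) ∘ ρ := by
    funext x
    simp
  rw [hconj]
  exact ρ.symm.bijective.comp
    ((PerfectRing.bijective_frobenius (R := R) (p := p)).comp ρ.bijective)

end StrictPRing

section AdicHomeomorph

theorem isHomeomorph_of_eq_induced {X Y : Type*} (tX : TopologicalSpace X) (tY : TopologicalSpace Y)
    (e : X ≃ Y) (h : tX = tY.induced e) : @IsHomeomorph X Y tX tY e :=
  (Equiv.toHomeomorphOfIsInducing e ⟨h⟩).isHomeomorph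

theorem adicTopology_eq_induced_of_map_eq {A B : Type*} [CommRing A] [CommRing B] (e : A ≃+* B)
    {I : Ideal A} {J : Ideal B} (h : I.map (e : A →+* B) = J) :
    I.adicTopology = J.adicTopology.induced e := by
  let := J.adicTopology
  have : IsTopologicalRing B := isTopologicalRing_of_isAdic (I := J) rfl
  have hcomap : ∀ n, (J ^ n).comap (e : A →+* B) = I ^ n := fun n => by
    rw [← h, ← Ideal.map_pow]
    exact Ideal.comap_map_of_bijective _ e.bijective
  exact adicTopology_eq_induced_of_comap_le (f := (e : A →+* B)) J.hasBasis_nhds_zero_adic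
    (fun n => ⟨n, (hcomap n).ge⟩) fun n => (hcomap n).le

end AdicHomeomorph

section WittVectorTopology

open WittVector

variable {p : ℕ} [Fact p.Prime]

section Coeff

variable {R : Type*} [CommRing R] [CharP R p] [PerfectRing R p] {t : R}

theorem mem_span_p_pow_iff_forall_coeff_eq {x y : WittVector p R} {n : ℕ} :
    y - x ∈ Ideal.span {(p : WittVector p R) ^ n} ↔ ∀ i < n, y.coeff i = x.coeff i := by
  rw [mem_span_p_pow_iff_le_coeff_eq_zero, le_coeff_eq_iff_le_sub_coeff_eq_zero]

theorem coeff_sub_mem_of_sub_mem {x y : WittVector p R} {n M : ℕ}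
    (h : y - x ∈ Ideal.span {(p : WittVector p R) ^ n, teichmuller p t ^ M}) {i : ℕ} (hi : i < n) :
    y.coeff i - x.coeff i ∈ Ideal.span {t ^ M} := by
  obtain ⟨u, v, huv⟩ := Ideal.mem_span_pair.1 h
  have hp : y.coeff i = (x + v * teichmuller p t ^ M).coeff i := by
    refine mem_span_p_pow_iff_forall_coeff_eq.1 (Ideal.mem_span_singleton.2 ⟨u, ?_⟩) i hi
    linear_combination -huv
  have ht : map (Ideal.Quotient.mk (Ideal.span {t ^ M})) (x + v * teichmuller p t ^ M) =
      map (Ideal.Quotient.mk (Ideal.span {t ^ M})) x := by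
    rw [map_add, map_mul, ← map_pow, map_teichmuller,
      Ideal.Quotient.eq_zero_iff_mem.2 (Ideal.mem_span_singleton_self _), teichmuller_zero,
      mul_zero, add_zero]
  rw [← Ideal.Quotient.mk_eq_mk_iff_sub_mem, hp, ← map_coeff, ht, map_coeff]

omit [CharP R p] [PerfectRing R p] in
theorem coeff_sub_mem_of_forall_coeff_sub_mem {x y : WittVector p R} {I : Ideal R} {n : ℕ}
    (h : ∀ i < n, y.coeff i - x.coeff i ∈ I) {i : ℕ} (hi : i < n) : (y - x).coeff i ∈ I := by
  have hmap := (le_coeff_eq_iff_le_sub_coeff_eq_zero (x := map (Ideal.Quotient.mk I) y)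
    (y := map (Ideal.Quotient.mk I) x)).1 (fun j hj => by
      rw [map_coeff, map_coeff]
      exact (Ideal.Quotient.mk_eq_mk_iff_sub_mem _ _).2 (h j hj)) i hi
  rwa [← map_sub, map_coeff, Ideal.Quotient.eq_zero_iff_mem] at hmap

theorem pow_dvd_frobeniusEquiv_symm_pow {z : R} {M i n : ℕ} (hi : i ≤ n)
    (hz : t ^ (M * p ^ n) ∣ z) : t ^ M ∣ ((_root_.frobeniusEquiv R p).symm ^ i) z := by
  rw [← iterateFrobeniusEquiv_symm, ← map_dvd_iff (iterateFrobeniusEquiv R p i),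
    RingEquiv.apply_symm_apply, iterateFrobeniusEquiv_def, ← pow_mul]
  exact (pow_dvd_pow t (Nat.mul_le_mul_left M
    (Nat.pow_le_pow_right (Fact.out : p.Prime).pos hi))).trans hz

/-- Modulo `p ^ n`, a Witt vector is the sum of the `p ^ i [zᵢ ^ (1 / p ^ i)]` for `i < n`. -/
theorem mem_span_of_forall_coeff_mem {z : WittVector p R} {n M : ℕ}
    (h : ∀ i < n, z.coeff i ∈ Ideal.span {t ^ (M * p ^ n)}) :
    z ∈ Ideal.span {(p : WittVector p R) ^ n, teichmuller p t ^ M} := by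
  obtain _ | m := n
  · rw [pow_zero, (Ideal.eq_top_iff_one _).2 (Ideal.subset_span (Set.mem_insert _ _))]
    exact Submodule.mem_top
  have hterm : ∀ i ∈ Finset.Iic m,
      teichmuller p (((_root_.frobeniusEquiv R p).symm ^ i) (z.coeff i)) *
        (p : WittVector p R) ^ i ∈
      Ideal.span {(p : WittVector p R) ^ (m + 1), teichmuller p t ^ M} := fun i hi => by
    have hi : i < m + 1 := Nat.lt_succ_of_le (Finset.mem_Iic.1 hi)
    have hdvd := map_dvd (teichmuller p)
      (pow_dvd_frobeniusEquiv_symm_pow hi.le (Ideal.mem_span_singleton.1 (h i hi)))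
    rw [map_pow] at hdvd
    exact Ideal.mul_mem_right _ _
      (Ideal.mem_of_dvd _ hdvd (Ideal.subset_span (Set.mem_insert_of_mem _ rfl)))
  rw [← sub_add_cancel z]
  exact add_mem (Ideal.mem_of_dvd _ (dvd_sub_sum_teichmuller_iterateFrobeniusEquiv_coeff z m)
    (Ideal.subset_span (Set.mem_insert _ _))) (Ideal.sum_mem _ hterm)

end Coeff

variable {R : Type} [CommRing R] [CharP R p] [PerfectRing R p] (t : R)

theorem continuous_coeff_adicTopology (i : ℕ) :
    Continuous[(Ideal.span {(p : WittVector p R), teichmuller p t}).adicTopology,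
      (Ideal.span {t}).adicTopology] fun x : WittVector p R => x.coeff i := by
  let := (Ideal.span {(p : WittVector p R), teichmuller p t}).adicTopology
  let := (Ideal.span {t}).adicTopology
  refine continuous_iff_continuousAt.2 fun x =>
    ((Ideal.hasBasis_nhds_adic _ x).tendsto_iff (Ideal.hasBasis_nhds_adic _ _)).2
      fun N _ => ⟨i + 1 + N, trivial, ?_⟩
  rintro _ ⟨z, hz, rfl⟩
  refine ⟨(x + z).coeff i - x.coeff i, ?_, add_sub_cancel _ _⟩
  rw [Ideal.span_singleton_pow]
  refine coeff_sub_mem_of_sub_mem (n := i + 1) ?_ i.lt_succ_self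
  rw [add_sub_cancel_left]
  exact pow_span_pair_le _ _ _ _ hz

theorem wittProductTopology_le_adicTopology :
    wittProductTopology p (Ideal.span {t}).adicTopology ≤
      (Ideal.span {(p : WittVector p R), teichmuller p t}).adicTopology := by
  let := (Ideal.span {t}).adicTopology
  let := wittProductTopology p (Ideal.span {t}).adicTopology
  have hcont (i : ℕ) : Continuous fun x : WittVector p R => x.coeff i :=
    (continuous_apply i).comp continuous_induced_dom
  refine le_of_nhds_le_nhds fun x => (Ideal.hasBasis_nhds_adic _ x).ge_iff.2 fun n _ => ?_
  have hcoeff (i : ℕ) : ∀ᶠ y in 𝓝 x, y.coeff i - x.coeff i ∈ Ideal.span {t ^ (n * p ^ n)} := by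
    filter_upwards [(hcont i).tendsto x ((Ideal.hasBasis_nhds_adic _ _).mem_of_mem
      (i := n * p ^ n) trivial)]
    rintro y ⟨z, hz, hzy⟩
    rwa [← Ideal.span_singleton_pow, ← show x.coeff i + z = y.coeff i from hzy,
      add_sub_cancel_left]
  filter_upwards [(eventually_all_finset (Finset.range n)).2 fun i _ => hcoeff i] with y hy
  exact ⟨y - x, span_pair_pow_le _ _ _ (mem_span_of_forall_coeff_mem fun i hi =>
    coeff_sub_mem_of_forall_coeff_sub_mem (fun j hj => hy j (Finset.mem_range.2 hj)) hi),
    add_sub_cancel _ _⟩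

theorem adicTopology_eq_wittProductTopology :
    (Ideal.span {(p : WittVector p R), teichmuller p t}).adicTopology =
      wittProductTopology p (Ideal.span {t}).adicTopology := by
  refine le_antisymm ?_ (wittProductTopology_le_adicTopology t)
  let := (Ideal.span {(p : WittVector p R), teichmuller p t}).adicTopology
  let := (Ideal.span {t}).adicTopology
  exact continuous_iff_le_induced.1 (continuous_pi (continuous_coeff_adicTopology t))

theorem pAdicTopology_eq_wittProductTopology_bot :
    pAdicTopology p (WittVector p R) = wittProductTopology p ⊥ := by
  have hbot : (Ideal.span {(0 : R)}).adicTopology = ⊥ := by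
    let : TopologicalSpace R := ⊥
    have : DiscreteTopology R := ⟨rfl⟩
    rw [Ideal.span_singleton_eq_bot.2 rfl]
    exact (is_bot_adic_iff.2 this).symm
  rw [← hbot, ← adicTopology_eq_wittProductTopology, teichmuller_zero, Ideal.span_pair_zero]

end WittVectorTopology

section Roots

variable {A : Type*} [CommRing A] [IsDomain A]

theorem eq_of_pow_eq_of_odd {p : ℕ} (hprime : Prime (p : A)) (hodd : Odd p) {a b : A}
    (h : a ^ p = b ^ p) (hab : (p : A) ∣ a - b) (hb : ¬(p : A) ∣ b) : a = b := by
  by_contra hne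
  obtain ⟨c, hc⟩ := hab
  obtain rfl : a = b + p * c := sub_eq_iff_eq_add'.1 hc
  have hsum : ∑ i ∈ Finset.range p, (b + p * c) ^ i * b ^ (p - 1 - i) = 0 :=
    (mul_eq_zero.1 ((Commute.all (b + p * c) b).geom_sum₂_mul p |>.trans
      (sub_eq_zero.2 h))).resolve_right (sub_ne_zero.2 hne)
  -- The sum is congruent to `p * b ^ (p - 1)` modulo `p ^ 2`.
  have hdvd := odd_sq_dvd_geom_sum₂_sub b c hodd
  rw [hsum, zero_sub, dvd_neg, sq, mul_dvd_mul_iff_left hprime.ne_zero] at hdvd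
  exact hb (hprime.dvd_of_dvd_pow hdvd)

theorem eq_of_pow_pow_eq_of_odd {p : ℕ} (hprime : Prime (p : A)) (hodd : Odd p) {a b : A} (n : ℕ)
    (h : a ^ p ^ n = b ^ p ^ n) (hab : (p : A) ∣ a - b) (hb : ¬(p : A) ∣ b) : a = b := by
  induction n with
  | zero => simpa using h
  | succ n ih =>
    rw [pow_succ, pow_mul, pow_mul] at h
    exact ih (eq_of_pow_eq_of_odd hprime hodd h (hab.trans (sub_dvd_pow_sub_pow _ _ _))
      fun h => hb (hprime.dvd_of_dvd_pow h))

theorem dvd_of_sq_eq_neg_sq (hprime : Prime (2 : A)) {a b : A} (h : a ^ 2 = -b ^ 2)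
    (hab : 2 ∣ a - b) : 2 ∣ b := by
  obtain ⟨c, hc⟩ := hab
  obtain rfl : a = b + 2 * c := sub_eq_iff_eq_add'.1 hc
  have hzero : 2 * (b ^ 2 + 2 * (b * c + c ^ 2)) = 0 := by linear_combination h
  refine hprime.dvd_of_dvd_pow (n := 2) ⟨-(b * c + c ^ 2), ?_⟩
  linear_combination (mul_eq_zero.1 hzero).resolve_left hprime.ne_zero

theorem eq_or_eq_neg_of_pow_two_pow_eq (hprime : Prime (2 : A)) {a b : A} (n : ℕ)
    (h : a ^ 2 ^ (n + 1) = b ^ 2 ^ (n + 1)) (hab : 2 ∣ a - b) (hb : ¬2 ∣ b) :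
    a = b ∨ a = -b := by
  induction n with
  | zero => simpa using sq_eq_sq_iff_eq_or_eq_neg.1 h
  | succ n ih =>
    rw [pow_succ 2 (n + 1), pow_mul, pow_mul] at h
    refine (sq_eq_sq_iff_eq_or_eq_neg.1 h).elim ih fun h => absurd ?_ hb
    rw [pow_succ, pow_mul, pow_mul] at h
    exact hprime.dvd_of_dvd_pow
      (dvd_of_sq_eq_neg_sq hprime h (hab.trans (sub_dvd_pow_sub_pow a b (2 ^ n))))

end Roots

theorem PerfPoly.algHom_ext {p : ℕ} [Fact p.Prime] {R B : Type} [CommRing R] [CommRing B]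
    [Algebra R B] {g g' : PerfPoly R p →ₐ[R] B} (h : ∀ n, g (root R p n) = g' (root R p n)) :
    g = g' := by
  refine AlgHom.ext fun a => ?_
  obtain ⟨n, P, rfl⟩ := exists_aeval_root a
  rw [← Polynomial.aeval_algHom_apply, ← Polynomial.aeval_algHom_apply, h]

theorem PerfPoly.mapRingHom_root {p : ℕ} [Fact p.Prime] {R S : Type} [CommRing R] [CommRing S]
    (g : R →+* S) (n : ℕ) :
    AddMonoidAlgebra.mapRingHom (zInvNonneg p) g (root R p n) = root S p n := by
  rw [root, AddMonoidAlgebra.mapRingHom_single, map_one, root]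

namespace UnifMeasure

variable {p : ℕ} [Fact p.Prime]

theorem prime_natCast : Prime (p : UnifMeasure p ℤ_[p]) := by
  have := (reduction p).domain_nontrivial
  rw [← Ideal.span_singleton_prime (nonZeroDivisors.ne_zero natCast_mem_nonZeroDivisors),
    ← ker_reduction]
  exact RingHom.ker_isPrime _

theorem diracSub_zmod_ne_zero (n : ℕ) : diracSub p (ZMod p) n ≠ 0 := fun h =>
  not_isNilpotent_diracSub (p := p) ⟨1, by
    rw [pow_one, ← diracSub_pow_self n, h, zero_pow (pow_ne_zero n (Fact.out : p.Prime).ne_zero)]⟩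

/-- The element `T̃_n = e⁻¹ [t_n]`. -/
noncomputable def teichmullerDirac
    (e : UnifMeasure p ℤ_[p] ≃+* WittVector p (UnifMeasure p (ZMod p))) (n : ℕ) :
    UnifMeasure p ℤ_[p] :=
  e.symm (WittVector.teichmuller p (diracSub p (ZMod p) n))

/-- The map `ℤ[X^{1/p^∞}] → D_unif(ℚ_p, ℤ_p)`, `X^{1/p^n} ↦ T̃_n`. -/
noncomputable def ofPerfPolyInt
    (e : UnifMeasure p ℤ_[p] ≃+* WittVector p (UnifMeasure p (ZMod p))) :
    PerfPoly ℤ p →ₐ[ℤ] UnifMeasure p ℤ_[p] :=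
  PerfPoly.eval ℤ (teichmullerDirac e) fun n => by
    rw [teichmullerDirac, ← map_pow, ← map_pow, diracSub_succ_pow, teichmullerDirac]

section Witt

variable {e : UnifMeasure p ℤ_[p] ≃+* WittVector p (UnifMeasure p (ZMod p))}

theorem apply_teichmullerDirac (n : ℕ) :
    e (teichmullerDirac e n) = WittVector.teichmuller p (diracSub p (ZMod p) n) :=
  e.apply_symm_apply _

theorem ofPerfPolyInt_root (n : ℕ) :
    ofPerfPolyInt e (PerfPoly.root ℤ p n) = teichmullerDirac e n :=
  PerfPoly.eval_root _ _ _ n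

theorem teichmullerDirac_succ_pow (n : ℕ) :
    teichmullerDirac e (n + 1) ^ p = teichmullerDirac e n := by
  rw [← ofPerfPolyInt_root, ← map_pow, PerfPoly.root_succ_pow, ofPerfPolyInt_root]

theorem teichmullerDirac_pow_self (n : ℕ) :
    teichmullerDirac e n ^ p ^ n = teichmullerDirac e 0 := by
  simpa using PerfPoly.pow_prime_pow_eq _ (teichmullerDirac_succ_pow (e := e)) 0 n

theorem pAdicTopology_eq_induced :
    pAdicTopology p (UnifMeasure p ℤ_[p]) =
      (pAdicTopology p (WittVector p (UnifMeasure p (ZMod p)))).induced e :=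
  adicTopology_eq_induced_of_map_eq e (by rw [Ideal.map_span, Set.image_singleton, map_natCast])

variable (he : ∀ μ, (e μ).coeff 0 = reduction p μ)
include he

theorem reduction_teichmullerDirac (n : ℕ) :
    reduction p (teichmullerDirac e n) = diracSub p (ZMod p) n := by
  rw [← he, apply_teichmullerDirac, WittVector.teichmuller_coeff_zero]

theorem natCast_dvd_diracSub_sub_teichmullerDirac (n : ℕ) :
    (p : UnifMeasure p ℤ_[p]) ∣ diracSub p ℤ_[p] n - teichmullerDirac e n := by
  rw [← reduction_eq_zero_iff, map_sub, reduction_diracSub, reduction_teichmullerDirac he, sub_self]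

theorem not_natCast_dvd_teichmullerDirac (n : ℕ) :
    ¬(p : UnifMeasure p ℤ_[p]) ∣ teichmullerDirac e n := by
  rw [← reduction_eq_zero_iff, reduction_teichmullerDirac he]
  exact diracSub_zmod_ne_zero n

theorem tendsto_diracSub_pow (n : ℕ) :
    Tendsto (fun m => diracSub p ℤ_[p] (n + m) ^ p ^ m) atTop
      (@nhds _ (pAdicTopology p (UnifMeasure p ℤ_[p])) (teichmullerDirac e n)) := by
  refine (Ideal.hasBasis_nhds_adic _ _).tendsto_right_iff.2 fun N _ => ?_
  filter_upwards [eventually_ge_atTop N] with m hm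
  refine ⟨diracSub p ℤ_[p] (n + m) ^ p ^ m - teichmullerDirac e n, ?_, add_sub_cancel _ _⟩
  rw [Ideal.span_singleton_pow,
    ← PerfPoly.pow_prime_pow_eq _ (teichmullerDirac_succ_pow (e := e)) n m]
  exact Ideal.mem_span_singleton.2 ((pow_dvd_pow _ (hm.trans m.le_succ)).trans
    (dvd_sub_pow_of_dvd_sub (natCast_dvd_diracSub_sub_teichmullerDirac he (n + m)) m))

theorem isAdic_span_teichmullerDirac :
    IsAdic (Ideal.span {(p : UnifMeasure p ℤ_[p]), teichmullerDirac e 0}) := by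
  obtain ⟨c, hc⟩ := natCast_dvd_diracSub_sub_teichmullerDirac he 0
  have hspan : Ideal.span {(p : UnifMeasure p ℤ_[p]), teichmullerDirac e 0} =
      Ideal.span {(p : UnifMeasure p ℤ_[p]), diracSub p ℤ_[p] 0} := by
    rw [sub_eq_iff_eq_add'.1 hc, mul_comm, Ideal.span_pair_add_mul_left]
  rw [hspan]
  exact isAdic_span_diracSub (isAdic_span_padicInt p)

theorem natCast_dvd_sub_teichmullerDirac {n : ℕ} {x : UnifMeasure p ℤ_[p]}
    (hx : x ^ p ^ n = teichmullerDirac e 0) :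
    (p : UnifMeasure p ℤ_[p]) ∣ x - teichmullerDirac e n := by
  have hred : reduction p x = diracSub p (ZMod p) n := by
    refine iterateFrobenius_inj (UnifMeasure p (ZMod p)) p n ?_
    rw [iterateFrobenius_def, iterateFrobenius_def, ← map_pow, hx, reduction_teichmullerDirac he,
      diracSub_pow_self]
  rw [← reduction_eq_zero_iff, map_sub, hred, reduction_teichmullerDirac he, sub_self]

theorem pow_eq_teichmullerDirac_iff (n : ℕ) (hn : 1 ≤ n) (x : UnifMeasure p ℤ_[p]) :
    x ^ p ^ n = teichmullerDirac e 0 ↔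
      x = teichmullerDirac e n ∨ p = 2 ∧ x = -teichmullerDirac e n := by
  have : IsDomain (UnifMeasure p ℤ_[p]) := e.toMulEquiv.isDomain _
  refine ⟨fun hx => ?_, ?_⟩
  · have hdvd := natCast_dvd_sub_teichmullerDirac he hx
    have hndvd := not_natCast_dvd_teichmullerDirac he n
    rw [← teichmullerDirac_pow_self n] at hx
    obtain rfl | hodd := (Fact.out : p.Prime).eq_two_or_odd'
    · obtain ⟨m, rfl⟩ := Nat.exists_eq_add_of_le' hn
      exact (eq_or_eq_neg_of_pow_two_pow_eq prime_natCast m hx hdvd hndvd).imp_right (⟨rfl, ·⟩)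
    · exact Or.inl (eq_of_pow_pow_eq_of_odd prime_natCast hodd n hx hdvd hndvd)
  · rintro (rfl | ⟨hp, rfl⟩)
    · exact teichmullerDirac_pow_self n
    · have heven : Even (p ^ n) := (hp ▸ even_two).pow_of_ne_zero (Nat.one_le_iff_ne_zero.1 hn)
      exact (heven.neg_pow _).trans (teichmullerDirac_pow_self n)

theorem reduction_comp_ofPerfPolyInt :
    (reduction p).comp (ofPerfPolyInt e : PerfPoly ℤ p →+* UnifMeasure p ℤ_[p]) =
      (ofPerfPoly p : PerfPoly (ZMod p) p →+* UnifMeasure p (ZMod p)).comp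
        (AddMonoidAlgebra.mapRingHom _ (Int.castRingHom (ZMod p))) := by
  refine RingHom.toIntAlgHom_injective (PerfPoly.algHom_ext fun n => ?_)
  calc reduction p (ofPerfPolyInt e (PerfPoly.root ℤ p n))
    _ = ofPerfPoly p (PerfPoly.root (ZMod p) p n) := by
      rw [ofPerfPolyInt_root, reduction_teichmullerDirac he, ofPerfPoly_root]
    _ = ofPerfPoly p (AddMonoidAlgebra.mapRingHom _ (Int.castRingHom (ZMod p)) _) := by
      rw [PerfPoly.mapRingHom_root]

theorem ofPerfPolyInt_injective : Function.Injective (ofPerfPolyInt e) := by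
  have := isHausdorff_span_natCast (G := zInvNonneg p) (Fact.out : p.Prime).ne_one
  exact injective_of_injective_of_ker_eq_span
    (f := (ofPerfPolyInt e : PerfPoly ℤ p →+* UnifMeasure p ℤ_[p]))
    (reduction_comp_ofPerfPolyInt he) (ker_mapRingHom_intCast p)
    (by rw [map_natCast]; exact natCast_mem_nonZeroDivisors) ofPerfPoly_injective

theorem isRingCompletion_ofPerfPolyInt :
    IsRingCompletion (Ideal.span {(p : PerfPoly ℤ p), PerfPoly.root ℤ p 0}).adicTopology
      (ofPerfPolyInt e : PerfPoly ℤ p →+* UnifMeasure p ℤ_[p]) := by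
  have hroot : (ofPerfPolyInt e : PerfPoly ℤ p →+* _) (PerfPoly.root ℤ p 0) =
      teichmullerDirac e 0 := ofPerfPolyInt_root 0
  have hred := reduction_teichmullerDirac he 0
  refine isRingCompletion_of_reduction (reduction_comp_ofPerfPolyInt he)
    (AddMonoidAlgebra.map_surjective _ ZMod.intCast_surjective) reduction_surjective
    (ker_mapRingHom_intCast p) ?_ ?_ ?_ ?_ ?_ ?_
  · rw [map_natCast, ker_reduction]
  · rw [map_natCast]
    exact natCast_mem_nonZeroDivisors
  · rw [hroot, hred]
    exact diracSub_zmod_ne_zero 0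
  · rw [hroot, hred, PerfPoly.mapRingHom_root]
    exact comap_ofPerfPoly_le
  · rw [hroot, hred, ← pow_one (Ideal.span _)]
    exact exists_sub_ofPerfPoly_mem 1
  · rw [map_natCast, hroot]
    exact isAdic_span_teichmullerDirac he

theorem topology_eq_induced_wittProductTopology :
    (inferInstance : TopologicalSpace (UnifMeasure p ℤ_[p])) =
      (wittProductTopology p (R := UnifMeasure p (ZMod p)) inferInstance).induced e := by
  have hmap : (Ideal.span {(p : UnifMeasure p ℤ_[p]), teichmullerDirac e 0}).map (e : _ →+* _) =
      Ideal.span {(p : WittVector p (UnifMeasure p (ZMod p))),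
        WittVector.teichmuller p (diracSub p (ZMod p) 0)} := by
    rw [Ideal.map_span, Set.image_pair, map_natCast, ← apply_teichmullerDirac (e := e) 0]
    rfl
  calc (inferInstance : TopologicalSpace (UnifMeasure p ℤ_[p]))
    _ = (Ideal.span {(p : UnifMeasure p ℤ_[p]), teichmullerDirac e 0}).adicTopology :=
      isAdic_span_teichmullerDirac he
    _ = _ := adicTopology_eq_induced_of_map_eq e hmap
    _ = (wittProductTopology p (Ideal.span {diracSub p (ZMod p) 0}).adicTopology).induced e := by
      rw [adicTopology_eq_wittProductTopology]
    _ = _ := by rw [← isAdic_span_diracSub_zmod]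

end Witt

end UnifMeasure

/-- The isomorphism of rings of Witt vectors induced by an isomorphism of rings; it transports
`A_inf` along the identification of the completion of `𝔽_p[t^{1/p^∞}]` with the measures. -/
noncomputable def wittVectorMapEquiv (p : ℕ) [Fact p.Prime] {R S : Type*} [CommRing R] [CommRing S]
    (j : R ≃+* S) : WittVector p R ≃+* WittVector p S :=
  RingEquiv.ofRingHom (WittVector.map (j : R →+* S)) (WittVector.map (j.symm : S →+* R))
    (by ext; simp [WittVector.map_coeff]) (by ext; simp [WittVector.map_coeff])

theorem proposition8p2 (p : ℕ) [Fact p.Prime] :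
    ∃ (φ : PerfPoly (ZMod p) p →+* UnifMeasure p (ZMod p))
      (j : PerfPoly.Completion p ≃+* UnifMeasure p (ZMod p))
      (e : UnifMeasure p ℤ_[p] ≃+* WittVector p (UnifMeasure p (ZMod p)))
      (Tt : ℕ → UnifMeasure p ℤ_[p])
      (ψ : PerfPoly ℤ p →+* UnifMeasure p ℤ_[p]),
    -- (1) `D_unif(ℚ_p, 𝔽_p)`; its natural topology is the `t`-adic one, `t = δ_1 - δ_0`
    (IsAdic (Ideal.span {UnifMeasure.diracSub p (ZMod p) 0}) ∧
      -- completion of `𝔽_p[ℚ_p]` for the topology given by the powers of `t` in the measures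
      Function.Injective (UnifMeasure.ofGroupAlgebra p (ZMod p) (ZMod p)) ∧
      IsRingCompletion
        ((Ideal.span {UnifMeasure.diracSub p (ZMod p) 0}).adicTopology.induced
          (UnifMeasure.ofGroupAlgebra p (ZMod p) (ZMod p)))
        (UnifMeasure.ofGroupAlgebra p (ZMod p) (ZMod p)) ∧
      -- completion of `𝔽_p[ℤ[1/p]]` in its own `(δ_1 - δ_0)`-adic topology
      Function.Injective (UnifMeasure.ofGroupAlgebraZInv p (ZMod p) (ZMod p)) ∧
      IsRingCompletion
        (Ideal.span {(AddMonoidAlgebra.single (UnifMeasure.zInvOne p) 1 -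
          AddMonoidAlgebra.single 0 1 :
            AddMonoidAlgebra (ZMod p) (UnifMeasure.zInv p))}).adicTopology
        (UnifMeasure.ofGroupAlgebraZInv p (ZMod p) (ZMod p)) ∧
      -- completion of `𝔽_p[t^{1/p^∞}]` in its `t`-adic topology
      (∀ n, φ (PerfPoly.root (ZMod p) p n) = UnifMeasure.diracSub p (ZMod p) n) ∧
      Function.Injective φ ∧
      IsRingCompletion (Ideal.span {PerfPoly.root (ZMod p) p 0}).adicTopology φ ∧
      (∀ x, j (AdicCompletion.of _ _ x) = φ x) ∧
      CharP (UnifMeasure p (ZMod p)) p ∧ PerfectRing (UnifMeasure p (ZMod p)) p) ∧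
    -- (2) `D_unif(ℚ_p, ℤ_p)` is a strict `p`-ring with residue ring `D_unif(ℚ_p, 𝔽_p)`
    (IsStrictPRing p (UnifMeasure p ℤ_[p]) ∧
      Function.Surjective (UnifMeasure.reduction p) ∧
      RingHom.ker (UnifMeasure.reduction p) = Ideal.span {(p : UnifMeasure p ℤ_[p])} ∧
      (∀ μ, (e μ).coeff 0 = UnifMeasure.reduction p μ) ∧
      (∀ e' : UnifMeasure p ℤ_[p] ≃+* WittVector p (UnifMeasure p (ZMod p)),
        (∀ μ, (e' μ).coeff 0 = UnifMeasure.reduction p μ) → e' = e) ∧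
      ∃ E : UnifMeasure p ℤ_[p] ≃+* Ainf p, ∀ μ, WittVector.map (j : _ →+* _) (E μ) = e μ) ∧
    -- (3) the natural topology of `D_unif(ℚ_p, ℤ_p)` is the `(p, T)`-adic one, `T = Δ_1 - Δ_0`
    (IsAdic (Ideal.span {(p : UnifMeasure p ℤ_[p]), UnifMeasure.diracSub p ℤ_[p] 0}) ∧
      -- completion of `ℤ[ℚ_p]` for the topology given by the powers of `(p, T)` in the measures
      Function.Injective (UnifMeasure.ofGroupAlgebra p ℤ ℤ_[p]) ∧
      IsRingCompletion
        ((Ideal.span {(p : UnifMeasure p ℤ_[p]),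
            UnifMeasure.diracSub p ℤ_[p] 0}).adicTopology.induced
          (UnifMeasure.ofGroupAlgebra p ℤ ℤ_[p]))
        (UnifMeasure.ofGroupAlgebra p ℤ ℤ_[p]) ∧
      -- completion of `ℤ[ℤ[1/p]]` in its own `(p, Δ_1 - Δ_0)`-adic topology
      Function.Injective (UnifMeasure.ofGroupAlgebraZInv p ℤ ℤ_[p]) ∧
      IsRingCompletion
        (Ideal.span {(p : AddMonoidAlgebra ℤ (UnifMeasure.zInv p)),
          AddMonoidAlgebra.single (UnifMeasure.zInvOne p) 1 -
            AddMonoidAlgebra.single 0 1}).adicTopology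
        (UnifMeasure.ofGroupAlgebraZInv p ℤ ℤ_[p])) ∧
    -- (4) the elements `T̃_n = lim_m (Δ_{1/p^{n+m}} - Δ_0)^{p^m} = [δ_{1/p^n} - δ_0] = [t^{1/p^n}]`
    ((∀ n, Filter.Tendsto (fun m => UnifMeasure.diracSub p ℤ_[p] (n + m) ^ p ^ m) Filter.atTop
        (@nhds _ (pAdicTopology p (UnifMeasure p ℤ_[p])) (Tt n))) ∧
      (∀ n, e (Tt n) = WittVector.teichmuller p (UnifMeasure.diracSub p (ZMod p) n)) ∧
      (∀ n, UnifMeasure.diracSub p (ZMod p) n ^ p ^ n = UnifMeasure.diracSub p (ZMod p) 0) ∧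
      (∀ n, 1 ≤ n → ∀ x : UnifMeasure p ℤ_[p],
        x ^ p ^ n = Tt 0 ↔ x = Tt n ∨ p = 2 ∧ x = -Tt n) ∧
      (∀ n, ψ (PerfPoly.root ℤ p n) = Tt n) ∧
      Function.Injective ψ ∧
      IsRingCompletion
        (Ideal.span {(p : PerfPoly ℤ p), PerfPoly.root ℤ p 0}).adicTopology ψ ∧
      IsAdic (Ideal.span {(p : UnifMeasure p ℤ_[p]), Tt 0})) ∧
    -- (5) the identification with the Witt vectors is topological in two ways
    -- (a) `p`-adic topologies; equivalently, on Witt vectors, the product of discrete topologies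
    (@IsHomeomorph _ _ (pAdicTopology p _) (pAdicTopology p _) e ∧
      @IsHomeomorph _ _ (pAdicTopology p _) (wittProductTopology p ⊥) e ∧
      -- (b) natural topologies; on Witt vectors, the product of the natural topologies
      @IsHomeomorph _ _ inferInstance (wittProductTopology p inferInstance) e) := by
  open UnifMeasure in
  obtain ⟨j, hj⟩ := exists_completion_ringEquiv (p := p)
  obtain ⟨e, he⟩ := exists_ringEquiv_wittVector (r := reduction p)
    reduction_surjective ker_reduction natCast_mem_nonZeroDivisors
  have hp : IsAdic (Ideal.span {(p : ℤ_[p])}) := isAdic_span_padicInt p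
  have hℤ : Function.Injective (algebraMap ℤ ℤ_[p]) := (algebraMap ℤ ℤ_[p]).injective_int
  refine ⟨(ofPerfPoly p).toRingHom, j, e, teichmullerDirac e, (ofPerfPolyInt e).toRingHom,
    ?_, ?_, ?_, ?_, ?_⟩
  · exact ⟨isAdic_span_diracSub_zmod, ofGroupAlgebra_injective Function.injective_id,
      isRingCompletion_ofGroupAlgebra_zmod, ofGroupAlgebraZInv_injective Function.injective_id,
      isRingCompletion_ofGroupAlgebraZInv_zmod, ofPerfPoly_root, ofPerfPoly_injective,
      isRingCompletion_ofPerfPoly, hj, inferInstance, inferInstance⟩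
  · exact ⟨isStrictPRing_of_ker_eq reduction_surjective ker_reduction natCast_mem_nonZeroDivisors,
      reduction_surjective, ker_reduction, he,
      fun e' he' => eq_of_coeff_zero_eq fun μ => (he' μ).trans (he μ).symm,
      e.trans (wittVectorMapEquiv p j).symm,
      fun μ => (wittVectorMapEquiv p j).apply_symm_apply (e μ)⟩
  · exact ⟨isAdic_span_diracSub hp, ofGroupAlgebra_injective hℤ,
      isRingCompletion_ofGroupAlgebra hp PadicInt.denseRange_intCast,
      ofGroupAlgebraZInv_injective hℤ, isRingCompletion_ofGroupAlgebraZInv hp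
        PadicInt.denseRange_intCast (comap_span_padicInt_le p)⟩
  · exact ⟨tendsto_diracSub_pow he, apply_teichmullerDirac, diracSub_pow_self,
      pow_eq_teichmullerDirac_iff he, ofPerfPolyInt_root, ofPerfPolyInt_injective he,
      isRingCompletion_ofPerfPolyInt he, isAdic_span_teichmullerDirac he⟩
  · exact ⟨isHomeomorph_of_eq_induced _ _ e.toEquiv pAdicTopology_eq_induced,
      isHomeomorph_of_eq_induced _ _ e.toEquiv
        (pAdicTopology_eq_wittProductTopology_bot (p := p) (R := UnifMeasure p (ZMod p)) ▸
          pAdicTopology_eq_induced),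
      isHomeomorph_of_eq_induced _ _ e.toEquiv (topology_eq_induced_wittProductTopology he)⟩
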